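/- **Setting.** Let $d\ge 3$. Let $B(n)=\{x\in\mathbb Z^d:\|x\|_\infty\le n\}$. A function $f$ of $n$ is called *s.e.-small* if there are constants $c_1,c_2,c_3>0$ with $0\le f(n)\le c_1e^{-c_2n^{c_3}}$ for all integers $n\ge 1$. For $h<\frac2d$ put $$\beta(d,h)=\min\Big\{k\ge 1:\ \frac{dh}{2}+\Big(d-3+h-\frac{dh}{2}\Big)\Big(1-\frac2d\Big)^{k-1}<1\Big\}.$$ Fix $h<\frac2d$, constants $M,C_5,C_6>0$, and s.e.-small functions $\varepsilon_1,\varepsilon_2$. For $n\ge1$ let $\hat\eta_1\le\hat\eta_2$ be random variables with values in the non-negative integers such that $$P\big[\hat\eta_1\ge C_5n^{d-2-h}\big]\ge 1-\varepsilon_1(n),\qquad P\big[\hat\eta_2\le C_6n^{M}\big]\ge 1-\varepsilon_2(n).$$ Let $X^{(1)},X^{(2)},\dots$, defined on the same probability space, be simple random walks on $\mathbb Z^d$ that are independent given their (deterministic or random) starting points, with $X^{(k)}_0\in B(n)$ for all $k\le\hat\eta_2$. Only the walks $X^{(k)}$ with $k\le\hat\eta_2$ matter below. Write $R_k(m)=\{X^{(k)}_0,\dots,X^{(k)}_m\}$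 and $$L_k=\Big\{m\ge1:\ \{X^{(k)}_{3mn^2},\dots,X^{(k)}_{3(m+1)n^2-1}\}\cap B(n)\ne\emptyset\Big\}.$$ Say that $X^{(i)}$ and $X^{(j)}$ are *$(s,m)$-connected* if there are indices $i=k_0,k_1,\dots,k_s=j$, all at most $\hat\eta_1$, with $R_{k_t}(m)\cap R_{k_{t-1}}(m)\neq\emptyset$ for $t=1,\dots,s$. **Proposition.** There is an s.e.-small function $\varepsilon$, depending only on $d,h,M,C_5,C_6,\varepsilon_1,\varepsilon_2$ (and not on $n$, the starting points, or the joint law of $\hat\eta_1,\hat\eta_2$ and the walks), such that for every $n\ge 1$ and all $\hat\eta_1,\hat\eta_2,X^{(k)}$ as above $$P\big[\forall i,j\le\hat\eta_1:\ X^{(i)}\text{ and }X^{(j)}\text{ are }(2\beta(d,h)+1,\,2n^2)\text{-connected}\big]\ge 1-\varepsilon(n),$$ $$P\big[\forall i\le\hat\eta_2\ \exists j\le\hat\eta_1:\ R_i(n^2)\cap R_j(2n^2)\ne\emptyset\big]\ge 1-\varepsilon(n),$$ $$P\big[\forall i\le\hat\eta_2\ \forall m\in L_i\ \exists j\le\hat\eta_1:\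 \{X^{(i)}_{3mn^2},\dots,X^{(i)}_{3(m+1)n^2-1}\}\cap R_j(2n^2)\ne\emptyset\big]\ge 1-\varepsilon(n).$$ -/

import Mathlib

open MeasureTheory ProbabilityTheory

namespace WalkIntersections

/-- The lattice `ℤ^d`. Its metric in Mathlib is the one of the `ℓ_∞`-norm. -/
abbrev Lattice (d : ℕ) : Type := Fin d → ℤ

/-- `B(r)`, the closed `ℓ_∞`-ball of radius `r` around the origin of `ℤ^d`. -/
def box (d : ℕ) (r : ℝ) : Set (Lattice d) := Metric.closedBall 0 r

/-- `f` is stretched-exponentially small: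
`0 ≤ f n ≤ c₁ exp (-c₂ n ^ c₃)` for all `n ≥ 1`, with positive constants `c₁, c₂, c₃`. -/
def SESmall (f : ℕ → ℝ) : Prop :=
  ∃ c₁ c₂ c₃ : ℝ, 0 < c₁ ∧ 0 < c₂ ∧ 0 < c₃ ∧
    ∀ n : ℕ, 1 ≤ n → 0 ≤ f n ∧ f n ≤ c₁ * Real.exp (-c₂ * (n : ℝ) ^ c₃)

/-- `X k m ω` is the position at time `m` of the walk number `k = 0, 1, 2, …`.
The walks are simple random walks on `ℤ^d`, independent given their starting points:
all increments of all walks are independent, each is uniform on the `2d` vectors of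
`ℓ_1`-norm one, and the family of increments is independent of the family of starting points
(which may in particular be deterministic). -/
structure IndepSimpleRandomWalks {d : ℕ} {Ω : Type*} [MeasurableSpace Ω] (μ : Measure Ω)
    (X : ℕ → ℕ → Ω → Lattice d) : Prop where
  measurable : ∀ k m, Measurable (X k m)
  step_law : ∀ (k m : ℕ) (v : Lattice d), ∑ i, |v i| = 1 →
    μ.real {ω | X k (m + 1) ω - X k m ω = v} = 1 / (2 * (d : ℝ))
  steps_indep : iIndepFun (fun (p : ℕ × ℕ) ω => X p.1 (p.2 + 1) ω - X p.1 p.2 ω) μ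
  starts_indep_steps : IndepFun (fun ω (k : ℕ) => X k 0 ω)
    (fun ω (p : ℕ × ℕ) => X p.1 (p.2 + 1) ω - X p.1 p.2 ω) μ

/-- `R(m) = {x_0, …, x_m}`, the sites visited by the trajectory `x` until time `m`. -/
def visited {d : ℕ} (x : ℕ → Lattice d) (m : ℕ) : Set (Lattice d) :=
  {y | ∃ t : ℕ, t ≤ m ∧ x t = y}

/-- The piece `{x_{3mn²}, …, x_{3(m+1)n²-1}}` of the trajectory `x`. -/
def piece {d : ℕ} (x : ℕ → Lattice d) (n m : ℕ) : Set (Lattice d) :=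
  {y | ∃ t : ℕ, 3 * m * n ^ 2 ≤ t ∧ t < 3 * (m + 1) * n ^ 2 ∧ x t = y}

/-- The set `L` of all `m ≥ 1` such that the piece number `m` of the trajectory `x`
meets `B(n)`. -/
def returnPieces {d : ℕ} (x : ℕ → Lattice d) (n : ℕ) : Set ℕ :=
  {m | 1 ≤ m ∧ (piece x n m ∩ box d n).Nonempty}

/-- Among the first `N` trajectories `x 0, …, x (N - 1)`, the trajectories number `i` and `j`
are `(s, m)`-connected: there are indices `i = k_0, k_1, …, k_s = j`, all `< N`, such that the
first `m` steps of consecutive trajectories have a common site. -/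
def ChainConnected {d : ℕ} (x : ℕ → ℕ → Lattice d) (N s m i j : ℕ) : Prop :=
  ∃ k : ℕ → ℕ, k 0 = i ∧ k s = j ∧ (∀ t ≤ s, k t < N) ∧
    ∀ t < s, (visited (x (k (t + 1))) m ∩ visited (x (k t)) m).Nonempty

/-- The condition on `k` in the definition of `β(d,h)`. -/
def BetaCondition (d : ℕ) (h : ℝ) (k : ℕ) : Prop :=
  1 ≤ k ∧
    (d : ℝ) * h / 2 + ((d : ℝ) - 3 + h - (d : ℝ) * h / 2) * (1 - 2 / (d : ℝ)) ^ (k - 1) < 1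

/-- `β(d,h)`, the least `k ≥ 1` with
`dh/2 + (d - 3 + h - dh/2) (1 - 2/d)^(k-1) < 1`. -/
noncomputable def beta (d : ℕ) (h : ℝ) : ℕ := sInf {k | BetaCondition d h k}

/-- The minimum in the definition of `β(d,h)` is over a non-empty set. -/
theorem exists_betaCondition {d : ℕ} (hd : 3 ≤ d) {h : ℝ} (hh : h < 2 / (d : ℝ)) :
    ∃ k, BetaCondition d h k := by
  have hd' : (3 : ℝ) ≤ d := by exact_mod_cast hd
  have h0 : (0 : ℝ) ≤ 1 - 2 / (d : ℝ) := by
    rw [sub_nonneg, div_le_one (by linarith)]; linarith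
  have h1 : 1 - 2 / (d : ℝ) < 1 := by
    have : 0 < 2 / (d : ℝ) := by positivity
    linarith
  have h2 : (d : ℝ) * h / 2 < 1 := by
    rw [lt_div_iff₀ (by linarith)] at hh; linarith
  have ht := ((tendsto_pow_atTop_nhds_zero_of_lt_one h0 h1).const_mul
    ((d : ℝ) - 3 + h - (d : ℝ) * h / 2)).const_add ((d : ℝ) * h / 2)
  rw [mul_zero, add_zero] at ht
  obtain ⟨k, hk⟩ := (ht.eventually (gt_mem_nhds h2)).exists
  exact ⟨k + 1, by omega, by simpa using hk⟩

theorem beta_spec {d : ℕ} (hd : 3 ≤ d) {h : ℝ} (hh : h < 2 / (d : ℝ)) :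
    BetaCondition d h (beta d h) := Nat.sInf_mem (exists_betaCondition hd hh)

end WalkIntersections

/-!
The capacity of a finite family of points is the square of their number over their energy with
respect to the Green function of the walk killed at time `n ^ 2`. Everything rests on two facts of
potential theory.

* A walk that starts at distance of order `n` from a family of capacity `κ` hits it within `n ^ 2`
  steps with probability at least of order `κ n ^ (2 - d)`; this is the second moment method
  (`exists_hits_ge`).
* If many independent walks have this chance, with an expected number `P ≥ 1` of hits, then with a
  probability bounded from below the later paths of those that hit have capacity at least of order
  `min (n P) (n ^ (d - 2))` (`exists_generation`).

A path of about `n ^ 2` steps contains a piece of capacity almost `n`, except with a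
stretched-exponentially small probability: cut the path into `n ^ δ` independent pieces, and use
the inequality of Markov for the energy of each of them (`exists_seed`). So each of the
`n ^ (d - 2 - h)` walks hits a given path with probability almost `n ^ (3 - d)`, and since `h < 1` it
is very unlikely that none of them does (`exists_meet`). This gives the second and the third claim.
For the third one, the probability that a walk is in the box at time `t` decays as `t ^ (-3 / 2)`,
so that the failures can be summed over all times.

For the first claim, start with the path of walk `i`, of capacity `n ^ (1 - 2δ)`. The walks that
hit it form a first generation, the walks that hit this generation form a second one, and so on,
each time with fresh walks; to get small failure probabilities each generation uses `n ^ δ`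
independent groups (`exists_reaches_succ`). Every generation multiplies the capacity by almost
`n ^ (1 - h)`, until it is almost `n ^ (d - 2)`. After `2β - 1` generations the product of the
capacity with the capacity of the path of walk `j` and with the number of walks beats
`n ^ (2 (d - 2))`, and then some fresh walk hits first the last generation and then the path of `j`
(`exists_chain_end`, `exists_chain`). That `2β - 1` generations are enough is the inequality
`d - 3 < 2β (1 - h)`, which follows from the definition of `β` by Bernoulli's inequality
(`lt_two_mul_of_betaCondition`).

All these estimates are made for deterministic starting points in a finite model, where finitely
many steps with labels (walk, time) are uniformly distributed, so that expectations are finite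
averages and independence is an exchange of coordinates (`mean_decouple`). They hold for the
random walks because an event that depends on finitely many steps and starting points has at most
the largest of its probabilities in the model (`measureReal_le_of_mean_le`).

The local estimates for the heat kernel come from the one-dimensional walk, as the coordinates are
independent given how many steps each of them makes (`heatKernel_eq_countMean`).
-/

namespace WalkIntersections

/-! ### Averages and iterated averages -/

/-- The indicator of a proposition, as a real number. -/
noncomputable def ind (p : Prop) : ℝ := by classical exact if p then 1 else 0

@[simp] theorem ind_true {p : Prop} (h : p) : ind p = 1 := by simp [ind, h]
@[simp] theorem ind_false {p : Prop} (h : ¬p) : ind p = 0 := by simp [ind, h]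
theorem ind_nonneg (p : Prop) : 0 ≤ ind p := by unfold ind; split_ifs <;> norm_num
theorem ind_le_one (p : Prop) : ind p ≤ 1 := by unfold ind; split_ifs <;> norm_num
theorem ind_mono {p q : Prop} (h : p → q) : ind p ≤ ind q := by
  by_cases hp : p
  · simp [hp, h hp]
  · simp [hp, ind_nonneg]
theorem ind_and (p q : Prop) : ind (p ∧ q) = ind p * ind q := by
  by_cases hp : p <;> by_cases hq : q <;> simp [hp, hq]
theorem ind_congr {p q : Prop} (h : p ↔ q) : ind p = ind q := by rw [propext h]
theorem ind_or_le (p q : Prop) : ind (p ∨ q) ≤ ind p + ind q := by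
  by_cases hp : p <;> by_cases hq : q <;> simp [hp, hq]
theorem ind_not (p : Prop) : ind (¬p) = 1 - ind p := by
  by_cases hp : p <;> simp [hp]
theorem ind_exists_le {ι : Type*} (s : Finset ι) (p : ι → Prop) :
    ind (∃ i ∈ s, p i) ≤ ∑ i ∈ s, ind (p i) := by
  by_cases h : ∃ i ∈ s, p i
  · obtain ⟨i, hi, hp⟩ := h
    calc _ ≤ ind (p i) := by simp [hp, ind_le_one]
      _ ≤ _ := Finset.single_le_sum (f := fun i => ind (p i)) (fun j _ => ind_nonneg _) hi
  · rw [ind_false h]; exact Finset.sum_nonneg fun j _ => ind_nonneg _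

/-- The uniform average over a finite type. -/
noncomputable def mean {α : Type*} [Fintype α] : (α → ℝ) →ₗ[ℝ] ℝ :=
  (Fintype.card α : ℝ)⁻¹ • ∑ a, LinearMap.proj a

theorem mean_apply {α : Type*} [Fintype α] (f : α → ℝ) :
    mean f = (Fintype.card α : ℝ)⁻¹ * ∑ a, f a := by
  simp [mean]

theorem mean_mono {α : Type*} [Fintype α] {f g : α → ℝ} (h : ∀ a, f a ≤ g a) :
    mean f ≤ mean g := by
  rw [mean_apply, mean_apply]
  exact mul_le_mul_of_nonneg_left (Finset.sum_le_sum fun a _ => h a) (by positivity)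

theorem mean_nonneg {α : Type*} [Fintype α] {f : α → ℝ} (h : ∀ a, 0 ≤ f a) : 0 ≤ mean f := by
  simpa using mean_mono (f := 0) h

@[simp] theorem mean_const {α : Type*} [Fintype α] [Nonempty α] (c : ℝ) :
    mean (fun _ : α => c) = c := by
  rw [mean_apply]; simp

section linear
variable {α : Type*} (φ : (α → ℝ) →ₗ[ℝ] ℝ)

theorem lin_add (f g : α → ℝ) : φ (fun a => f a + g a) = φ f + φ g := map_add φ f g
theorem lin_sub (f g : α → ℝ) : φ (fun a => f a - g a) = φ f - φ g := map_sub φ f g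
theorem lin_mul (c : ℝ) (f : α → ℝ) : φ (fun a => c * f a) = c * φ f := map_smul φ c f
theorem lin_mul_right (c : ℝ) (f : α → ℝ) : φ (fun a => f a * c) = φ f * c := by
  rw [mul_comm, ← lin_mul]; simp only [mul_comm]
theorem lin_sum {ι : Type*} (s : Finset ι) (f : ι → α → ℝ) :
    φ (fun a => ∑ i ∈ s, f i a) = ∑ i ∈ s, φ (f i) := by
  rw [← map_sum]; congr 1; ext a; simp
theorem lin_mean {ι : Type*} [Fintype ι] (f : ι → α → ℝ) :
    φ (fun a => mean fun i => f i a) = mean fun i => φ (f i) := by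
  simp only [mean_apply]; rw [lin_mul, lin_sum]
end linear

theorem mean_comm {α β : Type*} [Fintype α] [Fintype β] (f : α → β → ℝ) :
    mean (fun a => mean fun b => f a b) = mean (fun b => mean fun a => f a b) :=
  lin_mean mean fun b a => f a b

theorem mean_equiv {α β : Type*} [Fintype α] [Fintype β] (e : α ≃ β) (f : β → ℝ) :
    mean (fun a => f (e a)) = mean f := by
  rw [mean_apply, mean_apply, Fintype.card_congr e, Equiv.sum_comp e f]

theorem mean_prod {α β : Type*} [Fintype α] [Fintype β] (f : α × β → ℝ) :
    mean f = mean (fun a => mean fun b => f (a, b)) := by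
  simp only [mean_apply]
  rw [Fintype.card_prod, Fintype.sum_prod_type, ← Finset.mul_sum]; push_cast; rw [mul_inv]; ring

/-- `stepMean v u f` is the expectation of `f (v i₁ + ⋯ + v i_u)` for independent uniform
indices `i₁, …, i_u`. -/
noncomputable def stepMean {ι G : Type*} [Fintype ι] [AddCommMonoid G] (v : ι → G) :
    ℕ → ((G → ℝ) →ₗ[ℝ] ℝ)
  | 0 => LinearMap.proj 0
  | u + 1 => mean.comp (LinearMap.pi fun i =>
      (stepMean v u).comp (LinearMap.funLeft ℝ ℝ fun x => x + v i))

section stepMean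
variable {ι G : Type*} [Fintype ι] [AddCommMonoid G] (v : ι → G)

@[simp] theorem stepMean_zero (f : G → ℝ) : stepMean v 0 f = f 0 := rfl
theorem stepMean_succ (u : ℕ) (f : G → ℝ) :
    stepMean v (u + 1) f = mean fun i => stepMean v u fun x => f (x + v i) := rfl

theorem stepMean_mono (u : ℕ) {f g : G → ℝ} (h : ∀ x, f x ≤ g x) :
    stepMean v u f ≤ stepMean v u g := by
  induction u generalizing f g with
  | zero => exact h 0
  | succ u ih => exact mean_mono fun i => ih fun x => h _

theorem stepMean_nonneg (u : ℕ) {f : G → ℝ} (h : ∀ x, 0 ≤ f x) : 0 ≤ stepMean v u f := by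
  simpa using stepMean_mono v u (f := 0) h

@[simp] theorem stepMean_const [Nonempty ι] (u : ℕ) (c : ℝ) :
    stepMean v u (fun _ => c) = c := by
  induction u with
  | zero => rfl
  | succ u ih => rw [stepMean_succ]; simp [ih]

/-- Fubini's theorem for two independent walks. -/
theorem stepMean_comm {κ H : Type*} [Fintype κ] [AddCommMonoid H] (w : κ → H) (a b : ℕ)
    (f : G → H → ℝ) :
    stepMean v a (fun x => stepMean w b fun y => f x y) =
      stepMean w b fun y => stepMean v a fun x => f x y := by
  induction a generalizing f with
  | zero => rfl
  | succ a ih =>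
    simp only [stepMean_succ]
    rw [lin_mean]
    congr 1; ext i
    exact ih fun x y => f (x + v i) y

/-- The Markov property: a walk of `a + b` steps is a walk of `a` steps followed by an independent
one of `b` steps. -/
theorem stepMean_add (a b : ℕ) (f : G → ℝ) :
    stepMean v (a + b) f = stepMean v a fun x => stepMean v b fun y => f (x + y) := by
  induction b generalizing f with
  | zero => simp
  | succ b ih =>
    rw [← add_assoc, stepMean_succ]
    simp only [stepMean_succ]
    rw [lin_mean]
    congr 1; ext i
    rw [ih]
    simp only [add_assoc]

/-- Expectations of multiplicative functions of the walk are powers. -/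
theorem stepMean_character {f : G → ℝ} (h0 : f 0 = 1) (hf : ∀ x y, f (x + y) = f x * f y)
    (u : ℕ) : stepMean v u f = (mean fun i => f (v i)) ^ u := by
  induction u with
  | zero => simpa using h0
  | succ u ih =>
    rw [stepMean_succ]
    simp only [hf]
    simp only [lin_mul_right, lin_mul, ih]
    rw [pow_succ]
end stepMean

/-! ### One-dimensional walk -/

/-- The two steps of the walk on `ℤ`. -/
def signStep (b : Bool) : ℤ := if b then 1 else -1

/-- The law of the simple random walk on `ℤ` at time `m`. -/
noncomputable def lineKernel (m : ℕ) (j : ℤ) : ℝ := stepMean signStep m fun x => ind (x = j)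

theorem lineKernel_succ (m : ℕ) (j : ℤ) :
    lineKernel (m + 1) j = mean fun b => lineKernel m (j - signStep b) := by
  unfold lineKernel
  rw [stepMean_succ]
  congr 1; ext b; congr 1; ext x
  exact ind_congr ⟨fun h => by omega, fun h => by omega⟩

theorem lineKernel_nonneg (m : ℕ) (j : ℤ) : 0 ≤ lineKernel m j :=
  stepMean_nonneg _ _ fun _ => ind_nonneg _

theorem lineKernel_succ' (m : ℕ) (j : ℤ) :
    lineKernel (m + 1) j = (lineKernel m (j - 1) + lineKernel m (j + 1)) / 2 := by
  rw [lineKernel_succ, mean_apply]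
  simp [signStep]; ring

/-- The law of the walk on `ℤ` is binomial. -/
theorem lineKernel_eq (m : ℕ) (j : ℤ) :
    (∀ k : ℕ, j = 2 * k - m → lineKernel m j = (m.choose k : ℝ) / 2 ^ m) ∧
      ((∀ k : ℕ, j ≠ 2 * k - m) → lineKernel m j = 0) := by
  induction m generalizing j with
  | zero =>
    constructor
    · rintro k rfl
      rcases k with _ | k
      · simp [lineKernel]
      · have : ¬ ((0 : ℤ) = 2 * ((k + 1 : ℕ) : ℤ) - ((0 : ℕ) : ℤ)) := by push_cast; omega
        rw [lineKernel, stepMean_zero, ind_false this]; simp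
    · intro h
      have : ¬ ((0 : ℤ) = j) := fun h0 => h 0 (by simp [← h0])
      simp [lineKernel, stepMean_zero, ind_false this]
  | succ m ih =>
    constructor
    · rintro k hk
      rw [lineKernel_succ']
      have h2 := (ih (j + 1)).1 k (by push_cast at hk ⊢; omega)
      rcases k with _ | k
      · have h1 := (ih (j - 1)).2 (fun k => by push_cast at hk ⊢; omega)
        rw [h1, h2]; simp [pow_succ]; ring
      · have h1 := (ih (j - 1)).1 k (by push_cast at hk ⊢; omega)
        rw [h1, h2, Nat.choose_succ_succ]; push_cast; rw [pow_succ]; ring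
    · intro h
      rw [lineKernel_succ', (ih _).2, (ih _).2]
      · simp
      · intro k hk; exact h k (by push_cast; omega)
      · intro k hk; exact h (k + 1) (by push_cast; omega)

theorem centralBinom_sq_le (M : ℕ) : (2 * M + 1) * (M.centralBinom) ^ 2 ≤ 16 ^ M := by
  induction M with
  | zero => simp
  | succ M ih =>
    have h := Nat.succ_mul_centralBinom_succ M
    have h2 : (M + 1) ^ 2 * ((2 * (M + 1) + 1) * (M + 1).centralBinom ^ 2)
        = (2 * M + 3) * (2 * (2 * M + 1) * M.centralBinom) ^ 2 := by
      rw [← h]; ring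
    have h3 : (2 * M + 3) * (2 * (2 * M + 1) * M.centralBinom) ^ 2
        ≤ (M + 1) ^ 2 * 16 ^ (M + 1) := by
      calc _ = ((2 * M + 3) * (2 * M + 1) * 4) * ((2 * M + 1) * M.centralBinom ^ 2) := by ring
        _ ≤ ((M + 1) ^ 2 * 16) * 16 ^ M := Nat.mul_le_mul (by nlinarith) ih
        _ = _ := by ring
    rw [← h2] at h3
    exact Nat.le_of_mul_le_mul_left h3 (by positivity)

theorem le_centralBinom_sq (M : ℕ) : 16 ^ M ≤ (4 * M + 1) * (M.centralBinom) ^ 2 := by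
  induction M with
  | zero => simp
  | succ M ih =>
    have h := Nat.succ_mul_centralBinom_succ M
    have h2 : (M + 1) ^ 2 * ((4 * (M + 1) + 1) * (M + 1).centralBinom ^ 2)
        = (4 * M + 5) * (2 * (2 * M + 1) * M.centralBinom) ^ 2 := by
      rw [← h]; ring
    have h3 : (M + 1) ^ 2 * 16 ^ (M + 1)
        ≤ (4 * M + 5) * (2 * (2 * M + 1) * M.centralBinom) ^ 2 := by
      calc (M + 1) ^ 2 * 16 ^ (M + 1) = ((M + 1) ^ 2 * 16) * 16 ^ M := by ring
        _ ≤ ((M + 1) ^ 2 * 16) * ((4 * M + 1) * M.centralBinom ^ 2) := by gcongr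
        _ = (16 * (M + 1) ^ 2 * (4 * M + 1)) * M.centralBinom ^ 2 := by ring
        _ ≤ (4 * (4 * M + 5) * (2 * M + 1) ^ 2) * M.centralBinom ^ 2 :=
            Nat.mul_le_mul_right _ (by ring_nf; omega)
        _ = _ := by ring
    rw [← h2] at h3
    exact Nat.le_of_mul_le_mul_left h3 (by positivity)

theorem centralBinom_div_le (M : ℕ) :
    (M.centralBinom : ℝ) / 4 ^ M ≤ 1 / √(2 * M + 1) := by
  rw [div_le_div_iff₀ (by positivity) (by positivity), one_mul]
  have h : ((2 * M + 1 : ℕ) : ℝ) * (M.centralBinom : ℝ) ^ 2 ≤ 16 ^ M := by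
    exact_mod_cast centralBinom_sq_le M
  rw [← pow_le_pow_iff_left₀ (by positivity) (by positivity) two_ne_zero, mul_pow,
    Real.sq_sqrt (by positivity), ← pow_mul, mul_comm M 2, pow_mul]
  norm_num at h ⊢; linarith

theorem le_centralBinom_div (M : ℕ) :
    1 / √(4 * M + 1) ≤ (M.centralBinom : ℝ) / 4 ^ M := by
  rw [div_le_div_iff₀ (by positivity) (by positivity), one_mul]
  have h : (16 : ℝ) ^ M ≤ ((4 * M + 1 : ℕ) : ℝ) * (M.centralBinom : ℝ) ^ 2 := by
    exact_mod_cast le_centralBinom_sq M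
  rw [← pow_le_pow_iff_left₀ (by positivity) (by positivity) two_ne_zero, mul_pow,
    Real.sq_sqrt (by positivity), ← pow_mul, mul_comm M 2, pow_mul]
  norm_num at h ⊢; linarith

theorem lineKernel_even_le (M : ℕ) (j : ℤ) : lineKernel (2 * M) j ≤ 1 / √(2 * M + 1) := by
  by_cases h : ∃ k : ℕ, j = 2 * k - (2 * M : ℕ)
  · obtain ⟨k, hk⟩ := h
    rw [(lineKernel_eq _ _).1 k hk, pow_mul]
    refine le_trans ?_ (centralBinom_div_le M)
    norm_num
    gcongr
    exact Nat.choose_le_centralBinom _ _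
  · push Not at h
    rw [(lineKernel_eq _ _).2 h]; positivity

theorem lineKernel_le (m : ℕ) (j : ℤ) : lineKernel m j ≤ 2 / √(m + 1) := by
  obtain ⟨M, rfl | rfl⟩ := Nat.even_or_odd' m
  · refine (lineKernel_even_le M j).trans ?_
    push_cast
    gcongr; norm_num
  · rw [lineKernel_succ']
    have h1 := lineKernel_even_le M (j - 1)
    have h2 := lineKernel_even_le M (j + 1)
    have h3 : 1 / √(2 * M + 1) ≤ 2 / √(((2 * M + 1 : ℕ) : ℝ) + 1) := by
      rw [div_le_div_iff₀ (by positivity) (by positivity), one_mul]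
      rw [← pow_le_pow_iff_left₀ (by positivity) (by positivity) two_ne_zero, mul_pow,
        Real.sq_sqrt (by positivity), Real.sq_sqrt (by positivity)]
      push_cast; linarith
    linarith

/-- Each step away from the centre costs a factor `(M - J) / (M + J + 1)`, which is at least
`1 - x`. -/
theorem choose_ge_centralBinom_mul {M : ℕ} {x : ℝ} (hx0 : 0 ≤ x) (hx1 : x ≤ 1) (J : ℕ)
    (hJ : 2 * (J : ℝ) ≤ x * M) :
    (M.centralBinom : ℝ) * (1 - x) ^ J ≤ ((2 * M).choose (M + J) : ℝ) := by
  induction J with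
  | zero => simp [Nat.centralBinom]
  | succ J ih =>
    push_cast at hJ
    have ih := ih (by linarith)
    have hM : (0 : ℝ) ≤ M := by positivity
    have hJM : J + 1 ≤ M := by
      have : (J : ℝ) + 1 ≤ M := by nlinarith
      exact_mod_cast this
    have h := Nat.choose_succ_right_eq (2 * M) (M + J)
    have h' : ((2 * M).choose (M + J + 1) : ℝ) * (M + J + 1) = (2 * M).choose (M + J) * (M - J) := by
      have e : 2 * M - (M + J) = M - J := by omega
      rw [e] at h
      have := congrArg (Nat.cast (R := ℝ)) h
      push_cast [Nat.cast_sub (show J ≤ M by omega)] at this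
      linarith
    have hp : (0 : ℝ) < M + J + 1 := by positivity
    have key : (1 - x) * (M + J + 1) ≤ M - J := by nlinarith
    have hc : (0 : ℝ) ≤ (2 * M).choose (M + J) := by positivity
    rw [← add_assoc, ← mul_le_mul_iff_of_pos_right hp, h', pow_succ]
    calc _ = (M.centralBinom * (1 - x) ^ J) * ((1 - x) * (M + J + 1)) := by ring
      _ ≤ (2 * M).choose (M + J) * ((1 - x) * (M + J + 1)) := by
          gcongr
      _ ≤ _ := by gcongr

theorem exp_neg_le_one_sub {x : ℝ} (hx0 : 0 ≤ x) (hx1 : x ≤ 1 / 2) :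
    Real.exp (-(2 * x)) ≤ 1 - x := by
  rw [Real.exp_neg, inv_le_iff_one_le_mul₀ (Real.exp_pos _)]
  have := Real.add_one_le_exp (2 * x)
  nlinarith

theorem lineKernel_even_ge {M : ℕ} {x : ℝ} (hx0 : 0 ≤ x) (hx1 : x ≤ 1 / 2) (J : ℤ)
    (hJ : 2 * |(J : ℝ)| ≤ x * M) :
    Real.exp (-(2 * x * |(J : ℝ)|)) / √(4 * M + 1) ≤ lineKernel (2 * M) (2 * J) := by
  have hJM : J.natAbs ≤ M := by
    have : (J.natAbs : ℝ) ≤ M := by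
      rw [Nat.cast_natAbs, Int.cast_abs]
      have : 0 ≤ |(J : ℝ)| := abs_nonneg _
      have : (0 : ℝ) ≤ M := by positivity
      nlinarith
    exact_mod_cast this
  have e1 : lineKernel (2 * M) (2 * J) = ((2 * M).choose (M + J.natAbs) : ℝ) / 4 ^ M := by
    have e4 : (2 : ℝ) ^ (2 * M) = 4 ^ M := by rw [pow_mul]; norm_num
    rcases le_total 0 J with h | h
    · rw [(lineKernel_eq _ _).1 (M + J.natAbs) (by push_cast; rw [abs_of_nonneg h]; ring), e4]
    · rw [(lineKernel_eq _ _).1 (M - J.natAbs) (by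
        push_cast [Nat.cast_sub hJM]; rw [abs_of_nonpos h]; ring), e4]
      rw [← Nat.choose_symm (by omega)]
      congr 3; omega
  rw [e1]
  have h1 := choose_ge_centralBinom_mul hx0 (by linarith) J.natAbs (M := M) (by
    rw [Nat.cast_natAbs, Int.cast_abs]; exact hJ)
  have h2 := le_centralBinom_div M
  have h3 : Real.exp (-(2 * x * |(J : ℝ)|)) ≤ (1 - x) ^ J.natAbs := by
    have := pow_le_pow_left₀ (Real.exp_pos _).le (exp_neg_le_one_sub hx0 hx1) J.natAbs
    rw [← Real.exp_nat_mul, Nat.cast_natAbs, Int.cast_abs] at this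
    rwa [show -(2 * x * |(J : ℝ)|) = |(J : ℝ)| * -(2 * x) by ring]
  calc _ = Real.exp (-(2 * x * |(J : ℝ)|)) * (1 / √(4 * M + 1)) := by ring
    _ ≤ (1 - x) ^ J.natAbs * (M.centralBinom / 4 ^ M) := by
        have : 0 ≤ 1 - x := by linarith
        gcongr
    _ = (M.centralBinom * (1 - x) ^ J.natAbs) / 4 ^ M := by ring
    _ ≤ _ := by gcongr

/-- The local lower bound for the walk on `ℤ` on the diffusive scale. -/
theorem exists_lineKernel_ge {α R : ℝ} (hα : 0 < α) (hR : 0 < R) :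
    ∃ c : ℝ, 0 < c ∧ ∃ n₀ : ℕ, ∀ n ≥ n₀, ∀ m : ℕ, ∀ j : ℤ, α * (n : ℝ) ^ 2 ≤ m →
      (m : ℝ) ≤ 2 * (n : ℝ) ^ 2 → |(j : ℝ)| ≤ R * n → Even ((m : ℤ) + j) →
      c / n ≤ lineKernel m j := by
  -- For even times and sites the kernel is a binomial coefficient; one more step gives the odd
  -- case.
  have even : ∀ α R : ℝ, 0 < α → 0 < R →
    ∃ c : ℝ, 0 < c ∧ ∃ n₀ : ℕ, ∀ n ≥ n₀, ∀ M : ℕ, ∀ J : ℤ, α * (n : ℝ) ^ 2 ≤ M →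
      (M : ℝ) ≤ (n : ℝ) ^ 2 → |(J : ℝ)| ≤ R * n → c / n ≤ lineKernel (2 * M) (2 * J) := by
    intro α R hα hR
    refine ⟨Real.exp (-(4 * R ^ 2 / α)) / 3, by positivity, ⌈4 * R / α⌉₊ + 1, ?_⟩
    intro n hn M J hM hM' hJ
    have hn1 : (1 : ℝ) ≤ n := by exact_mod_cast (by omega : 1 ≤ n)
    have hn2 : 4 * R / α ≤ n := (Nat.le_ceil _).trans (by exact_mod_cast (by omega))
    have hx : 2 * R / α / n ≤ 1 / 2 := by
      rw [div_le_iff₀ (by linarith)]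
      have : 4 * R / α = 2 * (2 * R / α) := by ring
      linarith
    have h := lineKernel_even_ge (M := M) (x := 2 * R / α / n) (by positivity) hx J (by
      calc 2 * |(J : ℝ)| ≤ 2 * (R * n) := by gcongr
        _ = 2 * R / α / n * (α * (n : ℝ) ^ 2) := by field_simp
        _ ≤ _ := by gcongr)
    refine le_trans ?_ h
    rw [div_div]
    have hs : √(4 * M + 1) ≤ 3 * n := by
      rw [Real.sqrt_le_left (by positivity)]
      nlinarith
    have he : 2 * (2 * R / α / n) * |(J : ℝ)| ≤ 4 * R ^ 2 / α := by
      calc _ ≤ 2 * (2 * R / α / n) * (R * n) := by gcongr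
        _ = _ := by field_simp; ring
    gcongr
  obtain ⟨c, hc, n₀, h⟩ := even (α / 3) (2 * R + 2) (by positivity) (by positivity)
  refine ⟨c, hc, n₀ + ⌈1 / α⌉₊ + ⌈1 / R⌉₊ + 1, ?_⟩
  intro n hn m j hm hm' hj hp
  have hn1 : (1 : ℝ) ≤ n := by exact_mod_cast (by omega : 1 ≤ n)
  have hn2 : 1 / α < n := (Nat.le_ceil _).trans_lt (by exact_mod_cast (by omega))
  obtain ⟨M, rfl | rfl⟩ := Nat.even_or_odd' m
  · obtain ⟨J, rfl⟩ : ∃ J, j = 2 * J := by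
      obtain ⟨r, hr⟩ := hp; exact ⟨r - M, by push_cast at hr; omega⟩
    push_cast at *
    refine h n (by omega) M J (by nlinarith) (by linarith) ?_
    rw [abs_mul] at hj
    norm_num at hj
    have : 0 ≤ |(J : ℝ)| := abs_nonneg _
    nlinarith
  · obtain ⟨J, rfl⟩ : ∃ J, j = 2 * J + 1 := by
      obtain ⟨r, hr⟩ := hp; exact ⟨r - M - 1, by push_cast at hr; omega⟩
    have hα1 : 1 < α * (n : ℝ) ^ 2 := by
      rw [div_lt_iff₀ hα] at hn2
      nlinarith
    push_cast at *
    have hM1 : (1 : ℝ) ≤ M := by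
      have : (0 : ℝ) < M := by linarith
      exact_mod_cast this
    have hM : α / 3 * (n : ℝ) ^ 2 ≤ M := by linarith
    have hJ1 : |(J : ℝ)| ≤ (2 * R + 2) * n - 1 := by
      have := abs_le.1 hj
      rw [abs_le]; constructor <;> nlinarith
    have e1 : 2 * J + 1 - 1 = 2 * J := by ring
    have e2 : 2 * J + 1 + 1 = 2 * (J + 1) := by ring
    rw [lineKernel_succ', e1, e2]
    have h1 := h n (by omega) M J hM (by linarith) (by linarith)
    have h2 := h n (by omega) M (J + 1) hM (by linarith) (by
      push_cast; have := abs_add_le (J : ℝ) 1; norm_num at this; linarith)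
    linarith

/-! ### The heat kernel of the simple random walk -/

/-- Monotonicity needs to be checked only on the sites `x` that the walk can reach in `u` steps,
in the sense of an invariant `P u x` of the walk. -/
theorem stepMean_mono_on {ι G : Type*} [Fintype ι] [AddCommMonoid G] (v : ι → G)
    (P : ℕ → G → Prop) (h0 : P 0 0) (hs : ∀ u x i, P u x → P (u + 1) (x + v i))
    (u : ℕ) {f g : G → ℝ} (h : ∀ x, P u x → f x ≤ g x) : stepMean v u f ≤ stepMean v u g := by
  induction u generalizing f g with
  | zero => exact h 0 h0
  | succ u ih => exact mean_mono fun i => ih fun x hx => h _ (hs u x i hx)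

theorem mean_ge_single {α : Type*} [Fintype α] {f : α → ℝ} (h : ∀ a, 0 ≤ f a) (a : α) :
    (Fintype.card α : ℝ)⁻¹ * f a ≤ mean f := by
  rw [mean_apply]
  gcongr
  exact Finset.single_le_sum (fun b _ => h b) (Finset.mem_univ a)

/-- The `2d` directions of a step. -/
abbrev Dir (d : ℕ) : Type := Fin d × Bool

/-- The unit vector that belongs to a direction. -/
def dirVec {d : ℕ} (q : Dir d) : Lattice d := Pi.single q.1 (signStep q.2)

/-- The heat kernel `P[S_u = z]` of the simple random walk started at the origin. -/
noncomputable def heatKernel {d : ℕ} (u : ℕ) (z : Lattice d) : ℝ :=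
  stepMean dirVec u fun x => ind (x = z)

/-- The mean over the number of steps that each coordinate receives during `u` steps. -/
noncomputable def countMean (d : ℕ) (u : ℕ) : ((Fin d → ℕ) → ℝ) →ₗ[ℝ] ℝ :=
  stepMean (fun i : Fin d => (Pi.single i 1 : Fin d → ℕ)) u

variable {d : ℕ}

theorem heatKernel_nonneg (u : ℕ) (z : Lattice d) : 0 ≤ heatKernel u z :=
  stepMean_nonneg _ _ fun _ => ind_nonneg _

theorem heatKernel_zero (z : Lattice d) : heatKernel 0 z = ind (0 = z) := rfl

theorem heatKernel_succ (u : ℕ) (z : Lattice d) :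
    heatKernel (u + 1) z = mean fun q => heatKernel u (z - dirVec q) := by
  unfold heatKernel
  rw [stepMean_succ]
  congr 1; ext q; congr 1; ext x
  exact ind_congr eq_sub_iff_add_eq.symm

/-- Given how many steps fall on each coordinate, the coordinates are independent walks on `ℤ`. -/
theorem heatKernel_eq_countMean (u : ℕ) (z : Lattice d) :
    heatKernel u z = countMean d u fun c => ∏ i, lineKernel (c i) (z i) := by
  induction u generalizing z with
  | zero =>
    simp only [heatKernel_zero, countMean, stepMean_zero, Pi.zero_apply, lineKernel]
    by_cases h : (0 : Lattice d) = z
    · rw [ind_true h, Finset.prod_eq_one]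
      intro i _; rw [← h]; simp
    · rw [ind_false h]
      obtain ⟨i, hi⟩ := Function.ne_iff.1 h
      rw [Finset.prod_eq_zero (Finset.mem_univ i)]
      exact ind_false hi
  | succ u ih =>
    rw [heatKernel_succ, mean_prod]
    unfold countMean
    rw [stepMean_succ]
    congr 1; ext i
    simp only [ih]
    rw [← lin_mean (countMean d u)]
    unfold countMean
    congr 1; ext c
    have e1 : ∀ b, ∏ k, lineKernel (c k) ((z - dirVec (i, b)) k) =
        (∏ k ∈ Finset.univ.erase i, lineKernel (c k) (z k)) *
          lineKernel (c i) (z i - signStep b) := by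
      intro b
      rw [← Finset.prod_erase_mul _ _ (Finset.mem_univ i)]
      congr 1
      · refine Finset.prod_congr rfl fun k hk => ?_
        simp [dirVec, Pi.single_eq_of_ne (Finset.ne_of_mem_erase hk)]
      · simp [dirVec]
    simp only [e1]
    rw [lin_mul, ← lineKernel_succ, ← Finset.prod_erase_mul _ _ (Finset.mem_univ i)]
    congr 1
    · refine Finset.prod_congr rfl fun k hk => ?_
      simp [Pi.single_eq_of_ne (Finset.ne_of_mem_erase hk)]
    · simp

theorem countMean_mono_on (u : ℕ) {f g : (Fin d → ℕ) → ℝ}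
    (h : ∀ c, ∑ i, c i = u → f c ≤ g c) : countMean d u f ≤ countMean d u g :=
  stepMean_mono_on _ (fun u c => ∑ i, c i = u) (by simp)
    (fun u x i hx => by simp [Finset.sum_add_distrib, hx]) u h

/-- Large deviations: a fixed coordinate rarely gets less than half of its expected share `u / d`
of the steps. The base of the bound comes from the exponential moment of `2 ^ (-c i)`. -/
theorem countMean_lt_le [NeZero d] (u : ℕ) (i : Fin d) :
    countMean d u (fun c => ind (c i < u / (2 * d))) ≤ (1 - 1 / (2 * (d : ℝ)) ^ 2) ^ u := by
  have hd : (1 : ℝ) ≤ d := by exact_mod_cast NeZero.one_le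
  have h1 : ∀ c : Fin d → ℕ,
      ind (c i < u / (2 * d)) ≤ 2 ^ (u / (2 * d)) * (1 / 2 : ℝ) ^ (c i) := by
    intro c
    by_cases h : c i < u / (2 * d)
    · rw [ind_true h, one_div, inv_pow, ← div_eq_mul_inv, one_le_div (by positivity)]
      exact pow_le_pow_right₀ (by norm_num) h.le
    · rw [ind_false h]; positivity
  have h2 : countMean d u (fun c => (1 / 2 : ℝ) ^ (c i)) = (1 - 1 / (2 * (d : ℝ))) ^ u := by
    unfold countMean
    rw [stepMean_character _ (by simp) (by intro x y; simp [pow_add])]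
    congr 1
    rw [mean_apply, ← Finset.sum_erase_add _ _ (Finset.mem_univ i),
      Finset.sum_congr rfl (g := fun _ => (1 : ℝ))]
    · simp
      rw [Nat.cast_sub NeZero.one_le]
      field_simp; push_cast; ring
    · intro k hk
      simp [Pi.single_eq_of_ne (Finset.ne_of_mem_erase hk).symm]
  have h3 : (2 : ℝ) ^ (u / (2 * d)) ≤ (1 + 1 / (2 * (d : ℝ))) ^ u := by
    have hb : (2 : ℝ) ≤ (1 + 1 / (2 * (d : ℝ))) ^ (2 * d) := by
      have := one_add_mul_le_pow (a := 1 / (2 * (d : ℝ))) (by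
        have : 0 ≤ 1 / (2 * (d : ℝ)) := by positivity
        linarith) (2 * d)
      refine le_trans (le_of_eq ?_) this
      push_cast; field_simp; norm_num
    calc (2 : ℝ) ^ (u / (2 * d)) ≤ ((1 + 1 / (2 * (d : ℝ))) ^ (2 * d)) ^ (u / (2 * d)) := by gcongr
      _ = (1 + 1 / (2 * (d : ℝ))) ^ (2 * d * (u / (2 * d))) := (pow_mul _ _ _).symm
      _ ≤ _ := pow_le_pow_right₀ (by
          have : 0 ≤ 1 / (2 * (d : ℝ)) := by positivity
          linarith) (Nat.mul_div_le _ _)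
  have h4 : 0 ≤ 1 - 1 / (2 * (d : ℝ)) := by
    rw [sub_nonneg, div_le_one (by positivity)]; linarith
  calc _ ≤ countMean d u (fun c => 2 ^ (u / (2 * d)) * (1 / 2 : ℝ) ^ (c i)) :=
        stepMean_mono _ _ h1
    _ = 2 ^ (u / (2 * d)) * (1 - 1 / (2 * (d : ℝ))) ^ u := by rw [lin_mul, h2]
    _ ≤ (1 + 1 / (2 * (d : ℝ))) ^ u * (1 - 1 / (2 * (d : ℝ))) ^ u := by gcongr
    _ = _ := by rw [← mul_pow]; congr 1; field_simp; ring

theorem contraction_bounds [NeZero d] :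
    0 ≤ 1 - 1 / (2 * (d : ℝ)) ^ 2 ∧ 1 - 1 / (2 * (d : ℝ)) ^ 2 < 1 := by
  have hd : (1 : ℝ) ≤ d := by exact_mod_cast NeZero.one_le
  constructor
  · rw [sub_nonneg, div_le_one (by positivity)]; nlinarith
  · have : 0 < 1 / (2 * (d : ℝ)) ^ 2 := by positivity
    linarith

/-- The heat kernel at time `u` is at most of order `u ^ (-d / 2)`. -/
theorem exists_heatKernel_le_sqrt [NeZero d] :
    ∃ C : ℝ, 0 < C ∧ ∀ u : ℕ, ∀ z : Lattice d, heatKernel u z ≤ C / √(u + 1) ^ d := by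
  have hd : (1 : ℝ) ≤ d := by exact_mod_cast NeZero.one_le
  obtain ⟨hθ0, hθ1⟩ := contraction_bounds (d := d)
  set θ := 1 - 1 / (2 * (d : ℝ)) ^ 2 with hθ
  obtain ⟨B, hB⟩ : ∃ B : ℝ, ∀ u : ℕ, (u : ℝ) ^ d * θ ^ u ≤ B := by
    have := (tendsto_pow_const_mul_const_pow_of_abs_lt_one d
      (show |θ| < 1 by rwa [abs_of_nonneg hθ0])).bddAbove_range
    obtain ⟨B, hB⟩ := this
    exact ⟨B, fun u => hB ⟨u, rfl⟩⟩
  have hB2 : ∀ u : ℕ, ((u : ℝ) + 1) ^ d * θ ^ u ≤ 2 ^ d * B + 1 := by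
    intro u
    have hB0 : 0 ≤ B := by
      have := hB 0; simp at this
      rcases eq_or_ne d 0 with h | h
      · exact absurd h (NeZero.ne d)
      · simpa [h] using this
    rcases Nat.eq_zero_or_pos u with rfl | hu
    · simp; positivity
    · have hu' : (1 : ℝ) ≤ u := by exact_mod_cast hu
      calc ((u : ℝ) + 1) ^ d * θ ^ u ≤ (2 * u) ^ d * θ ^ u := by gcongr; linarith
        _ = 2 ^ d * (u ^ d * θ ^ u) := by rw [mul_pow]; ring
        _ ≤ 2 ^ d * B := by gcongr; exact hB u
        _ ≤ _ := by linarith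
  have hC0 : 0 ≤ 2 ^ d * B + 1 := le_trans (by positivity) (hB2 0)
  refine ⟨√(16 * d) ^ d + d * (2 ^ d * B + 1), by positivity, fun u z => ?_⟩
  have key : ∀ c : Fin d → ℕ, ∏ i, lineKernel (c i) (z i) ≤
      √(16 * d) ^ d / √(u + 1) ^ d + ∑ i, ind (c i < u / (2 * d)) := by
    intro c
    by_cases h : ∃ i, c i < u / (2 * d)
    · obtain ⟨i, hi⟩ := h
      have h1 : (1 : ℝ) ≤ ∑ i, ind (c i < u / (2 * d)) := by
        calc (1 : ℝ) = ind (c i < u / (2 * d)) := (ind_true hi).symm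
          _ ≤ _ := Finset.single_le_sum (f := fun i => ind (c i < u / (2 * d)))
            (fun j _ => ind_nonneg _) (Finset.mem_univ i)
      have h2 : ∏ i, lineKernel (c i) (z i) ≤ 1 := by
        refine Finset.prod_le_one (fun i _ => lineKernel_nonneg _ _) fun i _ => ?_
        exact (stepMean_mono _ _ fun _ => ind_le_one _).trans (by simp)
      have : 0 ≤ √(16 * (d : ℝ)) ^ d / √(u + 1) ^ d := by positivity
      linarith
    · push Not at h
      have h1 : ∏ i, lineKernel (c i) (z i) ≤ ∏ _i : Fin d, √(16 * d) / √(u + 1) := by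
        refine Finset.prod_le_prod (fun i _ => lineKernel_nonneg _ _) fun i _ => ?_
        refine (lineKernel_le _ _).trans ?_
        rw [div_le_div_iff₀ (by positivity) (by positivity),
          ← pow_le_pow_iff_left₀ (by positivity) (by positivity) two_ne_zero, mul_pow, mul_pow,
          Real.sq_sqrt (by positivity), Real.sq_sqrt (by positivity), Real.sq_sqrt (by positivity)]
        have h3 : u < 2 * d * (c i + 1) := by
          have := Nat.lt_mul_div_succ u (show 0 < 2 * d by have := NeZero.pos d; omega)
          exact this.trans_le (Nat.mul_le_mul_left _ (by have := h i; omega))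
        have h4 : (u : ℝ) + 1 ≤ 2 * d * (c i + 1) := by exact_mod_cast h3
        nlinarith
      have h2 : (0 : ℝ) ≤ ∑ i, ind (c i < u / (2 * d)) := Finset.sum_nonneg fun _ _ => ind_nonneg _
      rw [Finset.prod_const, Finset.card_univ, Fintype.card_fin, div_pow] at h1
      linarith
  rw [heatKernel_eq_countMean]
  have h5 : countMean d u (fun _ => √(16 * d) ^ d / √(u + 1) ^ d)
      = √(16 * d) ^ d / √(u + 1) ^ d := stepMean_const _ _ _
  calc _ ≤ _ := stepMean_mono _ _ key
    _ = √(16 * d) ^ d / √(u + 1) ^ d +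
        ∑ i, countMean d u (fun c => ind (c i < u / (2 * d))) := by
        rw [lin_add, ← lin_sum]
        congr 1
    _ ≤ √(16 * d) ^ d / √(u + 1) ^ d + ∑ _i : Fin d, θ ^ u := by
        gcongr with i; exact countMean_lt_le u i
    _ = √(16 * d) ^ d / √(u + 1) ^ d + d * θ ^ u := by simp
    _ ≤ √(16 * d) ^ d / √(u + 1) ^ d + d * ((2 ^ d * B + 1) / √(u + 1) ^ d) := by
        gcongr
        rw [le_div_iff₀ (by positivity), mul_comm]
        refine le_trans ?_ (hB2 u)
        gcongr
        rw [Real.sqrt_le_left (by positivity)]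
        nlinarith
    _ = _ := by ring

/-- At times of order `n ^ 2` the heat kernel is at most of order `n ^ (-d)`. -/
theorem exists_heatKernel_le_pow [NeZero d] :
    ∃ C : ℝ, 0 < C ∧ ∀ n : ℕ, 1 ≤ n → ∀ u, n ^ 2 / 2 ≤ u → ∀ z : Lattice d,
      heatKernel u z ≤ C / (n : ℝ) ^ d := by
  obtain ⟨C, hC, h⟩ := exists_heatKernel_le_sqrt (d := d)
  refine ⟨C * 2 ^ d, by positivity, fun n hn u hu z => (h u z).trans ?_⟩
  have hn' : (1 : ℝ) ≤ n := by exact_mod_cast hn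
  rw [div_le_div_iff₀ (by positivity) (by positivity), mul_assoc, ← mul_pow]
  gcongr
  have h1 : n ^ 2 ≤ 2 * (u + 1) := by omega
  have h2 : (n : ℝ) ^ 2 ≤ 2 * (u + 1) := by exact_mod_cast h1
  rw [← pow_le_pow_iff_left₀ (by positivity) (by positivity) two_ne_zero, mul_pow,
    Real.sq_sqrt (by positivity)]
  linarith

/-- The square root of the order `(u + 1) ^ (-3 / 2)` of the three-dimensional heat kernel. -/
noncomputable def decay (u : ℕ) : ℝ := ((u : ℝ) + 1) ^ (-(3 / 4) : ℝ)

theorem decay_pos (u : ℕ) : 0 < decay u := Real.rpow_pos_of_pos (by positivity) _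

theorem decay_le_one (u : ℕ) : decay u ≤ 1 :=
  Real.rpow_le_one_of_one_le_of_nonpos (by simp) (by norm_num)

theorem decay_anti {u v : ℕ} (h : u ≤ v) : decay v ≤ decay u :=
  Real.rpow_le_rpow_of_nonpos (by positivity) (by gcongr) (by norm_num)

theorem decay_sq (u : ℕ) : decay u ^ 2 = ((u : ℝ) + 1) ^ (-(3 / 2) : ℝ) := by
  unfold decay
  rw [← Real.rpow_natCast, ← Real.rpow_mul (by positivity)]; norm_num

/-- In dimension `d ≥ 3` the three-dimensional decay of the heat kernel is enough for single
paths. -/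
theorem exists_heatKernel_le_decay (hd : 3 ≤ d) :
    ∃ C : ℝ, 0 < C ∧ ∀ u, ∀ z : Lattice d, heatKernel u z ≤ C * decay u ^ 2 := by
  have : NeZero d := ⟨by omega⟩
  obtain ⟨C, hC, h⟩ := exists_heatKernel_le_sqrt (d := d)
  refine ⟨C, hC, fun u z => (h u z).trans ?_⟩
  have e : decay u ^ 2 = 1 / √(u + 1) ^ 3 := by
    rw [decay_sq, Real.rpow_neg (by positivity), one_div, Real.sqrt_eq_rpow, ← Real.rpow_natCast,
      ← Real.rpow_mul (by positivity)]
    norm_num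
  rw [e, mul_one_div]
  have : (1 : ℝ) ≤ √(u + 1) := by rw [Real.one_le_sqrt]; simp
  gcongr

theorem sum_decay_le (N : ℕ) :
    ∑ u ∈ Finset.range N, decay u ≤ 4 * (N : ℝ) ^ (1 / 4 : ℝ) := by
  induction N with
  | zero => simp
  | succ N ih =>
    rw [Finset.sum_range_succ]
    push_cast
    set a := (N : ℝ) ^ (1 / 4 : ℝ) with ha
    set b := ((N : ℝ) + 1) ^ (1 / 4 : ℝ) with hb
    have ha0 : 0 ≤ a := by positivity
    have hb0 : 0 < b := by positivity
    have hab : a ≤ b := by rw [ha, hb]; gcongr; linarith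
    have ha4 : a ^ 4 = N := by
      rw [ha, ← Real.rpow_natCast, ← Real.rpow_mul (by positivity)]; norm_num
    have hb4 : b ^ 4 = N + 1 := by
      rw [hb, ← Real.rpow_natCast, ← Real.rpow_mul (by positivity)]; norm_num
    have hd : decay N = 1 / b ^ 3 := by
      rw [decay, hb, Real.rpow_neg (by positivity), one_div, ← Real.rpow_natCast (_ ^ _),
        ← Real.rpow_mul (by positivity)]
      norm_num
    have h1 : (1 : ℝ) ≤ 4 * (b - a) * b ^ 3 := by
      have e : (1 : ℝ) = (b - a) * (b ^ 3 + b ^ 2 * a + b * a ^ 2 + a ^ 3) := by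
        have : b ^ 4 - a ^ 4 = 1 := by rw [ha4, hb4]; ring
        rw [← this]; ring
      have h2 : b ^ 2 * a ≤ b ^ 2 * b := by gcongr
      have h3 : b * a ^ 2 ≤ b * b ^ 2 := by gcongr
      have h4 : a ^ 3 ≤ b ^ 3 := by gcongr
      calc (1 : ℝ) = (b - a) * (b ^ 3 + b ^ 2 * a + b * a ^ 2 + a ^ 3) := e
        _ ≤ (b - a) * (4 * b ^ 3) := by
            apply mul_le_mul_of_nonneg_left _ (by linarith); linarith
        _ = _ := by ring
    have h2 : decay N ≤ 4 * (b - a) := by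
      rw [hd, div_le_iff₀ (by positivity)]; exact h1
    linarith

/-- Every division of `b` steps among the coordinates has positive probability. -/
theorem countMean_ge_single [NeZero d] (b : ℕ) (c : Fin d → ℕ) (hc : ∑ i, c i = b)
    {f : (Fin d → ℕ) → ℝ} (hf : ∀ x, 0 ≤ f x) : ((d : ℝ)⁻¹) ^ b * f c ≤ countMean d b f := by
  induction b generalizing c f with
  | zero =>
    have : c = 0 := by
      ext i; exact (Finset.sum_eq_zero_iff.1 hc) i (Finset.mem_univ i)
    simp [this, countMean]
  | succ b ih =>
    obtain ⟨i, hi⟩ : ∃ i, c i ≠ 0 := by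
      by_contra h; push Not at h; simp [h] at hc
    have e : c = (c - Pi.single i 1) + Pi.single i 1 := by
      ext k
      by_cases hk : k = i
      · subst hk; simp; omega
      · simp [hk]
    have hc' : ∑ k, (c - Pi.single i 1 : Fin d → ℕ) k = b := by
      rw [e] at hc
      simp only [Pi.add_apply, Finset.sum_add_distrib] at hc
      simp at hc ⊢; omega
    have h1 := ih (c - Pi.single i 1) hc' (f := fun x => f (x + Pi.single i 1)) (fun x => hf _)
    have h2 := mean_ge_single (f := fun k : Fin d => countMean d b fun x => f (x + Pi.single k 1))
      (fun k => stepMean_nonneg _ _ fun _ => hf _) i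
    rw [← e] at h1
    rw [Fintype.card_fin] at h2
    calc _ = (d : ℝ)⁻¹ * ((d : ℝ)⁻¹ ^ b * f c) := by rw [pow_succ]; ring
      _ ≤ _ := le_trans (by gcongr) h2

/-- Adding `d` steps in total, the numbers of steps of all coordinates can be given the parity
that is needed to reach `z`. -/
theorem exists_parity_fix [NeZero d] (c : Fin d → ℕ) (z : Lattice d)
    (h : Even ((∑ i, (c i : ℤ)) + d + ∑ i, z i)) :
    ∃ e : Fin d → ℕ, ∑ i, e i = d ∧ ∀ i, Even (((c i + e i : ℕ) : ℤ) + z i) := by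
  set e : Fin d → ℕ := fun i => ((c i + z i) % 2).toNat with he
  have he2 : ∀ i, (e i : ℤ) = (c i + z i) % 2 := fun i => by simp [he]; omega
  have hle : ∑ i, e i ≤ d := by
    calc _ ≤ ∑ _i : Fin d, 1 := Finset.sum_le_sum fun i _ => by have := he2 i; omega
      _ = d := by simp
  have hpar : Even ((d : ℤ) - ∑ i, (e i : ℤ)) := by
    have h1 : (2 : ℤ) ∣ ∑ i, ((c i : ℤ) + z i - e i) :=
      Finset.dvd_sum fun i _ => by rw [he2]; omega
    rw [Finset.sum_sub_distrib, Finset.sum_add_distrib] at h1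
    obtain ⟨r, hr⟩ := h
    obtain ⟨s, hs⟩ := h1
    exact ⟨r - ∑ i, (c i : ℤ) - ∑ i, z i + s, by omega⟩
  refine ⟨e + Pi.single 0 (d - ∑ i, e i), ?_, ?_⟩
  · simp only [Pi.add_apply, Finset.sum_add_distrib]
    simp; omega
  · intro i
    obtain ⟨r, hr⟩ := hpar
    have hc : ((∑ i, e i : ℕ) : ℤ) = ∑ i, (e i : ℤ) := by push_cast; rfl
    have := he2 i
    by_cases hi : i = 0
    · subst hi
      simp only [Pi.add_apply, Pi.single_eq_same]
      exact ⟨(c 0 + z 0 + e 0) / 2 + r, by omega⟩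
    · simp only [Pi.add_apply, Pi.single_eq_of_ne hi]
      exact ⟨(c i + z i + e i) / 2, by omega⟩

/-- The heat kernel at times of order `n ^ 2` is at least of order `n ^ (-d)` at distance of order
`n`. Because of parity the bound holds for one of any two consecutive times. -/
theorem exists_heatKernel_ge [NeZero d] (R : ℝ) (hR : 0 < R) :
    ∃ c : ℝ, 0 < c ∧ ∃ n₀ : ℕ, ∀ n ≥ n₀, ∀ u : ℕ, n ^ 2 / 2 ≤ u → u ≤ n ^ 2 →
      ∀ z : Lattice d, (∀ i, |(z i : ℝ)| ≤ R * n) →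
        c / (n : ℝ) ^ d ≤ heatKernel u z + heatKernel (u + 1) z := by
  have hd : (1 : ℝ) ≤ d := by exact_mod_cast NeZero.one_le
  obtain ⟨c, hc, n₁, h1⟩ := exists_lineKernel_ge (α := 1 / (16 * d)) (R := R) (by positivity) hR
  obtain ⟨hθ0, hθ1⟩ := contraction_bounds (d := d)
  obtain ⟨n₂, h2⟩ : ∃ n₂ : ℕ, ∀ u ≥ n₂, d * (1 - 1 / (2 * (d : ℝ)) ^ 2) ^ u ≤ 1 / 2 := by
    have := (tendsto_pow_atTop_nhds_zero_of_lt_one hθ0 hθ1).const_mul (d : ℝ)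
    rw [mul_zero] at this
    exact Filter.eventually_atTop.1 (this.eventually_le_const (by norm_num))
  refine ⟨((d : ℝ)⁻¹) ^ d * c ^ d / 2, by positivity, n₁ + 16 * d + 4 * n₂, ?_⟩
  intro n hn u hu hu' z hz
  have hdpos := NeZero.pos d
  have hn1 : 16 * d ≤ n := by omega
  have hn1' : (16 : ℝ) * d ≤ n := by exact_mod_cast hn1
  have hnn : n ≤ n ^ 2 := by nlinarith
  -- One of the two times has the parity of `z`. Of its `w = v + d` steps, the first `v` give each
  -- coordinate about its share, and the last `d` correct the parities of the single coordinates.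
  have main : ∀ w : ℕ, n ^ 2 / 2 ≤ w → w ≤ n ^ 2 + 1 → Even ((w : ℤ) + ∑ i, z i) →
      ((d : ℝ)⁻¹) ^ d * c ^ d / 2 / (n : ℝ) ^ d ≤ heatKernel w z := by
    intro w hw hw' hev
    obtain ⟨v, rfl⟩ : ∃ v, w = v + d := ⟨w - d, by omega⟩
    rw [heatKernel_eq_countMean]
    unfold countMean
    rw [stepMean_add]
    set θ := (1 - 1 / (2 * (d : ℝ)) ^ 2)
    have step : ∀ x : Fin d → ℕ, ∑ i, x i = v →
        ((d : ℝ)⁻¹) ^ d * (c / n) ^ d * (1 - ∑ i, ind (x i < v / (2 * d))) ≤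
        countMean d d fun y => ∏ i, lineKernel ((x + y) i) (z i) := by
      intro x hx
      have hnonneg : 0 ≤ countMean d d fun y => ∏ i, lineKernel ((x + y) i) (z i) :=
        stepMean_nonneg _ _ fun y => Finset.prod_nonneg fun i _ => lineKernel_nonneg _ _
      by_cases h : ∃ i, x i < v / (2 * d)
      · obtain ⟨i, hi⟩ := h
        have h1 : (1 : ℝ) ≤ ∑ i, ind (x i < v / (2 * d)) := by
          calc (1 : ℝ) = ind (x i < v / (2 * d)) := (ind_true hi).symm
            _ ≤ _ := Finset.single_le_sum (f := fun i => ind (x i < v / (2 * d)))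
              (fun j _ => ind_nonneg _) (Finset.mem_univ i)
        refine le_trans ?_ hnonneg
        exact mul_nonpos_of_nonneg_of_nonpos (by positivity) (by linarith)
      · push Not at h
        obtain ⟨e, he, hpar⟩ := exists_parity_fix x z (by
          have : (∑ i, (x i : ℤ)) = v := by rw [← hx]; push_cast; rfl
          rw [this]; push_cast at hev; exact hev)
        have hprod : (c / n) ^ d ≤ ∏ i, lineKernel ((x + e) i) (z i) := by
          calc (c / n) ^ d = ∏ _i : Fin d, (c / n : ℝ) := by simp [div_pow]
            _ ≤ _ := by
              refine Finset.prod_le_prod (fun i _ => by positivity) fun i _ => ?_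
              refine h1 n (by omega) _ _ ?_ ?_ (hz i) (hpar i)
              · have a1 : v < 2 * d * (x i + 1) := by
                  have := Nat.lt_mul_div_succ v (show 0 < 2 * d by omega)
                  exact this.trans_le (Nat.mul_le_mul_left _ (by have := h i; omega))
                have a2 : n ^ 2 ≤ 2 * (v + d + 1) := by omega
                have a3 : (v : ℝ) + 1 ≤ 2 * d * (x i + 1) := by exact_mod_cast a1
                have a4 : (n : ℝ) ^ 2 ≤ 2 * (v + d + 1) := by exact_mod_cast a2
                have a5 : (n : ℝ) ^ 2 ≤ 16 * d * x i := by
                  have : 16 * (d : ℝ) * (16 * d) ≤ n ^ 2 := by nlinarith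
                  nlinarith
                rw [div_mul_eq_mul_div, one_mul, div_le_iff₀ (by positivity)]
                have : (x i : ℝ) ≤ ((x + e) i : ℕ) := by simp
                nlinarith
              · have b1 : x i ≤ v := by
                  rw [← hx]; exact Finset.single_le_sum (fun _ _ => Nat.zero_le _) (Finset.mem_univ i)
                have b2 : e i ≤ d := by
                  rw [← he]; exact Finset.single_le_sum (fun _ _ => Nat.zero_le _) (Finset.mem_univ i)
                have b3 : (x + e) i ≤ 2 * n ^ 2 := by
                  simp only [Pi.add_apply]; omega
                exact_mod_cast b3
        have h0 : (∑ i, ind (x i < v / (2 * d))) = 0 :=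
          Finset.sum_eq_zero fun i _ => ind_false (by have := h i; omega)
        rw [h0, sub_zero, mul_one]
        refine le_trans ?_ (countMean_ge_single d e he fun y =>
          Finset.prod_nonneg fun i _ => lineKernel_nonneg _ _)
        gcongr
    refine le_trans ?_ (countMean_mono_on v step)
    rw [lin_mul, lin_sub, lin_sum]
    have e1 : countMean d v (fun _ => 1) = 1 := stepMean_const _ _ _
    rw [e1]
    have e2 : ∑ i, countMean d v (fun c => ind (c i < v / (2 * d))) ≤ 1 / 2 := by
      calc _ ≤ ∑ _i : Fin d, θ ^ v := Finset.sum_le_sum fun i _ => countMean_lt_le v i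
        _ = d * θ ^ v := by simp
        _ ≤ 1 / 2 := h2 v (by
            have : 16 * n ≤ n ^ 2 := by nlinarith
            omega)
    calc ((d : ℝ)⁻¹) ^ d * c ^ d / 2 / (n : ℝ) ^ d
        = ((d : ℝ)⁻¹) ^ d * (c / n) ^ d * (1 / 2) := by rw [div_pow]; ring
      _ ≤ _ := by gcongr; linarith
  have hnon1 := heatKernel_nonneg u z
  have hnon2 := heatKernel_nonneg (u + 1) z
  rcases Int.even_or_odd ((u : ℤ) + ∑ i, z i) with h | h
  · have := main u hu (by omega) h
    linarith
  · have := main (u + 1) (by omega) (by omega) (by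
      obtain ⟨r, hr⟩ := h; exact ⟨r + 1, by push_cast; omega⟩)
    linarith

/-- Sub-Gaussian tails of a coordinate of the walk. -/
theorem stepMean_large_le [NeZero d] (u : ℕ) (i : Fin d) {r L : ℝ} (hr : 0 ≤ r) (hL : 0 < L)
    (hu : (u : ℝ) ≤ L) :
    stepMean dirVec u (fun x : Lattice d => ind (r < |(x i : ℝ)|)) ≤
      2 * Real.exp (-(r ^ 2 / (2 * L))) := by
  have hchar : ∀ l : ℝ, stepMean dirVec u (fun x : Lattice d => Real.exp (l * x i)) ≤
      Real.exp (u * (l ^ 2 / 2)) := by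
    intro l
    rw [stepMean_character _ (by simp) (by intro x y; rw [← Real.exp_add]; push_cast [Pi.add_apply]; ring_nf),
      Real.exp_nat_mul]
    have hm : (mean fun q : Dir d => Real.exp (l * (dirVec q i : ℤ))) ≤ Real.exp (l ^ 2 / 2) := by
      refine le_trans ?_ (Real.cosh_le_exp_half_sq l)
      rw [mean_prod]
      rw [show Real.cosh l = mean (fun _ : Fin d => Real.cosh l) by simp]
      refine mean_mono fun k => ?_
      rw [mean_apply]
      by_cases hk : i = k
      · subst hk
        simp [dirVec, signStep, Real.cosh_eq]
        linarith
      · simp [dirVec, Pi.single_eq_of_ne hk]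
    have h0 : 0 ≤ mean fun q : Dir d => Real.exp (l * (dirVec q i : ℤ)) :=
      mean_nonneg fun q => (Real.exp_pos _).le
    exact pow_le_pow_left₀ h0 hm u
  set l := r / L with hl
  have hl0 : 0 ≤ l := by positivity
  have h1 : ∀ x : Lattice d, ind (r < |(x i : ℝ)|) ≤
      Real.exp (-(l * r)) * (Real.exp (l * x i) + Real.exp ((-l) * x i)) := by
    intro x
    by_cases h : r < |(x i : ℝ)|
    · rw [ind_true h, mul_add, ← Real.exp_add, ← Real.exp_add]
      rcases lt_abs.1 h with h | h
      · have : 1 ≤ Real.exp (-(l * r) + l * x i) := Real.one_le_exp (by nlinarith)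
        have := Real.exp_pos (-(l * r) + -l * x i)
        linarith
      · have : 1 ≤ Real.exp (-(l * r) + -l * x i) := Real.one_le_exp (by nlinarith)
        have := Real.exp_pos (-(l * r) + l * x i)
        linarith
    · rw [ind_false h]; positivity
  calc _ ≤ _ := stepMean_mono _ _ h1
    _ = Real.exp (-(l * r)) * (stepMean dirVec u (fun x : Lattice d => Real.exp (l * x i)) +
        stepMean dirVec u (fun x : Lattice d => Real.exp ((-l) * x i))) := by
        rw [lin_mul, lin_add]
    _ ≤ Real.exp (-(l * r)) * (Real.exp (u * (l ^ 2 / 2)) + Real.exp (u * ((-l) ^ 2 / 2))) := by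
        gcongr
        · exact hchar l
        · exact hchar (-l)
    _ = 2 * Real.exp (-(l * r) + u * (l ^ 2 / 2)) := by rw [neg_sq, Real.exp_add]; ring
    _ ≤ _ := by
        gcongr
        have : (u : ℝ) * (l ^ 2 / 2) ≤ L * (l ^ 2 / 2) := by gcongr
        have e : -(l * r) + L * (l ^ 2 / 2) = -(r ^ 2 / (2 * L)) := by
          rw [hl]; field_simp; ring
        linarith

variable {d : ℕ}

/-! ### A finite model of the walks -/

/-- The increment of walk `w` at time `m`, when the steps with labels in the finite set `I` have
the directions given by `σ`; steps with other labels are zero. -/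
def stepAt {I : Finset (ℕ × ℕ)} (σ : I → Dir d) (w m : ℕ) : Lattice d :=
  if h : (w, m) ∈ I then dirVec (σ ⟨(w, m), h⟩) else 0

/-- The displacement of walk `w` between the times `a` and `b`. -/
def walkInc {I : Finset (ℕ × ℕ)} (σ : I → Dir d) (w a b : ℕ) : Lattice d :=
  ∑ m ∈ Finset.Ico a b, stepAt σ w m

/-- The position at time `t` of walk `w` with starting point `x w`. -/
def walkPos {I : Finset (ℕ × ℕ)} (x : ℕ → Lattice d) (σ : I → Dir d) (w t : ℕ) : Lattice d :=
  x w + walkInc σ w 0 t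

/-- The labels of the steps that walk `w` makes between the times `a` and `b`. -/
def slots (w a b : ℕ) : Set (ℕ × ℕ) := {p | p.1 = w ∧ a ≤ p.2 ∧ p.2 < b}

/-- `f σ` is determined by the steps with labels in `S`. -/
def DepOn {I : Finset (ℕ × ℕ)} {β : Type*} (f : (I → Dir d) → β) (S : Set (ℕ × ℕ)) : Prop :=
  ∀ σ τ, (∀ p : I, p.1 ∈ S → σ p = τ p) → f σ = f τ

section model
variable {I : Finset (ℕ × ℕ)}

theorem DepOn.mono {β : Type*} {f : (I → Dir d) → β} {S T : Set (ℕ × ℕ)} (h : DepOn f S)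
    (hST : S ⊆ T) : DepOn f T := fun σ τ hστ => h σ τ fun q hq => hστ q (hST hq)

theorem DepOn.comp {β γ : Type*} {f : (I → Dir d) → β} {S : Set (ℕ × ℕ)} (h : DepOn f S)
    (g : β → γ) : DepOn (fun σ => g (f σ)) S := fun σ τ hστ => congrArg g (h σ τ hστ)

theorem DepOn.comp₂ {β γ δ : Type*} {f : (I → Dir d) → β} {f' : (I → Dir d) → γ}
    {S : Set (ℕ × ℕ)} (h : DepOn f S) (h' : DepOn f' S) (g : β → γ → δ) :
    DepOn (fun σ => g (f σ) (f' σ)) S :=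
  fun σ τ hστ => by simp only [h σ τ hστ, h' σ τ hστ]

theorem DepOn.sum {ι : Type*} {s : Finset ι} {f : ι → (I → Dir d) → ℝ} {S : Set (ℕ × ℕ)}
    (h : ∀ i ∈ s, DepOn (f i) S) : DepOn (fun σ => ∑ i ∈ s, f i σ) S :=
  fun σ τ hστ => Finset.sum_congr rfl fun i hi => h i hi σ τ hστ

theorem depOn_walkInc (w a b : ℕ) :
    DepOn (fun σ : I → Dir d => walkInc σ w a b) (slots w a b) := by
  intro σ τ h
  refine Finset.sum_congr rfl fun m hm => ?_
  rw [Finset.mem_Ico] at hm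
  unfold stepAt
  split_ifs with hI
  · rw [h ⟨(w, m), hI⟩ ⟨rfl, hm.1, hm.2⟩]
  · rfl

theorem slots_mono (w : ℕ) {a a' b b' : ℕ} (ha : a' ≤ a) (hb : b ≤ b') :
    slots w a b ⊆ slots w a' b' := fun _ hp => ⟨hp.1, ha.trans hp.2.1, hp.2.2.trans_le hb⟩

theorem slots_subset_compl_of_le (w w' : ℕ) {a b a' b' : ℕ} (h : b ≤ a') :
    slots w' a' b' ⊆ (slots w a b)ᶜ := by
  rintro p ⟨_, hp, _⟩ ⟨_, _, hp'⟩; omega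

theorem slots_subset_compl_of_ne {w w' : ℕ} (h : w' ≠ w) (a b a' b' : ℕ) :
    slots w' a' b' ⊆ (slots w a b)ᶜ := by
  rintro p ⟨rfl, _, _⟩ ⟨hp, _⟩; exact h hp

theorem depOn_walkPos (x : ℕ → Lattice d) (w t : ℕ) :
    DepOn (fun σ : I → Dir d => walkPos x σ w t) (slots w 0 t) :=
  (depOn_walkInc w 0 t).comp fun z => x w + z

theorem walkInc_add (σ : I → Dir d) (w : ℕ) {a b c : ℕ} (hab : a ≤ b) (hbc : b ≤ c) :
    walkInc σ w a b + walkInc σ w b c = walkInc σ w a c :=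
  Finset.sum_Ico_consecutive _ hab hbc

theorem walkPos_add (x : ℕ → Lattice d) (σ : I → Dir d) (w : ℕ) {a b : ℕ} (hab : a ≤ b) :
    walkPos x σ w b = walkPos x σ w a + walkInc σ w a b := by
  rw [walkPos, walkPos, add_assoc, walkInc_add σ w (Nat.zero_le _) hab]

/-- The part of `σ` on `S` and the rest of `σ` are independent: two independent copies of `σ` may
be used for them. The proof exchanges the parts on `S` of the two copies. -/
theorem mean_decouple (S : Set (ℕ × ℕ)) {F : (I → Dir d) → (I → Dir d) → ℝ}
    (h1 : ∀ τ, DepOn (fun σ => F σ τ) S) (h2 : ∀ σ, DepOn (fun τ => F σ τ) Sᶜ) :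
    mean (fun σ => F σ σ) = mean fun σ => mean fun τ => F σ τ := by
  classical
  let mix : (I → Dir d) → (I → Dir d) → (I → Dir d) := fun σ τ p => if p.1 ∈ S then σ p else τ p
  let e : (I → Dir d) × (I → Dir d) ≃ (I → Dir d) × (I → Dir d) :=
    { toFun := fun p => (mix p.1 p.2, mix p.2 p.1)
      invFun := fun p => (mix p.1 p.2, mix p.2 p.1)
      left_inv := fun p => by
        ext q <;> by_cases h : q.1 ∈ S <;> simp [mix, h]
      right_inv := fun p => by
        ext q <;> by_cases h : q.1 ∈ S <;> simp [mix, h] }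
  have h3 : ∀ σ τ, F σ τ = F (mix σ τ) (mix σ τ) := by
    intro σ τ
    have a : F σ τ = F (mix σ τ) τ := h1 τ _ _ fun p hp => by simp [mix, hp]
    have b : F (mix σ τ) τ = F (mix σ τ) (mix σ τ) := h2 _ _ _ fun p hp => by
      have : p.1 ∉ S := hp
      simp [mix, this]
    exact a.trans b
  rcases isEmpty_or_nonempty (I → Dir d) with hE | hE
  · simp [mean_apply]
  have h4 : mean (fun σ => mean fun τ => F σ τ) = mean (fun p : _ × _ => F (e p).1 (e p).1) := by
    rw [mean_prod]; congr 1; ext σ; congr 1; ext τ; exact h3 σ τ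
  rw [h4, mean_equiv e fun p => F p.1 p.1, mean_prod]
  congr 1; ext σ; simp

theorem mean_mul_of_depOn (S : Set (ℕ × ℕ)) {f g : (I → Dir d) → ℝ} (hf : DepOn f S)
    (hg : DepOn g Sᶜ) : mean (fun σ => f σ * g σ) = mean f * mean g := by
  rw [mean_decouple S (F := fun σ τ => f σ * g τ) (fun τ => hf.comp fun x => x * g τ)
    (fun σ => hg.comp fun x => f σ * x)]
  simp only [lin_mul, lin_mul_right]

theorem mean_decouple_le (S : Set (ℕ × ℕ)) {F : (I → Dir d) → (I → Dir d) → ℝ}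
    (h1 : ∀ τ, DepOn (fun σ => F σ τ) S) (h2 : ∀ σ, DepOn (fun τ => F σ τ) Sᶜ)
    {f : (I → Dir d) → ℝ} {c : ℝ} (h : ∀ σ, mean (F σ) ≤ f σ * c) :
    mean (fun σ => F σ σ) ≤ mean f * c := by
  rw [mean_decouple S h1 h2, ← lin_mul_right]
  exact mean_mono h

theorem mean_decouple_ge (S : Set (ℕ × ℕ)) {F : (I → Dir d) → (I → Dir d) → ℝ}
    (h1 : ∀ τ, DepOn (fun σ => F σ τ) S) (h2 : ∀ σ, DepOn (fun τ => F σ τ) Sᶜ)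
    {f : (I → Dir d) → ℝ} {c : ℝ} (h : ∀ σ, f σ * c ≤ mean (F σ)) :
    mean f * c ≤ mean (fun σ => F σ σ) := by
  rw [mean_decouple S h1 h2, ← lin_mul_right]
  exact mean_mono h

theorem mean_coord [NeZero d] (p : I) (G : Dir d → ℝ) :
    mean (fun σ : I → Dir d => G (σ p)) = mean G := by
  classical
  have := mean_equiv (Equiv.funSplitAt p (Dir d)) (fun q => G q.1)
  simp only [Equiv.funSplitAt_apply] at this
  rw [this, mean_prod]
  simp

theorem mean_walkInc [NeZero d] (w a u : ℕ) (hI : ∀ m, a ≤ m → m < a + u → (w, m) ∈ I)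
    (f : Lattice d → ℝ) :
    mean (fun σ : I → Dir d => f (walkInc σ w a (a + u))) = stepMean dirVec u f := by
  induction u generalizing f with
  | zero => simp [walkInc]
  | succ u ih =>
    have hin := hI (a + u) (by omega) (by omega)
    have e : ∀ σ : I → Dir d, walkInc σ w a (a + (u + 1)) =
        walkInc σ w a (a + u) + dirVec (σ ⟨(w, a + u), hin⟩) := by
      intro σ
      rw [walkInc, ← add_assoc, Finset.sum_Ico_succ_top (by omega)]
      simp [walkInc, stepAt, hin]
    simp only [e]
    rw [mean_decouple (slots w a (a + u))
      (F := fun σ τ => f (walkInc σ w a (a + u) + dirVec (τ ⟨(w, a + u), hin⟩)))]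
    · have h2 : ∀ σ : I → Dir d,
          (mean fun τ : I → Dir d => f (walkInc σ w a (a + u) + dirVec (τ ⟨(w, a + u), hin⟩))) =
            mean fun q => f (walkInc σ w a (a + u) + dirVec q) := fun σ =>
        mean_coord ⟨(w, a + u), hin⟩ fun q => f (walkInc σ w a (a + u) + dirVec q)
      simp only [h2]
      rw [mean_comm, stepMean_succ]
      congr 1; ext q
      exact ih (fun m h1 h2 => hI m h1 (by omega)) fun x => f (x + dirVec q)
    · exact fun τ => (depOn_walkInc w a (a + u)).comp fun z => f (z + _)
    · intro σ τ τ' h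
      have h2 := h ⟨(w, a + u), hin⟩ (by rintro ⟨_, _, h3⟩; simp at h3)
      simp only [h2]

/-- Increments of walks in the finite model are distributed as the simple random walk. -/
theorem mean_walkInc' [NeZero d] (w : ℕ) {a b : ℕ} (hab : a ≤ b)
    (hI : ∀ m, a ≤ m → m < b → (w, m) ∈ I) (f : Lattice d → ℝ) :
    mean (fun σ : I → Dir d => f (walkInc σ w a b)) = stepMean dirVec (b - a) f := by
  obtain ⟨u, rfl⟩ := Nat.exists_eq_add_of_le hab
  rw [Nat.add_sub_cancel_left]
  exact mean_walkInc w a u hI f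

theorem mean_walkInc_eq [NeZero d] (w : ℕ) {a b : ℕ} (hab : a ≤ b)
    (hI : ∀ m, a ≤ m → m < b → (w, m) ∈ I) (z : Lattice d) :
    mean (fun σ : I → Dir d => ind (walkInc σ w a b = z)) = heatKernel (b - a) z :=
  mean_walkInc' w hab hI fun x => ind (x = z)

end model

/-! ### Second moments -/

theorem mean_mul_sq_le {α : Type*} [Fintype α] (f g : α → ℝ) :
    (mean fun a => f a * g a) ^ 2 ≤ mean (fun a => f a ^ 2) * mean (fun a => g a ^ 2) := by
  simp only [mean_apply]
  have := Finset.sum_mul_sq_le_sq_mul_sq Finset.univ f g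
  calc _ = (Fintype.card α : ℝ)⁻¹ ^ 2 * (∑ i, f i * g i) ^ 2 := by ring
    _ ≤ (Fintype.card α : ℝ)⁻¹ ^ 2 * ((∑ i, f i ^ 2) * ∑ i, g i ^ 2) := by gcongr
    _ = _ := by ring

/-- The second moment method. -/
theorem mean_sq_le_ind_pos_mul {α : Type*} [Fintype α] (f : α → ℝ) (hf : ∀ a, 0 ≤ f a) :
    (mean f) ^ 2 ≤ mean (fun a => ind (0 < f a)) * mean (fun a => f a ^ 2) := by
  have h := mean_mul_sq_le (fun a => ind (0 < f a)) f
  have e1 : ∀ a, ind (0 < f a) * f a = f a := by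
    intro a
    rcases (hf a).eq_or_lt with h | h
    · rw [← h]; simp
    · simp [h]
  have e2 : ∀ p, ind p ^ 2 = ind p := by
    intro p; by_cases h : p <;> simp [h]
  simpa only [e1, e2] using h

/-- The Paley–Zygmund inequality. -/
theorem paley_zygmund {α : Type*} [Fintype α] [Nonempty α] {f : α → ℝ} {m V : ℝ}
    (hm : 0 ≤ m) (hV : 0 < V) (h1 : m ≤ mean f) (h2 : mean (fun a => f a ^ 2) ≤ V) :
    m ^ 2 / (4 * V) ≤ mean fun a => ind (m / 2 ≤ f a) := by
  have h := mean_mul_sq_le (fun a => ind (m / 2 ≤ f a)) f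
  have e2 : ∀ p, ind p ^ 2 = ind p := by
    intro p; by_cases h : p <;> simp [h]
  simp only [e2] at h
  have h3 : mean f ≤ m / 2 + mean fun a => ind (m / 2 ≤ f a) * f a := by
    have e : m / 2 + (mean fun a => ind (m / 2 ≤ f a) * f a) =
        mean fun a => m / 2 + ind (m / 2 ≤ f a) * f a := by rw [lin_add, mean_const]
    rw [e]
    refine mean_mono fun a => ?_
    by_cases h : m / 2 ≤ f a
    · rw [ind_true h]; linarith
    · rw [ind_false h]; push Not at h; linarith
  have h4 : (m / 2) ^ 2 ≤ (mean fun a => ind (m / 2 ≤ f a) * f a) ^ 2 := by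
    gcongr; linarith
  have h5 : 0 ≤ mean fun a => ind (m / 2 ≤ f a) := mean_nonneg fun _ => ind_nonneg _
  rw [div_le_iff₀ (by positivity)]
  have h6 := mul_le_mul_of_nonneg_left h2 h5
  nlinarith

theorem markov {α : Type*} [Fintype α] {f : α → ℝ} (hf : ∀ a, 0 ≤ f a) {t : ℝ} (ht : 0 < t) :
    mean (fun a => ind (t < f a)) ≤ mean f / t := by
  rw [le_div_iff₀ ht, ← lin_mul_right]
  refine mean_mono fun a => ?_
  by_cases h : t < f a
  · simp [h, h.le]
  · simp [h, hf a]

theorem sum_ind_sub_le (S : Finset ℕ) (u N : ℕ) {f : ℕ → ℝ} (hf : ∀ k, 0 ≤ f k)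
    (hS : ∀ v ∈ S, v - u < N) : ∑ v ∈ S, ind (u ≤ v) * f (v - u) ≤ ∑ k ∈ Finset.range N, f k := by
  classical
  have e : ∑ v ∈ S, ind (u ≤ v) * f (v - u) = ∑ v ∈ S.filter (u ≤ ·), f (v - u) := by
    rw [Finset.sum_filter]
    refine Finset.sum_congr rfl fun v _ => ?_
    by_cases h : u ≤ v <;> simp [h]
  rw [e, ← Finset.sum_image (f := f) (g := fun v => v - u)]
  · refine Finset.sum_le_sum_of_subset_of_nonneg ?_ fun _ _ _ => hf _
    intro k hk
    obtain ⟨v, hv, rfl⟩ := Finset.mem_image.1 hk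
    exact Finset.mem_range.2 (hS v (Finset.mem_filter.1 hv).1)
  · intro v hv v' hv' h
    simp at hv hv' h; omega

theorem sum_ind_sub_le' (S : Finset ℕ) (u N : ℕ) {f : ℕ → ℝ} (hf : ∀ k, 0 ≤ f k)
    (hS : ∀ v ∈ S, u - v < N) : ∑ v ∈ S, ind (v ≤ u) * f (u - v) ≤ ∑ k ∈ Finset.range N, f k := by
  classical
  have e : ∑ v ∈ S, ind (v ≤ u) * f (u - v) = ∑ v ∈ S.filter (· ≤ u), f (u - v) := by
    rw [Finset.sum_filter]
    refine Finset.sum_congr rfl fun v _ => ?_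
    by_cases h : v ≤ u <;> simp [h]
  rw [e, ← Finset.sum_image (f := f) (g := fun v => u - v)]
  · refine Finset.sum_le_sum_of_subset_of_nonneg ?_ fun _ _ _ => hf _
    intro k hk
    obtain ⟨v, hv, rfl⟩ := Finset.mem_image.1 hk
    exact Finset.mem_range.2 (hS v (Finset.mem_filter.1 hv).1)
  · intro v hv v' hv' h
    simp at hv hv' h; omega

/-- Lower bounds for pairs of consecutive terms suffice for sums; this takes care of the parity of
the walk. -/
theorem half_sum_pairs_le {f : ℕ → ℝ} (hf : ∀ k, 0 ≤ f k) (a b : ℕ) :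
    (∑ u ∈ Finset.Ico a b, (f u + f (u + 1))) / 2 ≤ ∑ u ∈ Finset.Icc a b, f u := by
  rw [Finset.sum_add_distrib]
  have h1 : ∑ u ∈ Finset.Ico a b, f u ≤ ∑ u ∈ Finset.Icc a b, f u :=
    Finset.sum_le_sum_of_subset_of_nonneg Finset.Ico_subset_Icc_self fun _ _ _ => hf _
  have h2 : ∑ u ∈ Finset.Ico a b, f (u + 1) ≤ ∑ u ∈ Finset.Icc a b, f u := by
    rw [Finset.sum_Ico_add' f a b 1]
    refine Finset.sum_le_sum_of_subset_of_nonneg ?_ fun _ _ _ => hf _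
    intro k hk
    simp at hk ⊢; omega
  linarith

/-! ### Energy -/

/-- The Green function of the walk killed after time `U`. -/
noncomputable def green (U : ℕ) (z : Lattice d) : ℝ := ∑ u ∈ Finset.range (U + 1), heatKernel u z

/-- The energy of a finite family of points, with repetitions, with respect to `green U`. -/
noncomputable def energy {ι : Type*} (U : ℕ) (s : Finset ι) (a : ι → Lattice d) : ℝ :=
  ∑ p ∈ s, ∑ q ∈ s, green U (a q - a p)

theorem green_nonneg (U : ℕ) (z : Lattice d) : 0 ≤ green U z :=
  Finset.sum_nonneg fun _ _ => heatKernel_nonneg _ _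

theorem energy_nonneg {ι : Type*} (U : ℕ) (s : Finset ι) (a : ι → Lattice d) :
    0 ≤ energy U s a := Finset.sum_nonneg fun _ _ => Finset.sum_nonneg fun _ _ => green_nonneg _ _

theorem one_le_green_zero (U : ℕ) : 1 ≤ green U (0 : Lattice d) := by
  have h : heatKernel 0 (0 : Lattice d) ≤ green U 0 :=
    Finset.single_le_sum (f := fun u => heatKernel u (0 : Lattice d))
      (fun _ _ => heatKernel_nonneg _ _) (by simp)
  simpa [heatKernel_zero] using h

theorem energy_pos {ι : Type*} (U : ℕ) {s : Finset ι} (hs : s.Nonempty) (a : ι → Lattice d) :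
    0 < energy U s a := by
  refine Finset.sum_pos' (fun _ _ => Finset.sum_nonneg fun _ _ => green_nonneg _ _) ?_
  obtain ⟨p, hp⟩ := hs
  refine ⟨p, hp, lt_of_lt_of_le zero_lt_one ?_⟩
  calc 1 ≤ green U (a p - a p) := by rw [sub_self]; exact one_le_green_zero U
    _ ≤ _ := Finset.single_le_sum (f := fun q => green U (a q - a p))
      (fun _ _ => green_nonneg _ _) hp

/-- The distance of two points of a path or of two paths is spread out both by the walk of `k`
steps and by that of `u` steps, so the better one of the two bounds holds. -/
theorem stepMean_heatKernel_le [NeZero d] {B : ℕ → ℝ} (hB : ∀ u, ∀ z : Lattice d, heatKernel u z ≤ B u)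
    (k u : ℕ) (z : Lattice d) :
    stepMean dirVec k (fun x => heatKernel u (z + x)) ≤ min (B k) (B u) ∧
      stepMean dirVec k (fun x => heatKernel u (z - x)) ≤ min (B k) (B u) := by
  refine ⟨le_min ?_ ?_, le_min ?_ ?_⟩
  · unfold heatKernel
    rw [stepMean_comm]
    calc _ ≤ stepMean dirVec u (fun _ : Lattice d => B k) := by
          refine stepMean_mono _ _ fun y => ?_
          refine le_trans (le_of_eq ?_) (hB k (y - z))
          unfold heatKernel
          congr 1; ext x; exact ind_congr ⟨fun h => by rw [h]; abel, fun h => by rw [h]; abel⟩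
      _ = B k := stepMean_const _ _ _
  · exact (stepMean_mono _ _ fun x => hB u _).trans (stepMean_const _ _ _).le
  · unfold heatKernel
    rw [stepMean_comm]
    calc _ ≤ stepMean dirVec u (fun _ : Lattice d => B k) := by
          refine stepMean_mono _ _ fun y => ?_
          refine le_trans (le_of_eq ?_) (hB k (z - y))
          unfold heatKernel
          congr 1; ext x; exact ind_congr ⟨fun h => by rw [h]; abel, fun h => by rw [h]; abel⟩
      _ = B k := stepMean_const _ _ _
  · exact (stepMean_mono _ _ fun x => hB u _).trans (stepMean_const _ _ _).le

theorem sq_add_one_rpow_le {n : ℕ} (hn : 1 ≤ n) :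
    ((n ^ 2 + 1 : ℕ) : ℝ) ^ (1 / 4 : ℝ) ≤ 2 * √n := by
  have hn' : (1 : ℝ) ≤ n := by exact_mod_cast hn
  have : ((n ^ 2 + 1 : ℕ) : ℝ) ≤ (2 * √n) ^ 4 := by
    have e : √(n : ℝ) ^ 4 = n ^ 2 := by
      rw [show 4 = 2 * 2 by norm_num, pow_mul, Real.sq_sqrt (by positivity)]
    rw [mul_pow, e]; push_cast; nlinarith
  calc _ ≤ ((2 * √(n : ℝ)) ^ 4) ^ (1 / 4 : ℝ) := by gcongr
    _ = 2 * √n := by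
      rw [← Real.rpow_natCast, ← Real.rpow_mul (by positivity)]; norm_num

/-- The Green function at the end of `k` steps. The minimum of the bounds for the times `k` and
`u` is replaced by their geometric mean, so that the sum over `u ≤ n ^ 2` costs a factor `√n`
only. -/
theorem exists_stepMean_green_le_decay (hd : 3 ≤ d) :
    ∃ C : ℝ, 0 < C ∧ ∀ n : ℕ, 1 ≤ n → ∀ k, ∀ z : Lattice d,
      stepMean dirVec k (fun x => green (n ^ 2) (z + x)) ≤ C * decay k * √n ∧
      stepMean dirVec k (fun x => green (n ^ 2) (z - x)) ≤ C * decay k * √n := by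
  have : NeZero d := ⟨by omega⟩
  obtain ⟨C, hC, h⟩ := exists_heatKernel_le_decay hd
  refine ⟨C * 8, by positivity, fun n hn k z => ?_⟩
  have hn' : (1 : ℝ) ≤ n := by exact_mod_cast hn
  have hmin : ∀ u, min (C * decay k ^ 2) (C * decay u ^ 2) ≤ C * decay k * decay u := by
    intro u
    have h1 := decay_pos k
    have h2 := decay_pos u
    rcases le_total (decay k) (decay u) with h | h
    · refine (min_le_left _ _).trans ?_
      rw [sq, ← mul_assoc]; gcongr
    · refine (min_le_right _ _).trans ?_
      rw [sq, ← mul_assoc]; gcongr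
  have hsum : ∑ u ∈ Finset.range (n ^ 2 + 1), C * decay k * decay u ≤ C * 8 * decay k * √n := by
    rw [← Finset.mul_sum]
    have h1 := sum_decay_le (n ^ 2 + 1)
    have h2 := sq_add_one_rpow_le hn
    have h3 := (decay_pos k).le
    calc _ ≤ C * decay k * (4 * (2 * √n)) := by gcongr; linarith
      _ = _ := by ring
  constructor
  · unfold green
    rw [lin_sum]
    refine le_trans (Finset.sum_le_sum fun u _ => ?_) hsum
    exact (stepMean_heatKernel_le h k u z).1.trans (hmin u)
  · unfold green
    rw [lin_sum]
    refine le_trans (Finset.sum_le_sum fun u _ => ?_) hsum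
    exact (stepMean_heatKernel_le h k u z).2.trans (hmin u)

/-- After a time of order `n ^ 2` the Green function is at most of order `n ^ (2 - d)` on average.
-/
theorem exists_stepMean_green_le_pow [NeZero d] :
    ∃ C : ℝ, 0 < C ∧ ∀ n : ℕ, 1 ≤ n → ∀ k, n ^ 2 / 2 ≤ k → ∀ z : Lattice d,
      stepMean dirVec k (fun x => green (n ^ 2) (z + x)) ≤ C * (n : ℝ) ^ 2 / (n : ℝ) ^ d := by
  obtain ⟨C, hC, h⟩ := exists_heatKernel_le_pow (d := d)
  refine ⟨C * 2, by positivity, fun n hn k hk z => ?_⟩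
  have hn' : (1 : ℝ) ≤ n := by exact_mod_cast hn
  unfold green
  rw [lin_sum]
  calc _ ≤ ∑ u ∈ Finset.range (n ^ 2 + 1), C / (n : ℝ) ^ d := by
        refine Finset.sum_le_sum fun u _ => ?_
        unfold heatKernel
        rw [stepMean_comm]
        calc _ ≤ stepMean dirVec u (fun _ : Lattice d => C / (n : ℝ) ^ d) := by
              refine stepMean_mono _ _ fun y => ?_
              refine le_trans (le_of_eq ?_) (h n hn k hk (y - z))
              unfold heatKernel
              congr 1; ext x; exact ind_congr ⟨fun h => by rw [h]; abel, fun h => by rw [h]; abel⟩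
          _ = _ := stepMean_const _ _ _
    _ = ((n ^ 2 + 1 : ℕ) : ℝ) * (C / (n : ℝ) ^ d) := by simp
    _ ≤ (2 * (n : ℝ) ^ 2) * (C / (n : ℝ) ^ d) := by
        gcongr; push_cast; nlinarith
    _ = _ := by ring

/-- The expected energy of a path of `l` steps: it is at most of order
`l ^ (5 / 4) * n ^ (1 / 2)`. -/
theorem exists_path_energy_le (hd : 3 ≤ d) :
    ∃ C : ℝ, 0 < C ∧ ∀ n : ℕ, 1 ≤ n → ∀ (I : Finset (ℕ × ℕ)) (w a l : ℕ),
      (∀ m, a ≤ m → m + 1 < a + l → (w, m) ∈ I) →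
      ∑ t ∈ Finset.Ico a (a + l), ∑ t' ∈ Finset.Ico a (a + l),
        mean (fun σ : I → Dir d => green (n ^ 2) (walkInc σ w a t' - walkInc σ w a t)) ≤
          C * l * (l : ℝ) ^ (1 / 4 : ℝ) * √n := by
  have : NeZero d := ⟨by omega⟩
  obtain ⟨C, hC, h⟩ := exists_stepMean_green_le_decay hd
  refine ⟨8 * C, by positivity, fun n hn I w a l hI => ?_⟩
  have key : ∀ t ∈ Finset.Ico a (a + l), ∀ t' ∈ Finset.Ico a (a + l),
      mean (fun σ : I → Dir d => green (n ^ 2) (walkInc σ w a t' - walkInc σ w a t)) ≤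
        C * √n * (ind (t ≤ t') * decay (t' - t) + ind (t' ≤ t) * decay (t - t')) := by
    intro t ht t' ht'
    rw [Finset.mem_Ico] at ht ht'
    have d1 := decay_pos (t' - t)
    have d2 := decay_pos (t - t')
    rcases le_total t t' with htt | htt
    · have e : ∀ σ : I → Dir d, walkInc σ w a t' - walkInc σ w a t = 0 + walkInc σ w t t' := by
        intro σ; rw [← walkInc_add σ w ht.1 htt]; abel
      simp only [e]
      rw [mean_walkInc' w htt (fun m h1 h2 => hI m (by omega) (by omega))
        fun x => green (n ^ 2) (0 + x)]
      refine ((h n hn (t' - t) 0).1).trans ?_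
      rw [ind_true htt]
      have : 0 ≤ C * √n * (ind (t' ≤ t) * decay (t - t')) := by
        have := ind_nonneg (t' ≤ t); positivity
      nlinarith
    · have e : ∀ σ : I → Dir d, walkInc σ w a t' - walkInc σ w a t = 0 - walkInc σ w t' t := by
        intro σ; rw [← walkInc_add σ w ht'.1 htt]; abel
      simp only [e]
      rw [mean_walkInc' w htt (fun m h1 h2 => hI m (by omega) (by omega))
        fun x => green (n ^ 2) (0 - x)]
      refine ((h n hn (t - t') 0).2).trans ?_
      rw [ind_true htt]
      have : 0 ≤ C * √n * (ind (t ≤ t') * decay (t' - t)) := by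
        have := ind_nonneg (t ≤ t'); positivity
      nlinarith
  calc _ ≤ ∑ t ∈ Finset.Ico a (a + l), ∑ t' ∈ Finset.Ico a (a + l),
        C * √n * (ind (t ≤ t') * decay (t' - t) + ind (t' ≤ t) * decay (t - t')) :=
        Finset.sum_le_sum fun t ht => Finset.sum_le_sum fun t' ht' => key t ht t' ht'
    _ ≤ ∑ t ∈ Finset.Ico a (a + l), C * √n * (4 * (l : ℝ) ^ (1 / 4 : ℝ) + 4 * (l : ℝ) ^ (1 / 4 : ℝ)) := by
        refine Finset.sum_le_sum fun t ht => ?_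
        rw [← Finset.mul_sum, Finset.sum_add_distrib]
        rw [Finset.mem_Ico] at ht
        gcongr
        · refine (sum_ind_sub_le _ t l (fun k => (decay_pos k).le) fun v hv => ?_).trans
            (sum_decay_le l)
          rw [Finset.mem_Ico] at hv; omega
        · refine (sum_ind_sub_le' _ t l (fun k => (decay_pos k).le) fun v hv => ?_).trans
            (sum_decay_le l)
          rw [Finset.mem_Ico] at hv; omega
    _ = _ := by simp; ring

/-! ### Hitting a set of small energy -/

/-- Walk `w`, put at `y` at time `a`, visits one of the points `pt p`, `p ∈ s`, between the times
`a + n² / 2` and `a + n²`, and at time `a + n²` it is within distance `R n` from `y`. -/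
def Hits {I : Finset (ℕ × ℕ)} {ι : Type*} (n : ℕ) (R : ℝ) (s : Finset ι) (pt : ι → Lattice d)
    (y : Lattice d) (w a : ℕ) (σ : I → Dir d) : Prop :=
  (∃ u ∈ Finset.Icc (n ^ 2 / 2) (n ^ 2), ∃ p ∈ s, y + walkInc σ w a (a + u) = pt p) ∧
    ∀ i, |((walkInc σ w a (a + n ^ 2) i : ℤ) : ℝ)| ≤ R * n

theorem depOn_hits {I : Finset (ℕ × ℕ)} {ι : Type*} (n : ℕ) (R : ℝ) (s : Finset ι)
    (pt : ι → Lattice d) (y : Lattice d) (w a : ℕ) :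
    DepOn (fun σ : I → Dir d => Hits n R s pt y w a σ) (slots w a (a + n ^ 2)) := by
  intro σ τ h
  have h1 : ∀ u, u ≤ n ^ 2 → walkInc σ w a (a + u) = walkInc τ w a (a + u) := fun u hu =>
    depOn_walkInc w a (a + u) σ τ fun p hp => h p (slots_mono w le_rfl (by omega) hp)
  unfold Hits
  beta_reduce
  rw [h1 _ le_rfl, eq_iff_iff]
  refine and_congr ⟨?_, ?_⟩ Iff.rfl
  · rintro ⟨u, hu, p, hp, e⟩
    exact ⟨u, hu, p, hp, by rw [← h1 u (Finset.mem_Icc.1 hu).2]; exact e⟩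
  · rintro ⟨u, hu, p, hp, e⟩
    exact ⟨u, hu, p, hp, by rw [h1 u (Finset.mem_Icc.1 hu).2]; exact e⟩

theorem four_mul_le_exp (hd : 3 ≤ d) : 4 * (d : ℝ) ≤ Real.exp (2 * (d : ℝ) ^ 2) := by
  have h := Real.add_one_le_exp (2 * (d : ℝ) ^ 2)
  have : (3 : ℝ) ≤ d := by exact_mod_cast hd
  nlinarith

/-- With probability at least one half the walk moves by at most `2dn` until time `n²`. -/
theorem half_le_stepMean_near (hd : 3 ≤ d) {n : ℕ} (hn : 1 ≤ n) {u : ℕ} (hu : u ≤ n ^ 2) :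
    1 / 2 ≤ stepMean dirVec u
      fun x : Lattice d => ind (∀ i, |((x i : ℤ) : ℝ)| ≤ 2 * d * n) := by
  have : NeZero d := ⟨by omega⟩
  have hn' : (1 : ℝ) ≤ n := by exact_mod_cast hn
  have hd' : (3 : ℝ) ≤ d := by exact_mod_cast hd
  have h1 : ∀ x : Lattice d, 1 - ∑ i, ind (2 * d * n < |((x i : ℤ) : ℝ)|) ≤
      ind (∀ i, |((x i : ℤ) : ℝ)| ≤ 2 * d * n) := by
    intro x
    by_cases h : ∀ i, |((x i : ℤ) : ℝ)| ≤ 2 * d * n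
    · rw [ind_true h]
      have : 0 ≤ ∑ i, ind (2 * d * n < |((x i : ℤ) : ℝ)|) :=
        Finset.sum_nonneg fun _ _ => ind_nonneg _
      linarith
    · rw [ind_false h]
      push Not at h
      obtain ⟨i, hi⟩ := h
      have : ind (2 * d * n < |((x i : ℤ) : ℝ)|) ≤ ∑ i, ind (2 * d * n < |((x i : ℤ) : ℝ)|) :=
        Finset.single_le_sum (f := fun i => ind (2 * d * n < |((x i : ℤ) : ℝ)|))
          (fun _ _ => ind_nonneg _) (Finset.mem_univ i)
      rw [ind_true hi] at this
      linarith
  refine le_trans ?_ (stepMean_mono _ _ h1)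
  rw [lin_sub, lin_sum, stepMean_const]
  have h2 : ∀ i : Fin d, stepMean dirVec u (fun x : Lattice d => ind (2 * d * n < |((x i : ℤ) : ℝ)|))
      ≤ 1 / (2 * d) := by
    intro i
    refine (stepMean_large_le u i (r := 2 * d * n) (L := (n : ℝ) ^ 2) (by positivity)
      (by positivity) (by exact_mod_cast hu)).trans ?_
    have e : (2 * d * (n : ℝ)) ^ 2 / (2 * (n : ℝ) ^ 2) = 2 * (d : ℝ) ^ 2 := by field_simp
    rw [e, Real.exp_neg, ← div_eq_mul_inv, div_le_div_iff₀ (Real.exp_pos _) (by positivity)]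
    have := four_mul_le_exp hd
    linarith
  have h3 : ∑ i : Fin d, stepMean dirVec u (fun x : Lattice d => ind (2 * d * n < |((x i : ℤ) : ℝ)|))
      ≤ ∑ _i : Fin d, 1 / (2 * (d : ℝ)) := Finset.sum_le_sum fun i _ => h2 i
  have h4 : ∑ _i : Fin d, 1 / (2 * (d : ℝ)) = 1 / 2 := by simp; field_simp
  linarith

/-- A walk that starts within distance of order `n` from a family of points of capacity at least `κ`
(number of points squared over energy) hits it with probability of order `κ n^(2-d)` at least. -/
theorem exists_hits_ge (hd : 3 ≤ d) {R₀ : ℝ} (hR₀ : 0 < R₀) :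
    ∃ c : ℝ, 0 < c ∧ ∃ n₀ : ℕ, ∀ n ≥ n₀, ∀ (I : Finset (ℕ × ℕ)) (w a : ℕ),
      (∀ m, a ≤ m → m < a + n ^ 2 → (w, m) ∈ I) → ∀ (y : Lattice d) (ι : Type) (s : Finset ι)
      (pt : ι → Lattice d), s.Nonempty → (∀ p ∈ s, ∀ i, |((pt p i - y i : ℤ) : ℝ)| ≤ R₀ * n) →
      ∀ κ : ℝ, κ * energy (n ^ 2) s pt ≤ (s.card : ℝ) ^ 2 →
      c * κ * (n : ℝ) ^ 2 / (n : ℝ) ^ d ≤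
        mean fun σ : I → Dir d => ind (Hits n (R₀ + 2 * d) s pt y w a σ) := by
  have : NeZero d := ⟨by omega⟩
  obtain ⟨c, hc, n₁, hlow⟩ := exists_heatKernel_ge (d := d) R₀ hR₀
  obtain ⟨C, hC, hup⟩ := exists_heatKernel_le_pow (d := d)
  refine ⟨c ^ 2 / (256 * C), by positivity, n₁ + 1, ?_⟩
  intro n hn I w a hI y ι s pt hs hpt κ hκ
  have hn1 : 1 ≤ n := by omega
  have hn' : (1 : ℝ) ≤ n := by exact_mod_cast hn1
  set U := n ^ 2 with hU
  set T := Finset.Icc (U / 2) U with hT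
  let A : ℕ × ι → (I → Dir d) → ℝ := fun x σ => ind (walkInc σ w a (a + x.1) = pt x.2 - y)
  let D : ℕ → (I → Dir d) → ℝ := fun u σ =>
    ind (∀ i, |((walkInc σ w (a + u) (a + U) i : ℤ) : ℝ)| ≤ 2 * d * n)
  let N : (I → Dir d) → ℝ := fun σ => ∑ x ∈ T ×ˢ s, A x σ * D x.1 σ
  have hA0 : ∀ x σ, 0 ≤ A x σ := fun _ _ => ind_nonneg _
  have hD0 : ∀ x σ, 0 ≤ D x σ := fun _ _ => ind_nonneg _
  have hN0 : ∀ σ, 0 ≤ N σ := fun σ => Finset.sum_nonneg fun x _ => mul_nonneg (hA0 _ _) (hD0 _ _)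
  -- `N` counts the visits to the points after which the walk stays close; a positive count means
  -- a hit.
  have hpos : ∀ σ, ind (0 < N σ) ≤ ind (Hits n (R₀ + 2 * d) s pt y w a σ) := by
    intro σ
    refine ind_mono fun h => ?_
    obtain ⟨x, hx, hne⟩ := Finset.exists_ne_zero_of_sum_ne_zero h.ne'
    rw [Finset.mem_product] at hx
    have h1 : walkInc σ w a (a + x.1) = pt x.2 - y := by
      by_contra h1; exact hne (by simp [A, h1])
    have h2 : ∀ i, |((walkInc σ w (a + x.1) (a + U) i : ℤ) : ℝ)| ≤ 2 * d * n := by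
      by_contra h2; exact hne (by simp only [D, ind_false h2, mul_zero])
    refine ⟨⟨x.1, hx.1, x.2, hx.2, by rw [h1]; abel⟩, fun i => ?_⟩
    rw [← walkInc_add σ w (b := a + x.1) (by omega) (by have := (Finset.mem_Icc.1 hx.1).2; omega),
      h1]
    have h3 := hpt x.2 hx.2 i
    have h4 := h2 i
    have h5 := abs_add_le (((pt x.2 i - y i : ℤ) : ℝ))
      (((walkInc σ w (a + x.1) (a + U) i : ℤ)) : ℝ)
    simp only [Pi.add_apply, Pi.sub_apply]
    push_cast at h3 h5 ⊢
    linarith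
  -- The first moment: visits have the probabilities of the heat kernel, and given a visit the
  -- walk stays close with probability at least one half.
  have hAmean : ∀ x, x.1 ∈ T → mean (A x) = heatKernel x.1 (pt x.2 - y) := by
    intro x hx
    have := (Finset.mem_Icc.1 hx).2
    have := mean_walkInc_eq (I := I) w (show a ≤ a + x.1 by omega)
      (fun m h1 h2 => hI m h1 (by omega)) (pt x.2 - y)
    rwa [Nat.add_sub_cancel_left] at this
  have hfirst : ∀ x ∈ T ×ˢ s, heatKernel x.1 (pt x.2 - y) / 2 ≤ mean fun σ => A x σ * D x.1 σ := by
    intro x hx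
    rw [Finset.mem_product] at hx
    have hx2 := (Finset.mem_Icc.1 hx.1).2
    rw [mean_mul_of_depOn (slots w a (a + x.1))
      ((depOn_walkInc w a (a + x.1)).comp fun z => ind (z = pt x.2 - y))
      (((depOn_walkInc w (a + x.1) (a + U)).comp
        fun z => ind (∀ i, |((z i : ℤ) : ℝ)| ≤ 2 * d * n)).mono
          (slots_subset_compl_of_le w w le_rfl))]
    have h1 := hAmean x hx.1
    have h2 : 1 / 2 ≤ mean (D x.1) := by
      have := mean_walkInc' (d := d) (I := I) w (show a + x.1 ≤ a + U by omega)
        (fun m h1 h2 => hI m (by omega) (by omega))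
        (fun z => ind (∀ i, |((z i : ℤ) : ℝ)| ≤ 2 * d * n))
      rw [this]
      exact half_le_stepMean_near hd hn1 (by omega)
    have h3 := heatKernel_nonneg x.1 (pt x.2 - y)
    change _ ≤ mean (A x) * mean (D x.1)
    rw [h1]
    nlinarith
  have hEN : (s.card : ℝ) * (c * n ^ 2 / (8 * (n : ℝ) ^ d)) ≤ mean N := by
    calc (s.card : ℝ) * (c * n ^ 2 / (8 * (n : ℝ) ^ d))
        = ∑ p ∈ s, c * n ^ 2 / (8 * (n : ℝ) ^ d) := by simp
      _ ≤ ∑ p ∈ s, ∑ u ∈ T, heatKernel u (pt p - y) / 2 := by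
          refine Finset.sum_le_sum fun p hp => ?_
          rw [← Finset.sum_div]
          have h1 := half_sum_pairs_le (fun u => heatKernel_nonneg u (pt p - y)) (U / 2) U
          have h2 : ∑ u ∈ Finset.Ico (U / 2) U, c / (n : ℝ) ^ d ≤ ∑ u ∈ Finset.Ico (U / 2) U,
              (heatKernel u (pt p - y) + heatKernel (u + 1) (pt p - y)) := by
            refine Finset.sum_le_sum fun u hu => ?_
            rw [Finset.mem_Ico] at hu
            exact hlow n (by omega) u hu.1 hu.2.le _ (by
              intro i; have := hpt p hp i; simpa using this)
          have h3 : (n : ℝ) ^ 2 / 2 * (c / (n : ℝ) ^ d) ≤ ∑ u ∈ Finset.Ico (U / 2) U, c / (n : ℝ) ^ d := by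
            rw [Finset.sum_const, Nat.card_Ico, nsmul_eq_mul]
            gcongr
            rw [div_le_iff₀ (by norm_num)]
            have : U ≤ (U - U / 2) * 2 := by omega
            exact_mod_cast this
          calc _ = (n : ℝ) ^ 2 / 2 * (c / (n : ℝ) ^ d) / 2 / 2 := by ring
            _ ≤ _ := by gcongr; linarith
      _ = ∑ x ∈ T ×ˢ s, heatKernel x.1 (pt x.2 - y) / 2 := by
          rw [Finset.sum_product, Finset.sum_comm]
      _ ≤ ∑ x ∈ T ×ˢ s, mean fun σ => A x σ * D x.1 σ := Finset.sum_le_sum hfirst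
      _ = mean N := (lin_sum _ _ _).symm
  -- The second moment: two visits have the probability `n ^ (-d)` of the first one times the heat
  -- kernel between the points, and the sum over the time of the second one is the Green function.
  -- So the energy appears.
  have hcross : ∀ x ∈ T ×ˢ s, ∀ z ∈ T ×ˢ s, mean (fun σ => A x σ * A z σ) ≤
      C / (n : ℝ) ^ d * (ind (x.1 ≤ z.1) * heatKernel (z.1 - x.1) (pt z.2 - pt x.2) +
        ind (z.1 ≤ x.1) * heatKernel (x.1 - z.1) (pt x.2 - pt z.2)) := by
    have key : ∀ x ∈ T ×ˢ s, ∀ z ∈ T ×ˢ s, x.1 ≤ z.1 → mean (fun σ => A x σ * A z σ) ≤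
        C / (n : ℝ) ^ d * heatKernel (z.1 - x.1) (pt z.2 - pt x.2) := by
      intro x hx z hz hxz
      rw [Finset.mem_product] at hx hz
      have hz2 := (Finset.mem_Icc.1 hz.1).2
      have e : ∀ σ : I → Dir d, A x σ * A z σ =
          A x σ * ind (walkInc σ w (a + x.1) (a + z.1) = pt z.2 - pt x.2) := by
        intro σ
        by_cases h : walkInc σ w a (a + x.1) = pt x.2 - y
        · simp only [A, ind_true h, one_mul]
          rw [← walkInc_add σ w (b := a + x.1) (by omega) (by omega), h]
          refine ind_congr ⟨fun h => ?_, fun h => by rw [h]; abel⟩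
          rw [← eq_sub_iff_add_eq'] at h
          rw [h]; abel
        · simp only [A, ind_false h, zero_mul]
      simp only [e]
      rw [mean_mul_of_depOn (slots w a (a + x.1))
        ((depOn_walkInc w a (a + x.1)).comp fun z => ind (z = pt x.2 - y))
        (((depOn_walkInc w (a + x.1) (a + z.1)).comp fun v => ind (v = pt z.2 - pt x.2)).mono
          (slots_subset_compl_of_le w w le_rfl))]
      change mean (A x) * _ ≤ _
      have h2 := mean_walkInc_eq (I := I) w (show a + x.1 ≤ a + z.1 by omega)
        (fun m h1 h2 => hI m (by omega) (by omega)) (pt z.2 - pt x.2)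
      rw [hAmean x hx.1, h2, Nat.add_sub_add_left]
      have := heatKernel_nonneg (z.1 - x.1) (pt z.2 - pt x.2)
      gcongr
      exact hup n hn1 _ (Finset.mem_Icc.1 hx.1).1 _
    intro x hx z hz
    have p1 := heatKernel_nonneg (z.1 - x.1) (pt z.2 - pt x.2)
    have p2 := heatKernel_nonneg (x.1 - z.1) (pt x.2 - pt z.2)
    have q1 := ind_nonneg (x.1 ≤ z.1)
    have q2 := ind_nonneg (z.1 ≤ x.1)
    rcases le_total x.1 z.1 with h | h
    · refine (key x hx z hz h).trans ?_
      gcongr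
      rw [ind_true h, one_mul]
      have := mul_nonneg q2 p2
      linarith
    · have := key z hz x hx h
      simp only [mul_comm (A z _)] at this
      refine this.trans ?_
      gcongr
      rw [ind_true h, one_mul]
      have := mul_nonneg q1 p1
      linarith
  have hE0 := energy_pos U hs pt
  have hEN2 : mean (fun σ => N σ ^ 2) ≤ 4 * C * n ^ 2 / (n : ℝ) ^ d * energy U s pt := by
    have h1 : ∀ σ, N σ ^ 2 ≤ ∑ x ∈ T ×ˢ s, ∑ z ∈ T ×ˢ s, A x σ * A z σ := by
      intro σ
      have : N σ ≤ ∑ x ∈ T ×ˢ s, A x σ := Finset.sum_le_sum fun x _ =>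
        mul_le_of_le_one_right (hA0 _ _) (ind_le_one _)
      calc N σ ^ 2 ≤ (∑ x ∈ T ×ˢ s, A x σ) ^ 2 := by gcongr; exact hN0 σ
        _ = _ := by rw [sq, Finset.sum_mul_sum]
    refine (mean_mono h1).trans ?_
    rw [lin_sum]
    simp only [lin_sum]
    have h2 : ∀ x ∈ T ×ˢ s, ∑ z ∈ T ×ˢ s, mean (fun σ => A x σ * A z σ) ≤
        C / (n : ℝ) ^ d * ∑ q ∈ s, (green U (pt q - pt x.2) + green U (pt x.2 - pt q)) := by
      intro x hx
      refine (Finset.sum_le_sum fun z hz => hcross x hx z hz).trans ?_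
      rw [← Finset.mul_sum, Finset.sum_product, Finset.sum_comm]
      gcongr with q hq
      rw [Finset.sum_add_distrib]
      rw [Finset.mem_product] at hx
      have hx2 := (Finset.mem_Icc.1 hx.1).2
      gcongr
      · exact sum_ind_sub_le T x.1 (U + 1) (fun k => heatKernel_nonneg k (pt q - pt x.2)) fun v hv => by
          have := (Finset.mem_Icc.1 hv).2; omega
      · exact sum_ind_sub_le' T x.1 (U + 1) (fun k => heatKernel_nonneg k (pt x.2 - pt q)) fun v hv => by omega
    calc _ ≤ ∑ x ∈ T ×ˢ s, C / (n : ℝ) ^ d *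
          ∑ q ∈ s, (green U (pt q - pt x.2) + green U (pt x.2 - pt q)) :=
          Finset.sum_le_sum h2
      _ = ∑ u ∈ T, C / (n : ℝ) ^ d * (2 * energy U s pt) := by
          rw [Finset.sum_product]
          refine Finset.sum_congr rfl fun u _ => ?_
          rw [← Finset.mul_sum]
          congr 1
          simp only [Finset.sum_add_distrib]
          unfold energy
          rw [two_mul]
          congr 1
          rw [Finset.sum_comm]
      _ = (T.card : ℝ) * (C / (n : ℝ) ^ d * (2 * energy U s pt)) := by simp
      _ ≤ (2 * (n : ℝ) ^ 2) * (C / (n : ℝ) ^ d * (2 * energy U s pt)) := by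
          gcongr
          have h3 : T.card ≤ 2 * n ^ 2 := by
            rw [hT, Nat.card_Icc]
            have : 1 ≤ U := Nat.one_le_pow _ _ hn1
            omega
          exact_mod_cast h3
      _ = _ := by ring
  have hCS := mean_sq_le_ind_pos_mul N hN0
  set P := mean fun σ : I → Dir d => ind (Hits n (R₀ + 2 * d) s pt y w a σ)
  have hP0 : 0 ≤ P := mean_nonneg fun _ => ind_nonneg _
  have h1 : (mean N) ^ 2 ≤ P * (4 * C * n ^ 2 / (n : ℝ) ^ d * energy U s pt) := by
    refine hCS.trans (mul_le_mul (mean_mono hpos) hEN2 (mean_nonneg fun _ => sq_nonneg _) hP0)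
  have h2 : ((s.card : ℝ) * (c * n ^ 2 / (8 * (n : ℝ) ^ d))) ^ 2 ≤ (mean N) ^ 2 := by gcongr
  have h3 : κ * energy U s pt * (c * n ^ 2 / (8 * (n : ℝ) ^ d)) ^ 2 ≤
      P * (4 * C * n ^ 2 / (n : ℝ) ^ d * energy U s pt) := by
    refine le_trans ?_ (h2.trans h1)
    rw [mul_pow]; gcongr
  have hnd : (0 : ℝ) < (n : ℝ) ^ d := by positivity
  have hn2 : (0 : ℝ) < (n : ℝ) ^ 2 := by positivity
  have h4 : (energy U s pt * (n : ℝ) ^ 2 / (n : ℝ) ^ d * (4 * C)) *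
      (c ^ 2 / (256 * C) * κ * (n : ℝ) ^ 2 / (n : ℝ) ^ d) ≤
      (energy U s pt * (n : ℝ) ^ 2 / (n : ℝ) ^ d * (4 * C)) * P := by
    calc _ = κ * energy U s pt * (c * n ^ 2 / (8 * (n : ℝ) ^ d)) ^ 2 := by field_simp; ring
      _ ≤ _ := h3
      _ = _ := by ring
  exact le_of_mul_le_mul_left h4 (by positivity)

/-! ### Passing from one generation of walks to the next -/

/-- The box `B(n)` as a finite set. -/
noncomputable def boxFinset (d n : ℕ) : Finset (Lattice d) := Fintype.piFinset fun _ => Finset.Icc (-(n : ℤ)) n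

theorem mem_boxFinset {n : ℕ} {z : Lattice d} : z ∈ boxFinset d n ↔ ∀ i, |z i| ≤ (n : ℤ) := by
  simp [boxFinset, abs_le]

theorem card_boxFinset (n : ℕ) : (boxFinset d n).card = (2 * n + 1) ^ d := by
  simp only [boxFinset, Fintype.card_piFinset, Int.card_Icc, Finset.prod_const, Finset.card_univ,
    Fintype.card_fin]
  congr 1; omega

theorem abs_le_of_mem_boxFinset {n : ℕ} {z : Lattice d} (h : z ∈ boxFinset d n) (i : Fin d) :
    |((z i : ℤ) : ℝ)| ≤ n := by
  have := mem_boxFinset.1 h i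
  rw [← Int.cast_abs]; exact_mod_cast this

theorem ind_mem_eq_sum {G : Type*} (s : Finset G) (x : G) :
    ind (x ∈ s) = ∑ b ∈ s, ind (x = b) := by
  classical
  by_cases h : x ∈ s
  · rw [Finset.sum_eq_single_of_mem x h fun b _ hb => ind_false (Ne.symm hb)]
    simp [h]
  · rw [ind_false h, Finset.sum_eq_zero]
    intro b hb
    exact ind_false fun e => h (e ▸ hb)

theorem stepMean_add_mem (u : ℕ) (y : Lattice d) (s : Finset (Lattice d)) :
    stepMean dirVec u (fun x => ind (y + x ∈ s)) = ∑ b ∈ s, heatKernel u (b - y) := by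
  simp only [ind_mem_eq_sum]
  rw [lin_sum]
  refine Finset.sum_congr rfl fun b _ => ?_
  unfold heatKernel
  congr 1; ext x
  exact ind_congr ⟨fun h => by rw [← h]; abel, fun h => by rw [h]; abel⟩

set_option maxHeartbeats 1000000 in
/-- Suppose that walks `w` of a group `g` succeed, by what they do until time `n²`, with
probabilities that add up to `∑ p_w ≥ 1`. Then, with a probability bounded from below, the points
that the successful ones visit in `B(n)` between the times `3n²/2` and `2n²` have capacity at
least of the order of the smaller one of `n ∑ p_w` and `n^(d-2)`. -/
theorem exists_generation (hd : 3 ≤ d) {R : ℝ} (hR : 0 < R) :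
    ∃ c : ℝ, 0 < c ∧ ∃ n₀ : ℕ, ∀ n ≥ n₀, ∀ (I : Finset (ℕ × ℕ)) (g : Finset ℕ)
      (x : ℕ → Lattice d) (succ : ℕ → (I → Dir d) → Prop),
      (∀ w ∈ g, ∀ m < 2 * n ^ 2, (w, m) ∈ I) →
      (∀ w ∈ g, DepOn (succ w) (slots w 0 (n ^ 2))) →
      (∀ w ∈ g, ∀ σ, succ w σ → ∀ i, |((walkPos x σ w (n ^ 2) i : ℤ) : ℝ)| ≤ R * n) →
      1 ≤ ∑ w ∈ g, mean (fun σ => ind (succ w σ)) →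
      ∀ κ : ℝ, 0 ≤ κ → κ ≤ c * n * ∑ w ∈ g, mean (fun σ => ind (succ w σ)) →
      κ ≤ c * ((n : ℝ) ^ d / (n : ℝ) ^ 2) →
      c ≤ mean fun σ : I → Dir d => ind (∃ s : Finset (ℕ × ℕ), s.Nonempty ∧
        (∀ p ∈ s, p.1 ∈ g ∧ succ p.1 σ ∧ p.2 ≤ 2 * n ^ 2 ∧ walkPos x σ p.1 p.2 ∈ boxFinset d n) ∧
        κ * energy (n ^ 2) s (fun p => walkPos x σ p.1 p.2) ≤ (s.card : ℝ) ^ 2) := by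
  classical
  have : NeZero d := ⟨by omega⟩
  obtain ⟨c, hc, n₁, hlow⟩ := exists_heatKernel_ge (d := d) (R + 1) (by positivity)
  obtain ⟨C₁, hC₁, hself⟩ := exists_path_energy_le hd
  obtain ⟨C₂, hC₂, hcr⟩ := exists_stepMean_green_le_pow (d := d)
  set c₀ := c ^ 2 / 1024 with hc₀
  have hc₀pos : 0 < c₀ := by positivity
  set c' := c₀ * c ^ 2 / (256 * (2 * C₁ + 2 * C₂)) with hc'
  have hc'pos : 0 < c' := by positivity
  refine ⟨min c' c₀, lt_min hc'pos hc₀pos, n₁ + 1, ?_⟩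
  intro n hn I g x succ hI hdep hnear hP κ hκ0 hκ1 hκ2
  have hn1 : 1 ≤ n := by omega
  have hn' : (1 : ℝ) ≤ n := by exact_mod_cast hn1
  set U := n ^ 2 with hU
  have hU1 : 1 ≤ U := Nat.one_le_pow _ _ hn1
  set T := Finset.Icc (U + U / 2) (2 * U) with hT
  let ξ : ℕ → (I → Dir d) → ℝ := fun w σ => ind (succ w σ)
  let V : ℕ → ℕ → (I → Dir d) → ℝ := fun w t σ => ind (walkPos x σ w t ∈ boxFinset d n)
  let p : ℕ → ℝ := fun w => mean (ξ w)
  have hp0 : ∀ w, 0 ≤ p w := fun w => mean_nonneg fun _ => ind_nonneg _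
  set P := ∑ w ∈ g, p w with hPdef
  have hP1 : 1 ≤ P := hP
  have hcardT : (T.card : ℝ) ≤ 2 * (n : ℝ) ^ 2 := by
    have : T.card ≤ 2 * n ^ 2 := by rw [hT, Nat.card_Icc]; omega
    exact_mod_cast this
  have hξdep : ∀ w ∈ g, DepOn (ξ w) (slots w 0 U) := fun w hw => (hdep w hw).comp ind
  have hξ0 : ∀ w σ, 0 ≤ ξ w σ := fun _ _ => ind_nonneg _
  have hξ1 : ∀ w σ, ξ w σ ≤ 1 := fun _ _ => ind_le_one _
  -- `K` is the number of pairs (successful walk, time) with the walk in `B(n)`. Its mean is of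
  -- order `P n ^ 2`, where `P ≥ 1` is the expected number of successful walks, and its second
  -- moment of order `P ^ 2 n ^ 4`.
  let K : (I → Dir d) → ℝ := fun σ => ∑ w ∈ g, ∑ t ∈ T, ξ w σ * V w t σ
  have hpair : ∀ w ∈ g, ∀ t ∈ Finset.Ico (U + U / 2) (2 * U),
      p w * c ≤ mean (fun σ => ξ w σ * V w t σ) + mean (fun σ => ξ w σ * V w (t + 1) σ) := by
    intro w hw t ht
    rw [Finset.mem_Ico] at ht
    rw [← lin_add]
    have e : ∀ σ : I → Dir d, ξ w σ * V w t σ + ξ w σ * V w (t + 1) σ =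
        ξ w σ * (ind (walkPos x σ w U + walkInc σ w U t ∈ boxFinset d n) +
          ind (walkPos x σ w U + walkInc σ w U (t + 1) ∈ boxFinset d n)) := by
      intro σ
      rw [← walkPos_add x σ w (by omega), ← walkPos_add x σ w (by omega)]; ring
    simp only [e]
    refine mean_decouple_ge (slots w 0 U) (F := fun σ τ =>
        ξ w σ * (ind (walkPos x σ w U + walkInc τ w U t ∈ boxFinset d n) +
          ind (walkPos x σ w U + walkInc τ w U (t + 1) ∈ boxFinset d n))) ?_ ?_ ?_
    · intro τ
      exact (hξdep w hw).comp₂ (depOn_walkPos x w U) fun a y =>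
        a * (ind (y + walkInc τ w U t ∈ boxFinset d n) +
          ind (y + walkInc τ w U (t + 1) ∈ boxFinset d n))
    · intro σ
      refine DepOn.mono (S := slots w U (t + 1)) ?_ (slots_subset_compl_of_le w w le_rfl)
      exact ((depOn_walkInc w U t).mono (slots_mono w le_rfl (by omega))).comp₂
        (depOn_walkInc w U (t + 1)) fun a b => ξ w σ *
          (ind (walkPos x σ w U + a ∈ boxFinset d n) + ind (walkPos x σ w U + b ∈ boxFinset d n))
    · intro σ
      by_cases hs : succ w σ
      swap
      · simp only [ξ, ind_false hs]; simp
      have hy := hnear w hw σ hs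
      simp only [lin_mul]
      gcongr
      · exact hξ0 w σ
      rw [lin_add,
        mean_walkInc' w (show U ≤ t by omega) (fun m h1 h2 => hI w hw m (by omega))
          (fun z => ind (walkPos x σ w U + z ∈ boxFinset d n)),
        mean_walkInc' w (show U ≤ t + 1 by omega) (fun m h1 h2 => hI w hw m (by omega))
          (fun z => ind (walkPos x σ w U + z ∈ boxFinset d n)),
        stepMean_add_mem, stepMean_add_mem, ← Finset.sum_add_distrib]
      calc c = (n : ℝ) ^ d * (c / (n : ℝ) ^ d) := by field_simp
        _ ≤ ((boxFinset d n).card : ℝ) * (c / (n : ℝ) ^ d) := by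
            rw [card_boxFinset]; push_cast; gcongr; linarith
        _ = ∑ b ∈ boxFinset d n, c / (n : ℝ) ^ d := by simp
        _ ≤ _ := by
            refine Finset.sum_le_sum fun b hb => ?_
            rw [show t + 1 - U = t - U + 1 by omega]
            refine hlow n (by omega) (t - U) (by omega) (by omega) _ fun i => ?_
            have h1 := abs_le_of_mem_boxFinset hb i
            have h2 := hy i
            have h3 := abs_sub (((b i : ℤ)) : ℝ) ((walkPos x σ w U i : ℤ) : ℝ)
            simp only [Pi.sub_apply]; push_cast
            linarith
  have hEK : c * P * n ^ 2 / 4 ≤ mean K := by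
    have h1 : ∀ w ∈ g, p w * (c * n ^ 2 / 4) ≤ ∑ t ∈ T, mean (fun σ => ξ w σ * V w t σ) := by
      intro w hw
      have h2 := half_sum_pairs_le (f := fun t => mean (fun σ => ξ w σ * V w t σ))
        (fun t => mean_nonneg fun σ => mul_nonneg (ind_nonneg _) (ind_nonneg _)) (U + U / 2) (2 * U)
      refine le_trans ?_ h2
      have h3 := Finset.sum_le_sum (hpair w hw)
      rw [Finset.sum_const, Nat.card_Ico, nsmul_eq_mul] at h3
      have h4 : (n : ℝ) ^ 2 / 2 ≤ ((2 * U - (U + U / 2) : ℕ) : ℝ) := by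
        rw [div_le_iff₀ (by norm_num)]
        have : U ≤ (2 * U - (U + U / 2)) * 2 := by omega
        exact_mod_cast this
      have h5 := mul_le_mul_of_nonneg_right h4 (mul_nonneg (hp0 w) hc.le)
      linarith
    have h2 : mean K = ∑ w ∈ g, ∑ t ∈ T, mean (fun σ => ξ w σ * V w t σ) := by
      simp only [K, lin_sum]
    rw [h2]
    refine le_trans (le_of_eq ?_) (Finset.sum_le_sum h1)
    rw [← Finset.sum_mul]; ring
  have hindep : ∀ w ∈ g, ∀ w' ∈ g, w ≠ w' → mean (fun σ => ξ w σ * ξ w' σ) = p w * p w' := by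
    intro w hw w' hw' hne
    exact mean_mul_of_depOn (slots w 0 U) (hξdep w hw)
      ((hξdep w' hw').mono (slots_subset_compl_of_ne hne.symm _ _ _ _))
  have hξsq : ∀ w σ, ξ w σ * ξ w σ = ξ w σ := by
    intro w σ; by_cases h : succ w σ <;> simp [ξ, h]
  have hEK2 : mean (fun σ => K σ ^ 2) ≤ 8 * (n : ℝ) ^ 4 * P ^ 2 := by
    have h1 : ∀ σ, K σ ^ 2 ≤ 4 * (n : ℝ) ^ 4 * ∑ w ∈ g, ∑ w' ∈ g, ξ w σ * ξ w' σ := by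
      intro σ
      have h2 : K σ ≤ 2 * (n : ℝ) ^ 2 * ∑ w ∈ g, ξ w σ := by
        rw [Finset.mul_sum]
        refine Finset.sum_le_sum fun w _ => ?_
        calc _ ≤ ∑ _t ∈ T, ξ w σ := Finset.sum_le_sum fun t _ =>
              mul_le_of_le_one_right (hξ0 _ _) (ind_le_one _)
          _ = T.card * ξ w σ := by simp
          _ ≤ _ := by gcongr; exact hξ0 _ _
      have h3 : 0 ≤ K σ := Finset.sum_nonneg fun w _ => Finset.sum_nonneg fun t _ =>
        mul_nonneg (ind_nonneg _) (ind_nonneg _)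
      calc K σ ^ 2 ≤ (2 * (n : ℝ) ^ 2 * ∑ w ∈ g, ξ w σ) ^ 2 := by gcongr
        _ = _ := by rw [← Finset.sum_mul_sum]; ring
    refine (mean_mono h1).trans ?_
    rw [lin_mul, lin_sum]
    simp only [lin_sum]
    have h2 : ∑ w ∈ g, ∑ w' ∈ g, mean (fun σ => ξ w σ * ξ w' σ) ≤ P + P * P := by
      rw [hPdef, Finset.sum_mul_sum, ← Finset.sum_add_distrib]
      refine Finset.sum_le_sum fun w hw => ?_
      rw [← Finset.add_sum_erase _ _ hw, ← Finset.add_sum_erase _ (fun j => p w * p j) hw]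
      have h3 : ∑ w' ∈ g.erase w, mean (fun σ => ξ w σ * ξ w' σ) = ∑ w' ∈ g.erase w, p w * p w' :=
        Finset.sum_congr rfl fun w' hw' =>
          hindep w hw w' (Finset.mem_of_mem_erase hw') (Finset.ne_of_mem_erase hw').symm
      simp only [hξsq]
      rw [h3]
      have := mul_nonneg (hp0 w) (hp0 w)
      change p w + _ ≤ _
      linarith
    have h3 : P + P * P ≤ 2 * P ^ 2 := by nlinarith
    calc _ ≤ 4 * (n : ℝ) ^ 4 * (2 * P ^ 2) := by gcongr; linarith
      _ = _ := by ring
  have hPZ := paley_zygmund (f := K) (m := c * P * n ^ 2 / 4) (V := 8 * (n : ℝ) ^ 4 * P ^ 2)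
    (by positivity) (by positivity) hEK hEK2
  have hPZc : (c * P * n ^ 2 / 4) ^ 2 / (4 * (8 * (n : ℝ) ^ 4 * P ^ 2)) = 2 * c₀ := by
    rw [hc₀]; field_simp; norm_num
  rw [hPZc] at hPZ
  -- `E` is the energy of these points. A single path contributes at most of order `n ^ 3`
  -- (dimension three is the worst case), and two different paths contribute at most of order
  -- `n ^ (6 - d)`.
  let E : (I → Dir d) → ℝ := fun σ => ∑ w ∈ g, ∑ w' ∈ g, ∑ t ∈ T, ∑ t' ∈ T,
    ξ w σ * ξ w' σ * green U (walkPos x σ w' t' - walkPos x σ w t)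
  have hE0 : ∀ σ, 0 ≤ E σ := fun σ => Finset.sum_nonneg fun _ _ => Finset.sum_nonneg fun _ _ =>
    Finset.sum_nonneg fun _ _ => Finset.sum_nonneg fun _ _ =>
      mul_nonneg (mul_nonneg (ind_nonneg _) (ind_nonneg _)) (green_nonneg _ _)
  have hdiag : ∀ w ∈ g, ∑ t ∈ T, ∑ t' ∈ T, mean (fun σ =>
      ξ w σ * ξ w σ * green U (walkPos x σ w t' - walkPos x σ w t)) ≤ p w * (4 * C₁ * n ^ 3) := by
    intro w hw
    have h1 : ∀ t ∈ T, ∀ t' ∈ T, mean (fun σ =>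
        ξ w σ * ξ w σ * green U (walkPos x σ w t' - walkPos x σ w t)) =
        p w * mean (fun σ : I → Dir d => green U (walkInc σ w U t' - walkInc σ w U t)) := by
      intro t ht t' ht'
      rw [Finset.mem_Icc] at ht ht'
      have e : ∀ σ : I → Dir d, ξ w σ * ξ w σ * green U (walkPos x σ w t' - walkPos x σ w t) =
          ξ w σ * green U (walkInc σ w U t' - walkInc σ w U t) := by
        intro σ
        rw [hξsq, walkPos_add x σ w (show U ≤ t by omega), walkPos_add x σ w (show U ≤ t' by omega),
          add_sub_add_left_eq_sub]
      simp only [e]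
      refine mean_mul_of_depOn (slots w 0 U) (hξdep w hw) ?_
      refine DepOn.mono (S := slots w U (2 * U)) ?_ (slots_subset_compl_of_le w w le_rfl)
      exact ((depOn_walkInc w U t').mono (slots_mono w le_rfl ht'.2)).comp₂
        ((depOn_walkInc w U t).mono (slots_mono w le_rfl ht.2)) fun a b => green U (a - b)
    rw [Finset.sum_congr rfl fun t ht => Finset.sum_congr rfl fun t' ht' => h1 t ht t' ht']
    simp only [← Finset.mul_sum]
    refine mul_le_mul_of_nonneg_left ?_ (hp0 w)
    have h2 := hself n hn1 I w U (U + 1) (fun m h1 h2 => hI w hw m (by omega))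
    have h3 : T ⊆ Finset.Ico U (U + (U + 1)) := by
      intro t ht; rw [Finset.mem_Icc] at ht; rw [Finset.mem_Ico]; omega
    have hg0 : ∀ t t', 0 ≤ mean (fun σ : I → Dir d => green U (walkInc σ w U t' - walkInc σ w U t)) :=
      fun t t' => mean_nonneg fun _ => green_nonneg _ _
    calc _ ≤ ∑ t ∈ Finset.Ico U (U + (U + 1)), ∑ t' ∈ Finset.Ico U (U + (U + 1)),
          mean (fun σ : I → Dir d => green U (walkInc σ w U t' - walkInc σ w U t)) := by
          refine (Finset.sum_le_sum fun t _ => Finset.sum_le_sum_of_subset_of_nonneg h3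
            fun t' _ _ => hg0 t t').trans (Finset.sum_le_sum_of_subset_of_nonneg h3
              fun t _ _ => Finset.sum_nonneg fun t' _ => hg0 t t')
      _ ≤ _ := h2
      _ ≤ C₁ * (2 * (n : ℝ) ^ 2) * (2 * √n) * √n := by
          have := sq_add_one_rpow_le hn1
          gcongr
          push_cast [hU]; nlinarith
      _ = 4 * C₁ * n ^ 2 * (√n * √n) := by ring
      _ = _ := by rw [Real.mul_self_sqrt (by positivity)]; ring
  have hoff : ∀ w ∈ g, ∀ w' ∈ g, w ≠ w' → ∑ t ∈ T, ∑ t' ∈ T, mean (fun σ =>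
      ξ w σ * ξ w' σ * green U (walkPos x σ w' t' - walkPos x σ w t)) ≤
        p w * p w' * (4 * C₂ * (n : ℝ) ^ 6 / (n : ℝ) ^ d) := by
    intro w hw w' hw' hne
    have h1 : ∀ t ∈ T, ∀ t' ∈ T, mean (fun σ =>
        ξ w σ * ξ w' σ * green U (walkPos x σ w' t' - walkPos x σ w t)) ≤
        p w * p w' * (C₂ * (n : ℝ) ^ 2 / (n : ℝ) ^ d) := by
      intro t ht t' ht'
      rw [Finset.mem_Icc] at ht ht'
      have e : ∀ σ : I → Dir d,
          ξ w σ * ξ w' σ * green U (walkPos x σ w' t' - walkPos x σ w t) =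
          ξ w σ * ξ w' σ * green U (walkPos x σ w' U - walkPos x σ w t + walkInc σ w' U t') := by
        intro σ
        rw [walkPos_add x σ w' (show U ≤ t' by omega)]
        congr 2; abel
      simp only [e]
      rw [← hindep w hw w' hw' hne]
      have hs1 : slots w 0 t ⊆ (slots w' U t')ᶜ := slots_subset_compl_of_ne hne _ _ _ _
      have hs2 : slots w 0 U ⊆ (slots w' U t')ᶜ := slots_subset_compl_of_ne hne _ _ _ _
      have hs3 : slots w' 0 U ⊆ (slots w' U t')ᶜ := by
        rintro q ⟨_, _, h1⟩ ⟨_, h2, _⟩; omega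
      have hd1 := (hξdep w hw).mono hs2
      have hd2 := (hξdep w' hw').mono hs3
      have hd3 := (depOn_walkPos (I := I) x w' U).mono hs3
      have hd4 := (depOn_walkPos (I := I) x w t).mono hs1
      refine mean_decouple_le (slots w' U t')ᶜ (F := fun σ τ =>
        ξ w σ * ξ w' σ * green U (walkPos x σ w' U - walkPos x σ w t + walkInc τ w' U t')) ?_ ?_ ?_
      · intro τ
        exact (hd1.comp₂ hd2 fun a b => a * b).comp₂ (hd3.comp₂ hd4 fun a b => a - b)
          fun a y => a * green U (y + walkInc τ w' U t')
      · intro σ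
        rw [compl_compl]
        exact (depOn_walkInc w' U t').comp fun z =>
          ξ w σ * ξ w' σ * green U (walkPos x σ w' U - walkPos x σ w t + z)
      · intro σ
        simp only [lin_mul]
        refine mul_le_mul_of_nonneg_left ?_ (mul_nonneg (ind_nonneg _) (ind_nonneg _))
        rw [mean_walkInc' w' (show U ≤ t' by omega) (fun m h1 h2 => hI w' hw' m (by omega))
          (fun z => green U (walkPos x σ w' U - walkPos x σ w t + z))]
        exact hcr n hn1 (t' - U) (by omega) _
    calc _ ≤ ∑ _t ∈ T, ∑ _t' ∈ T, p w * p w' * (C₂ * (n : ℝ) ^ 2 / (n : ℝ) ^ d) :=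
          Finset.sum_le_sum fun t ht => Finset.sum_le_sum fun t' ht' => h1 t ht t' ht'
      _ = (T.card : ℝ) * ((T.card : ℝ) * (p w * p w' * (C₂ * (n : ℝ) ^ 2 / (n : ℝ) ^ d))) := by
          simp
      _ ≤ (2 * (n : ℝ) ^ 2) * ((2 * (n : ℝ) ^ 2) * (p w * p w' * (C₂ * (n : ℝ) ^ 2 / (n : ℝ) ^ d))) := by
          have := hp0 w; have := hp0 w'
          gcongr
      _ = _ := by ring
  set B := 4 * C₁ * n ^ 3 * P + 4 * C₂ * (n : ℝ) ^ 6 / (n : ℝ) ^ d * P ^ 2 with hB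
  have hBpos : 0 < B := by positivity
  have hEE : mean E ≤ B := by
    simp only [E, lin_sum]
    have h1 : ∀ w ∈ g, ∑ w' ∈ g, ∑ t ∈ T, ∑ t' ∈ T, mean (fun σ =>
        ξ w σ * ξ w' σ * green U (walkPos x σ w' t' - walkPos x σ w t)) ≤
        p w * (4 * C₁ * n ^ 3) + ∑ w' ∈ g, p w * p w' * (4 * C₂ * (n : ℝ) ^ 6 / (n : ℝ) ^ d) := by
      intro w hw
      rw [← Finset.add_sum_erase _ _ hw]
      refine add_le_add (hdiag w hw) ?_
      refine (Finset.sum_le_sum fun w' hw' => hoff w hw w' (Finset.mem_of_mem_erase hw')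
        (Finset.ne_of_mem_erase hw').symm).trans ?_
      refine Finset.sum_le_sum_of_subset_of_nonneg (Finset.erase_subset _ _) fun w' _ _ => ?_
      have := hp0 w; have := hp0 w'
      positivity
    refine (Finset.sum_le_sum h1).trans (le_of_eq ?_)
    rw [Finset.sum_add_distrib, ← Finset.sum_mul]
    simp only [← Finset.sum_mul, ← Finset.mul_sum]
    rw [hB]; ring
  have hM := markov hE0 (t := B / c₀) (by positivity)
  have hM2 : mean E / (B / c₀) ≤ c₀ := by
    rw [div_le_iff₀ (by positivity)]
    calc mean E ≤ B := hEE
      _ = _ := by field_simp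
  -- With probability at least `2 c₀ - c₀` the number is large and, by the inequality of Markov,
  -- the energy is small.
  refine (min_le_right _ _).trans ?_
  have hfin : ∀ σ : I → Dir d, ind (c * P * n ^ 2 / 4 / 2 ≤ K σ) - ind (B / c₀ < E σ) ≤
      ind (∃ s : Finset (ℕ × ℕ), s.Nonempty ∧
        (∀ p ∈ s, p.1 ∈ g ∧ succ p.1 σ ∧ p.2 ≤ 2 * U ∧ walkPos x σ p.1 p.2 ∈ boxFinset d n) ∧
        κ * energy U s (fun p => walkPos x σ p.1 p.2) ≤ (s.card : ℝ) ^ 2) := by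
    intro σ
    by_cases h1 : c * P * n ^ 2 / 4 / 2 ≤ K σ
    swap
    · rw [ind_false h1]
      have := ind_nonneg (B / c₀ < E σ)
      exact (by linarith : _ ≤ (0 : ℝ)).trans (ind_nonneg _)
    by_cases h2 : B / c₀ < E σ
    · rw [ind_true h1, ind_true h2, sub_self]; exact ind_nonneg _
    push Not at h2
    rw [ind_true h1, ind_false (not_lt.2 h2), sub_zero]
    let s : Finset (ℕ × ℕ) := (g ×ˢ T).filter fun q =>
      succ q.1 σ ∧ walkPos x σ q.1 q.2 ∈ boxFinset d n
    have hfi : ∀ q : ℕ × ℕ, (if succ q.1 σ ∧ walkPos x σ q.1 q.2 ∈ boxFinset d n then (1 : ℝ) else 0)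
        = ξ q.1 σ * V q.1 q.2 σ := by
      intro q
      change _ = ind _ * ind _
      rw [← ind_and]; simp [ind]
    have hcard : (s.card : ℝ) = K σ := by
      simp only [s, Finset.card_filter, K]
      push_cast
      simp only [hfi]
      rw [Finset.sum_product]
    have hen : energy U s (fun p => walkPos x σ p.1 p.2) ≤ E σ := by
      simp only [energy, s, E]
      rw [Finset.sum_filter]
      simp only [Finset.sum_filter]
      rw [Finset.sum_product]
      refine Finset.sum_le_sum fun w _ => ?_
      rw [Finset.sum_comm (s := g) (t := T)]
      refine Finset.sum_le_sum fun t _ => ?_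
      rw [← Finset.sum_product' (s := g) (t := T) (f := fun w' t' =>
        ξ w σ * ξ w' σ * green U (walkPos x σ w' t' - walkPos x σ w t))]
      have hnn : ∀ q : ℕ × ℕ, 0 ≤ ξ w σ * ξ q.1 σ * green U (walkPos x σ q.1 q.2 - walkPos x σ w t) :=
        fun q => mul_nonneg (mul_nonneg (ind_nonneg _) (ind_nonneg _)) (green_nonneg _ _)
      split_ifs with h3
      · refine Finset.sum_le_sum fun q _ => ?_
        split_ifs with h4
        · simp [ξ, h3.1, h4.1]
        · exact hnn q
      · exact Finset.sum_nonneg fun q _ => hnn q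
    have hKpos : 0 < K σ := lt_of_lt_of_le (by positivity) h1
    rw [ind_true]
    refine ⟨s, ?_, ?_, ?_⟩
    · rw [← Finset.card_pos]
      have : (0 : ℝ) < s.card := by rw [hcard]; exact hKpos
      exact_mod_cast this
    · intro q hq
      rw [Finset.mem_filter, Finset.mem_product, Finset.mem_Icc] at hq
      exact ⟨hq.1.1, hq.2.1, hq.1.2.2, hq.2.2⟩
    · rw [hcard]
      have k1 : κ ≤ c' * n * P := hκ1.trans (by
        have : min c' c₀ ≤ c' := min_le_left _ _
        gcongr)
      have k2 : κ ≤ c' * ((n : ℝ) ^ d / (n : ℝ) ^ 2) := hκ2.trans (by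
        have : min c' c₀ ≤ c' := min_le_left _ _
        gcongr)
      calc κ * energy U s (fun p => walkPos x σ p.1 p.2) ≤ κ * (B / c₀) := by
            gcongr; exact hen.trans h2
        _ = (κ * (4 * C₁ * n ^ 3 * P) + κ * (4 * C₂ * (n : ℝ) ^ 6 / (n : ℝ) ^ d * P ^ 2)) / c₀ := by
            rw [hB]; ring
        _ ≤ ((c' * n * P) * (4 * C₁ * n ^ 3 * P) +
            (c' * ((n : ℝ) ^ d / (n : ℝ) ^ 2)) * (4 * C₂ * (n : ℝ) ^ 6 / (n : ℝ) ^ d * P ^ 2)) / c₀ := by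
            gcongr
        _ = c' * (4 * C₁ + 4 * C₂) / c₀ * (P ^ 2 * n ^ 4) := by field_simp
        _ ≤ (c * P * n ^ 2 / 4 / 2) ^ 2 := by
            rw [hc']
            have : c₀ * c ^ 2 / (256 * (2 * C₁ + 2 * C₂)) * (4 * C₁ + 4 * C₂) / c₀ = c ^ 2 / 128 := by
              field_simp; ring
            rw [this]
            have : 0 ≤ c ^ 2 * (P ^ 2 * (n : ℝ) ^ 4) := by positivity
            nlinarith
        _ ≤ K σ ^ 2 := by gcongr
  have h5 := mean_mono hfin
  rw [lin_sub] at h5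
  linarith

/-! ### Independent trials -/

section trials
variable {I : Finset (ℕ × ℕ)}

theorem mean_prod_of_depOn {ι : Type*} (s : Finset ι) (f : ι → (I → Dir d) → ℝ)
    (S : ι → Set (ℕ × ℕ)) (h : ∀ j ∈ s, DepOn (f j) (S j))
    (hdis : ∀ j ∈ s, ∀ k ∈ s, j ≠ k → Disjoint (S j) (S k)) [NeZero d] :
    mean (fun σ => ∏ j ∈ s, f j σ) = ∏ j ∈ s, mean (f j) := by
  classical
  induction s using Finset.induction_on with
  | empty => simp
  | insert j s hj ih =>
    simp only [Finset.prod_insert hj]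
    rw [mean_mul_of_depOn (S j) (h j (Finset.mem_insert_self _ _)), ih]
    · exact fun k hk => h k (Finset.mem_insert_of_mem hk)
    · exact fun k hk l hl => hdis k (Finset.mem_insert_of_mem hk) l (Finset.mem_insert_of_mem hl)
    · intro σ τ hστ
      refine Finset.prod_congr rfl fun k hk => ?_
      refine h k (Finset.mem_insert_of_mem hk) σ τ fun p hp => hστ p ?_
      have := hdis j (Finset.mem_insert_self _ _) k (Finset.mem_insert_of_mem hk)
        (by rintro rfl; exact hj hk)
      exact fun hp' => Set.disjoint_left.1 this hp' hp

theorem ind_forall {ι : Type*} (s : Finset ι) (A : ι → Prop) :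
    ind (∀ j ∈ s, A j) = ∏ j ∈ s, ind (A j) := by
  by_cases h : ∀ j ∈ s, A j
  · rw [ind_true h, Finset.prod_eq_one fun j hj => ind_true (h j hj)]
  · rw [ind_false h]
    push Not at h
    obtain ⟨j, hj, hA⟩ := h
    exact (Finset.prod_eq_zero hj (ind_false hA)).symm

/-- Independent trials with success probabilities at least `p` rarely all fail. -/
theorem mean_forall_not_le [NeZero d] {ι : Type*} (s : Finset ι) (A : ι → (I → Dir d) → Prop)
    (S : ι → Set (ℕ × ℕ)) (h : ∀ j ∈ s, DepOn (A j) (S j))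
    (hdis : ∀ j ∈ s, ∀ k ∈ s, j ≠ k → Disjoint (S j) (S k)) {p : ℝ}
    (hp : ∀ j ∈ s, p ≤ mean fun σ => ind (A j σ)) :
    mean (fun σ => ind (∀ j ∈ s, ¬A j σ)) ≤ Real.exp (-(p * s.card)) := by
  simp only [ind_forall]
  rw [mean_prod_of_depOn s (fun j σ => ind (¬A j σ)) S
    (fun j hj => (h j hj).comp fun q => ind (¬q)) hdis]
  calc _ ≤ ∏ _j ∈ s, Real.exp (-p) := by
        refine Finset.prod_le_prod (fun j _ => mean_nonneg fun _ => ind_nonneg _) fun j hj => ?_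
        simp only [ind_not]
        rw [lin_sub, mean_const]
        have := Real.add_one_le_exp (-p)
        have := hp j hj
        linarith
    _ = _ := by
        rw [Finset.prod_const, ← Real.exp_nat_mul]; congr 1; ring

end trials

/-! ### A single path contains a set of large capacity -/

/-- The points `pt p`, `p ∈ s`, lie within distance `3n` of the origin and their capacity is at
least `κ`. -/
def Spread (n : ℕ) (κ : ℝ) (s : Finset (ℕ × ℕ)) (pt : ℕ × ℕ → Lattice d) : Prop :=
  s.Nonempty ∧ (∀ p ∈ s, ∀ k, |((pt p k : ℤ) : ℝ)| ≤ 3 * n) ∧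
    κ * energy (n ^ 2) s pt ≤ (s.card : ℝ) ^ 2

theorem energy_congr {ι : Type*} {U : ℕ} {s : Finset ι} {a b : ι → Lattice d}
    (h : ∀ p ∈ s, a p = b p) : energy U s a = energy U s b :=
  Finset.sum_congr rfl fun p hp => Finset.sum_congr rfl fun q hq => by rw [h p hp, h q hq]

theorem Spread.congr {n : ℕ} {κ : ℝ} {s : Finset (ℕ × ℕ)} {a b : ℕ × ℕ → Lattice d}
    (h : ∀ p ∈ s, a p = b p) (hs : Spread n κ s a) : Spread n κ s b :=
  ⟨hs.1, fun p hp => by rw [← h p hp]; exact hs.2.1 p hp, by rw [← energy_congr h]; exact hs.2.2⟩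

open Classical in
/-- The positions of the walks at the labels (walk, time) in `𝓛`, and `0` at other labels. -/
noncomputable def restr {I : Finset (ℕ × ℕ)} (𝓛 : Set (ℕ × ℕ)) (x : ℕ → Lattice d)
    (σ : I → Dir d) (p : ℕ × ℕ) : Lattice d := if p ∈ 𝓛 then walkPos x σ p.1 p.2 else 0

theorem restr_of_mem {I : Finset (ℕ × ℕ)} {𝓛 : Set (ℕ × ℕ)} (x : ℕ → Lattice d)
    (σ : I → Dir d) {p : ℕ × ℕ} (hp : p ∈ 𝓛) : restr 𝓛 x σ p = walkPos x σ p.1 p.2 := if_pos hp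

theorem depOn_restr {I : Finset (ℕ × ℕ)} {𝓛 S : Set (ℕ × ℕ)} (x : ℕ → Lattice d)
    (h : ∀ p ∈ 𝓛, slots p.1 0 p.2 ⊆ S) : DepOn (fun σ : I → Dir d => restr 𝓛 x σ) S := by
  intro σ τ hστ
  ext1 p
  by_cases hp : p ∈ 𝓛
  · simp only [restr, if_pos hp]
    exact depOn_walkPos x p.1 p.2 σ τ fun q hq => hστ q (h p hp hq)
  · simp only [restr, if_neg hp]

theorem mean_walkInc_large_le [NeZero d] {I : Finset (ℕ × ℕ)} (w : ℕ) {a b : ℕ} (hab : a ≤ b)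
    (hI : ∀ m, a ≤ m → m < b → (w, m) ∈ I) {r L : ℝ} (hr : 0 ≤ r) (hL : 0 < L)
    (hb : ((b - a : ℕ) : ℝ) ≤ L) :
    mean (fun σ : I → Dir d => ind (∃ k ∈ (Finset.univ : Finset (Fin d)),
      r < |((walkInc σ w a b k : ℤ) : ℝ)|)) ≤ 2 * d * Real.exp (-(r ^ 2 / (2 * L))) := by
  refine (mean_mono fun σ => ind_exists_le _ _).trans ?_
  rw [lin_sum]
  calc _ ≤ ∑ _k : Fin d, 2 * Real.exp (-(r ^ 2 / (2 * L))) := by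
        refine Finset.sum_le_sum fun k _ => ?_
        rw [mean_walkInc' w hab hI fun z => ind (r < |((z k : ℤ) : ℝ)|)]
        exact stepMean_large_le _ k hr hL hb
    _ = _ := by simp; ring

/-- Cut `Q * l` steps of a walk into `Q` pieces of length `l`. Except for the rare event `D`, the
walk moves by at most `n` during these steps, and one of the pieces has capacity at least of order
`l ^ (3 / 4) / n ^ (1 / 2)`. -/
theorem exists_seed (hd : 3 ≤ d) :
    ∃ C : ℝ, 0 < C ∧ ∀ n : ℕ, 1 ≤ n → ∀ (I : Finset (ℕ × ℕ)) (i a l Q : ℕ) (x : ℕ → Lattice d) (L : ℝ),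
      1 ≤ l → 0 < L → (∀ m < a + Q * l, (i, m) ∈ I) → ((Q * l : ℕ) : ℝ) ≤ L →
      ∃ D : (I → Dir d) → Prop, DepOn D (slots i a (a + Q * l)) ∧
        mean (fun σ => ind (D σ)) ≤
          2 * d * (L + 1) * Real.exp (-((n : ℝ) ^ 2 / (2 * L))) + Real.exp (-(1 / 2 * Q)) ∧
        ∀ σ, ¬D σ →
          (∀ t, a ≤ t → t ≤ a + Q * l → ∀ k, |((walkInc σ i a t k : ℤ) : ℝ)| ≤ n) ∧
          ∃ s : Finset (ℕ × ℕ), s.Nonempty ∧ (∀ p ∈ s, p.1 = i ∧ a ≤ p.2 ∧ p.2 ≤ a + Q * l) ∧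
            (l : ℝ) ^ (3 / 4 : ℝ) / (C * √n) * energy (n ^ 2) s (fun p => walkPos x σ p.1 p.2) ≤
              (s.card : ℝ) ^ 2 := by
  have : NeZero d := ⟨by omega⟩
  obtain ⟨C, hC, hen⟩ := exists_path_energy_le hd
  refine ⟨2 * C, by positivity, ?_⟩
  intro n hn I i a l Q x L hl hL hI hQL
  have hn' : (1 : ℝ) ≤ n := by exact_mod_cast hn
  have hl' : (1 : ℝ) ≤ l := by exact_mod_cast hl
  have hsqrt : 0 < √(n : ℝ) := Real.sqrt_pos.2 (by linarith)
  let J : ℕ → Finset ℕ := fun b => Finset.Ico (a + b * l) (a + b * l + l)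
  have hJQ : ∀ b < Q, a + b * l + l ≤ a + Q * l := by
    intro b hb
    have : (b + 1) * l ≤ Q * l := Nat.mul_le_mul_right _ hb
    linarith [this, Nat.succ_mul b l]
  let e : ℕ → (I → Dir d) → ℝ := fun b σ => ∑ t ∈ J b, ∑ t' ∈ J b,
    green (n ^ 2) (walkInc σ i (a + b * l) t' - walkInc σ i (a + b * l) t)
  have he0 : ∀ b σ, 0 ≤ e b σ := fun b σ => Finset.sum_nonneg fun _ _ =>
    Finset.sum_nonneg fun _ _ => green_nonneg _ _
  set B := C * l * (l : ℝ) ^ (1 / 4 : ℝ) * √n with hB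
  have hBpos : 0 < B := by positivity
  let good : ℕ → (I → Dir d) → Prop := fun b σ => e b σ ≤ 2 * B
  have hdep_e : ∀ b, DepOn (e b) (slots i (a + b * l) (a + b * l + l)) := by
    intro b
    refine DepOn.sum fun t ht => DepOn.sum fun t' ht' => ?_
    rw [Finset.mem_Ico] at ht ht'
    exact ((depOn_walkInc i (a + b * l) t').mono (slots_mono i le_rfl ht'.2.le)).comp₂
      ((depOn_walkInc i (a + b * l) t).mono (slots_mono i le_rfl ht.2.le))
        fun y z => green (n ^ 2) (y - z)
  have hgood : ∀ b ∈ Finset.range Q, 1 / 2 ≤ mean fun σ => ind (good b σ) := by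
    intro b hb
    rw [Finset.mem_range] at hb
    have h1 : mean (e b) ≤ B := by
      simp only [e, lin_sum]
      exact hen n hn I i (a + b * l) l fun m h1 h2 => hI m (by have := hJQ b hb; omega)
    have h2 := markov (he0 b) (t := 2 * B) (by positivity)
    have h3 : mean (e b) / (2 * B) ≤ 1 / 2 := by
      rw [div_le_iff₀ (by positivity)]; linarith
    have h4 : ∀ σ, ind (good b σ) = 1 - ind (2 * B < e b σ) := by
      intro σ; rw [← ind_not]; exact ind_congr not_lt.symm
    simp only [h4]
    rw [lin_sub, mean_const]
    linarith
  -- `D1`: the walk moves too far; `D2`: each of the `Q` independent pieces has more than twice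
  -- the expected energy
  let D1 : (I → Dir d) → Prop := fun σ => ∃ t ∈ Finset.Icc a (a + Q * l),
    ∃ k ∈ (Finset.univ : Finset (Fin d)), (n : ℝ) < |((walkInc σ i a t k : ℤ) : ℝ)|
  let D2 : (I → Dir d) → Prop := fun σ => ∀ b ∈ Finset.range Q, ¬good b σ
  refine ⟨fun σ => D1 σ ∨ D2 σ, ?_, ?_, ?_⟩
  · have h1 : DepOn D1 (slots i a (a + Q * l)) := by
      intro σ τ h
      have h2 : ∀ t ∈ Finset.Icc a (a + Q * l), walkInc σ i a t = walkInc τ i a t := by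
        intro t ht
        rw [Finset.mem_Icc] at ht
        exact depOn_walkInc i a t σ τ fun p hp => h p (slots_mono i le_rfl ht.2 hp)
      apply propext
      constructor
      · rintro ⟨t, ht, k, hk, hlt⟩; exact ⟨t, ht, k, hk, by rw [← h2 t ht]; exact hlt⟩
      · rintro ⟨t, ht, k, hk, hlt⟩; exact ⟨t, ht, k, hk, by rw [h2 t ht]; exact hlt⟩
    have h2 : DepOn D2 (slots i a (a + Q * l)) := by
      intro σ τ h
      refine forall_congr fun b => forall_congr fun hb => ?_
      rw [Finset.mem_range] at hb
      have : e b σ = e b τ := hdep_e b σ τ fun p hp => h p (slots_mono i (by omega) (hJQ b hb) hp)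
      simp only [good, this]
    exact h1.comp₂ h2 Or
  · refine (mean_mono fun σ => ind_or_le _ _).trans ?_
    rw [lin_add]
    refine add_le_add ?_ ?_
    · refine (mean_mono fun σ => ind_exists_le _ _).trans ?_
      rw [lin_sum]
      calc _ ≤ ∑ _t ∈ Finset.Icc a (a + Q * l), 2 * d * Real.exp (-((n : ℝ) ^ 2 / (2 * L))) := by
            refine Finset.sum_le_sum fun t ht => ?_
            rw [Finset.mem_Icc] at ht
            refine mean_walkInc_large_le i ht.1 (fun m _ h2 => hI m (by omega)) (by positivity) hL ?_
            refine le_trans ?_ hQL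
            exact_mod_cast (by omega)
        _ = ((Q * l + 1 : ℕ) : ℝ) * (2 * d * Real.exp (-((n : ℝ) ^ 2 / (2 * L)))) := by
            rw [Finset.sum_const, Nat.card_Icc, nsmul_eq_mul]
            congr 2; omega
        _ ≤ (L + 1) * (2 * d * Real.exp (-((n : ℝ) ^ 2 / (2 * L)))) := by
            gcongr; push_cast at hQL ⊢; linarith
        _ = _ := by ring
    · have := mean_forall_not_le (Finset.range Q) good
        (fun b => slots i (a + b * l) (a + b * l + l)) (fun b _ => (hdep_e b).comp (· ≤ 2 * B))
        (by
          intro b _ b' _ hne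
          rw [Set.disjoint_left]
          rintro p ⟨_, h1, h2⟩ ⟨_, h3, h4⟩
          rcases Nat.lt_or_gt_of_ne hne with h | h
          · have : (b + 1) * l ≤ b' * l := Nat.mul_le_mul_right _ h
            have e := Nat.succ_mul b l
            simp only [Nat.succ_eq_add_one] at e
            omega
          · have : (b' + 1) * l ≤ b * l := Nat.mul_le_mul_right _ h
            have e := Nat.succ_mul b' l
            simp only [Nat.succ_eq_add_one] at e
            omega) hgood
      rwa [Finset.card_range] at this
  · intro σ hσ
    rw [not_or] at hσ
    obtain ⟨h1, h2⟩ := hσ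
    refine ⟨fun t ht1 ht2 k => ?_, ?_⟩
    · by_contra h
      exact h1 ⟨t, Finset.mem_Icc.2 ⟨ht1, ht2⟩, k, Finset.mem_univ k, not_le.1 h⟩
    · simp only [D2] at h2
      push Not at h2
      obtain ⟨b, hb, hgb⟩ := h2
      rw [Finset.mem_range] at hb
      refine ⟨{i} ×ˢ J b, ?_, ?_, ?_⟩
      · exact (Finset.singleton_nonempty i).product (Finset.nonempty_Ico.2 (by omega))
      · intro p hp
        rw [Finset.mem_product, Finset.mem_singleton, Finset.mem_Ico] at hp
        exact ⟨hp.1, by omega, by have := hJQ b hb; omega⟩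
      · have h3 : energy (n ^ 2) ({i} ×ˢ J b) (fun p => walkPos x σ p.1 p.2) = e b σ := by
          unfold energy
          simp only [Finset.sum_product, Finset.sum_singleton]
          refine Finset.sum_congr rfl fun t ht => Finset.sum_congr rfl fun t' ht' => ?_
          rw [Finset.mem_Ico] at ht ht'
          rw [walkPos_add x σ i ht.1, walkPos_add x σ i ht'.1, add_sub_add_left_eq_sub]
        rw [h3]
        have h4 : (({i} ×ˢ J b).card : ℝ) = l := by
          rw [Finset.card_product, Finset.card_singleton, Nat.card_Ico]
          simp
        rw [h4]
        calc _ ≤ (l : ℝ) ^ (3 / 4 : ℝ) / (2 * C * √n) * (2 * B) := by gcongr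
          _ = (l : ℝ) * ((l : ℝ) ^ (3 / 4 : ℝ) * (l : ℝ) ^ (1 / 4 : ℝ)) := by
              rw [hB]; field_simp
          _ = (l : ℝ) ^ 2 := by
              rw [← Real.rpow_add (by linarith)]; norm_num; ring

/-- The walk is in a translate of `B(n)` at time `t` with probability at most the volume times the
maximum of the heat kernel. -/
theorem mean_walkPos_mem_le [NeZero d] {I : Finset (ℕ × ℕ)} {B : ℕ → ℝ}
    (hB : ∀ u, ∀ z : Lattice d, heatKernel u z ≤ B u) (x : ℕ → Lattice d) (i t : ℕ)
    (hI : ∀ m < t, (i, m) ∈ I) (z : Lattice d) (n : ℕ) :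
    mean (fun σ : I → Dir d => ind (walkPos x σ i t + z ∈ boxFinset d n)) ≤
      (2 * n + 1) ^ d * B t := by
  have h := mean_walkInc' (I := I) i (Nat.zero_le t) (fun m _ hm => hI m hm)
    fun v => ind (x i + z + v ∈ boxFinset d n)
  rw [Nat.sub_zero, stepMean_add_mem] at h
  have e : ∀ σ : I → Dir d, walkPos x σ i t + z = x i + z + walkInc σ i 0 t := by
    intro σ; unfold walkPos; abel
  simp only [e, h]
  calc _ ≤ ∑ _b ∈ boxFinset d n, B t := Finset.sum_le_sum fun b _ => hB _ _
    _ = _ := by rw [Finset.sum_const, card_boxFinset, nsmul_eq_mul]; push_cast; rfl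

/-- It is unlikely that walk `i` is in `B(n)` at a given time `t` between `a` and `a + Q l`, and
that none of the walks `j ∈ V`, which start in `B(n)`, meets the path of `i` between these times.
The factor `decay a ^ 2` accounts for the event that `i` is in `B(n)`. -/
theorem exists_meet (hd : 3 ≤ d) :
    ∃ C : ℝ, 0 < C ∧ ∃ c : ℝ, 0 < c ∧ ∃ n₀ : ℕ, ∀ n ≥ n₀, ∀ (I : Finset (ℕ × ℕ)) (i : ℕ)
      (V : Finset ℕ) (a t l Q : ℕ) (x : ℕ → Lattice d) (L κ : ℝ),
      1 ≤ l → 0 < L → (∀ m < a + Q * l, (i, m) ∈ I) → (∀ j ∈ V, ∀ m < n ^ 2, (j, m) ∈ I) →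
      i ∉ V → (∀ j ∈ V, x j ∈ boxFinset d n) → a ≤ t → t ≤ a + Q * l →
      ((Q * l : ℕ) : ℝ) ≤ L → κ ≤ (l : ℝ) ^ (3 / 4 : ℝ) / (C * √n) →
      mean (fun σ : I → Dir d => ind (walkPos x σ i t ∈ boxFinset d n ∧ ∀ j ∈ V,
        ¬∃ u u', a ≤ u ∧ u ≤ a + Q * l ∧ u' ≤ n ^ 2 ∧ walkPos x σ i u = walkPos x σ j u')) ≤
      (2 * n + 1) ^ d * (C * decay a ^ 2) *
        (2 * d * (L + 1) * Real.exp (-((n : ℝ) ^ 2 / (2 * L))) + Real.exp (-(1 / 2 * Q)) +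
          Real.exp (-(c * κ * (n : ℝ) ^ 2 / (n : ℝ) ^ d * V.card))) := by
  have : NeZero d := ⟨by omega⟩
  obtain ⟨C₁, hC₁, hseed⟩ := exists_seed hd
  obtain ⟨C₂, hC₂, hup⟩ := exists_heatKernel_le_decay hd
  obtain ⟨c, hc, n₁, hhit⟩ := exists_hits_ge hd (R₀ := 4) (by norm_num)
  refine ⟨max C₁ C₂, by positivity, c, hc, n₁ + 1, ?_⟩
  intro n hn I i V a t l Q x L κ hl hL hIi hIV hiV hx hat htQ hQL hκ
  have hn1 : 1 ≤ n := by omega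
  have hn' : (1 : ℝ) ≤ n := by exact_mod_cast hn1
  have hsqrt : 0 < √(n : ℝ) := Real.sqrt_pos.2 (by linarith)
  obtain ⟨D, hDdep, hDle, hD⟩ := hseed n hn1 I i a l Q x L hl hL hIi hQL
  have hκ' : κ ≤ (l : ℝ) ^ (3 / 4 : ℝ) / (C₁ * √n) := hκ.trans (by
    gcongr; exact le_max_left _ _)
  have hup' : ∀ u, ∀ z : Lattice d, heatKernel u z ≤ max C₁ C₂ * decay u ^ 2 := fun u z =>
    (hup u z).trans (by gcongr; exact le_max_right _ _)
  set C := max C₁ C₂ with hC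
  -- `q` bounds the probability that the walk is in the box, for any displacement after the time
  -- `a`. The event `D` depends on the steps after the time `a` only, so its probability is
  -- multiplied with `q`.
  set q := (2 * (n : ℝ) + 1) ^ d * (C * decay a ^ 2) with hq
  let 𝓛 : Set (ℕ × ℕ) := {p | p.1 = i ∧ a ≤ p.2 ∧ p.2 ≤ a + Q * l}
  let S := slots i 0 (a + Q * l)
  let Φ : (ℕ × ℕ → Lattice d) → (I → Dir d) → Prop := fun pt τ =>
    (∃ s : Finset (ℕ × ℕ), (∀ p ∈ s, p ∈ 𝓛) ∧ Spread n κ s pt) ∧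
      ∀ s : Finset (ℕ × ℕ), (∀ p ∈ s, p ∈ 𝓛) → Spread n κ s pt →
        ∀ j ∈ V, ¬Hits n (4 + 2 * d) s pt (x j) j 0 τ
  have hevent : ∀ σ : I → Dir d, ind (walkPos x σ i t ∈ boxFinset d n ∧ ∀ j ∈ V,
        ¬∃ u u', a ≤ u ∧ u ≤ a + Q * l ∧ u' ≤ n ^ 2 ∧ walkPos x σ i u = walkPos x σ j u') ≤
      ind (walkPos x σ i t ∈ boxFinset d n) * ind (D σ) +
      ind (walkPos x σ i t ∈ boxFinset d n) * ind (Φ (restr 𝓛 x σ) σ) := by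
    intro σ
    rw [← ind_and, ← ind_and]
    refine le_trans (ind_mono ?_) (ind_or_le _ _)
    rintro ⟨hB, hV⟩
    by_cases hDσ : D σ
    · exact Or.inl ⟨hB, hDσ⟩
    refine Or.inr ⟨hB, ?_, ?_⟩
    · obtain ⟨hnear, s, hs, hs𝓛, hen⟩ := hD σ hDσ
      refine ⟨s, hs𝓛, Spread.congr (a := fun p => walkPos x σ p.1 p.2)
        (fun p hp => (restr_of_mem x σ (hs𝓛 p hp)).symm) ⟨hs, fun p hp k => ?_, ?_⟩⟩
      · obtain ⟨h1, h2, h3⟩ := hs𝓛 p hp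
        have e1 := walkPos_add x σ i hat
        have e2 := walkPos_add x σ i h2
        have b1 := abs_le.1 (abs_le_of_mem_boxFinset hB k)
        have b2 := abs_le.1 (hnear t hat htQ k)
        have b3 := abs_le.1 (hnear p.2 h2 h3 k)
        rw [e1] at b1
        beta_reduce
        rw [h1, e2]
        simp only [Pi.add_apply] at b1 ⊢
        push_cast at b1 ⊢
        rw [abs_le]; constructor <;> linarith
      · refine le_trans ?_ hen
        have := energy_nonneg (n ^ 2) s (fun p => walkPos x σ p.1 p.2)
        gcongr
    · rintro s hs𝓛 _ j hj ⟨⟨u, hu, p, hp, e⟩, _⟩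
      refine hV j hj ⟨p.2, u, (hs𝓛 p hp).2.1, (hs𝓛 p hp).2.2, (Finset.mem_Icc.1 hu).2, ?_⟩
      rw [restr_of_mem x σ (hs𝓛 p hp), Nat.zero_add] at e
      rw [← (hs𝓛 p hp).1, ← e]; rfl
  have hBdep : DepOn (fun σ : I → Dir d => ind (walkPos x σ i t ∈ boxFinset d n)) S :=
    ((depOn_walkPos x i t).mono (slots_mono i le_rfl htQ)).comp fun z => ind (z ∈ boxFinset d n)
  have hq0 : 0 ≤ q := by positivity
  have hfirst : mean (fun σ : I → Dir d => ind (walkPos x σ i t ∈ boxFinset d n) * ind (D σ)) ≤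
      mean (fun σ => ind (D σ)) * q := by
    have e : ∀ σ : I → Dir d, ind (walkPos x σ i t ∈ boxFinset d n) * ind (D σ) =
        ind (D σ) * ind (walkPos x σ i a + walkInc σ i a t ∈ boxFinset d n) := by
      intro σ; rw [← walkPos_add x σ i hat, mul_comm]
    simp only [e]
    have hsub : slots i a (a + Q * l) ⊆ (slots i 0 a)ᶜ := slots_subset_compl_of_le i i le_rfl
    refine mean_decouple_le (slots i 0 a)ᶜ (F := fun τ σ => ind (D τ) *
      ind (walkPos x σ i a + walkInc τ i a t ∈ boxFinset d n)) ?_ ?_ ?_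
    · intro σ
      exact (hDdep.mono hsub).comp₂
        ((depOn_walkInc i a t).mono ((slots_mono i le_rfl htQ).trans hsub))
        fun p z => ind p * ind (walkPos x σ i a + z ∈ boxFinset d n)
    · intro τ
      rw [compl_compl]
      exact (depOn_walkPos x i a).comp fun z => ind (D τ) * ind (z + walkInc τ i a t ∈ boxFinset d n)
    · intro τ
      simp only [lin_mul]
      exact mul_le_mul_of_nonneg_left (mean_walkPos_mem_le hup' x i a
        (fun m hm => hIi m (by omega)) _ n) (ind_nonneg _)
  set ρ := Real.exp (-(c * κ * (n : ℝ) ^ 2 / (n : ℝ) ^ d * V.card)) with hρ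
  have hhits : ∀ pt : ℕ × ℕ → Lattice d, mean (fun τ : I → Dir d => ind (Φ pt τ)) ≤ ρ := by
    intro pt
    by_cases h : ∃ s : Finset (ℕ × ℕ), (∀ p ∈ s, p ∈ 𝓛) ∧ Spread n κ s pt
    · obtain ⟨s, hs𝓛, hs⟩ := h
      refine (mean_mono fun τ => ind_mono fun hΦ => hΦ.2 s hs𝓛 hs).trans ?_
      refine mean_forall_not_le V _ (fun j => slots j 0 (0 + n ^ 2))
        (fun j _ => depOn_hits n _ s pt (x j) j 0) ?_ ?_
      · intro j _ k _ hne
        rw [Set.disjoint_left]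
        rintro p ⟨rfl, _⟩ ⟨h2, _⟩
        exact hne h2
      · intro j hj
        refine hhit n (by omega) I j 0 (fun m _ hm => hIV j hj m (by omega)) (x j) (ℕ × ℕ) s pt hs.1
          (fun p hp k => ?_) κ hs.2.2
        have b1 := abs_le.1 (abs_le_of_mem_boxFinset (hx j hj) k)
        have b2 := abs_le.1 (hs.2.1 p hp k)
        push_cast
        rw [abs_le]; constructor <;> linarith
    · calc _ ≤ mean (fun _ : I → Dir d => (0 : ℝ)) :=
            mean_mono fun τ => (ind_false fun hΦ : Φ pt τ => h hΦ.1).le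
        _ ≤ ρ := by rw [mean_const]; positivity
  have hsecond : mean (fun σ : I → Dir d => ind (walkPos x σ i t ∈ boxFinset d n) *
      ind (Φ (restr 𝓛 x σ) σ)) ≤ q * ρ := by
    refine (mean_decouple_le S (F := fun σ τ => ind (walkPos x σ i t ∈ boxFinset d n) *
      ind (Φ (restr 𝓛 x σ) τ)) (f := fun σ => ind (walkPos x σ i t ∈ boxFinset d n))
      (c := ρ) ?_ ?_ ?_).trans ?_
    · intro τ
      refine hBdep.comp₂ (depOn_restr (𝓛 := 𝓛) x ?_) fun y pt => y * ind (Φ pt τ)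
      rintro p ⟨h1, _, h3⟩
      rw [h1]; exact slots_mono i le_rfl h3
    · intro σ τ τ' h
      have hh : ∀ j ∈ V, ∀ s, Hits n (4 + 2 * d) s (restr 𝓛 x σ) (x j) j 0 τ =
          Hits n (4 + 2 * d) s (restr 𝓛 x σ) (x j) j 0 τ' := by
        intro j hj s
        refine depOn_hits n _ s _ (x j) j 0 τ τ' fun p hp => h p ?_
        exact slots_subset_compl_of_ne (by rintro rfl; exact hiV hj) _ _ _ _ hp
      have : Φ (restr 𝓛 x σ) τ = Φ (restr 𝓛 x σ) τ' := by
        refine congrArg (And _) (forall_congr fun s => forall_congr fun _ => forall_congr fun _ =>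
          forall_congr fun j => forall_congr fun hj => ?_)
        rw [hh j hj s]
      simp only [this]
    · intro σ
      simp only [lin_mul]
      exact mul_le_mul_of_nonneg_left (hhits _) (ind_nonneg _)
    · gcongr
      have h1 := mean_walkPos_mem_le hup' x i t (fun m hm => hIi m (by omega)) 0 n
      simp only [add_zero] at h1
      refine h1.trans ?_
      rw [hq]
      have := decay_anti hat
      have := (decay_pos t).le
      gcongr
  refine (mean_mono hevent).trans ?_
  rw [lin_add]
  calc _ ≤ mean (fun σ => ind (D σ)) * q + q * ρ := add_le_add hfirst hsecond
    _ ≤ (2 * d * (L + 1) * Real.exp (-((n : ℝ) ^ 2 / (2 * L))) + Real.exp (-(1 / 2 * Q))) * q +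
        q * ρ := by gcongr
    _ = _ := by ring

/-! ### Chains of walks -/

/-- The trajectories `w` and `w'` of the field `pt` meet within time `2U`. -/
def Linked (U : ℕ) (pt : ℕ × ℕ → Lattice d) (w w' : ℕ) : Prop :=
  ∃ t t', t ≤ 2 * U ∧ t' ≤ 2 * U ∧ pt (w, t) = pt (w', t')

/-- A chain of `k` links from `i` to `w` inside the set `A` of walks. -/
def Chain (U : ℕ) (pt : ℕ × ℕ → Lattice d) (A : Finset ℕ) (i k w : ℕ) : Prop :=
  ∃ f : ℕ → ℕ, f 0 = i ∧ f k = w ∧ (∀ t ≤ k, f t ∈ A) ∧ ∀ t < k, Linked U pt (f (t + 1)) (f t)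

theorem Chain.congr {U : ℕ} {a b : ℕ × ℕ → Lattice d} {A : Finset ℕ} {i k w : ℕ}
    (h : ∀ v ∈ A, ∀ t ≤ 2 * U, a (v, t) = b (v, t)) (hc : Chain U a A i k w) :
    Chain U b A i k w := by
  obtain ⟨f, h0, hk, hA, hl⟩ := hc
  refine ⟨f, h0, hk, hA, fun t ht => ?_⟩
  obtain ⟨s, s', hs, hs', e⟩ := hl t ht
  exact ⟨s, s', hs, hs', by rw [← h _ (hA _ ht) s hs, ← h _ (hA _ ht.le) s' hs']; exact e⟩

theorem Chain.succ {U : ℕ} {pt : ℕ × ℕ → Lattice d} {A A' : Finset ℕ} {i k w w' : ℕ}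
    (hc : Chain U pt A i k w) (hA : A ⊆ A') (hw' : w' ∈ A') (hl : Linked U pt w' w) :
    Chain U pt A' i (k + 1) w' := by
  obtain ⟨f, h0, hk, hfA, hf⟩ := hc
  refine ⟨fun t => if t ≤ k then f t else w', by simp [h0], by simp, fun t _ => ?_, fun t ht => ?_⟩
  · beta_reduce
    split_ifs with h
    · exact hA (hfA t h)
    · exact hw'
  · have htk : t ≤ k := by omega
    simp only [htk, if_true]
    split_ifs with h
    · exact hf t h
    · have : t = k := by omega
      rw [this, hk]; exact hl

/-- `s` is a set of labels (walk, time) of walks that are connected with walk `i` by chains of `k`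
links in `A`, and the corresponding points have capacity at least `κ`. -/
def Reaches (n : ℕ) (κ : ℝ) (pt : ℕ × ℕ → Lattice d) (A : Finset ℕ) (i k : ℕ)
    (s : Finset (ℕ × ℕ)) : Prop :=
  (∀ p ∈ s, p.1 ∈ A ∧ p.2 ≤ 2 * n ^ 2 ∧ Chain (n ^ 2) pt A i k p.1) ∧ Spread n κ s pt

theorem Reaches.congr {n : ℕ} {κ : ℝ} {a b : ℕ × ℕ → Lattice d} {A : Finset ℕ} {i k : ℕ}
    {s : Finset (ℕ × ℕ)} (h : ∀ v ∈ A, ∀ t ≤ 2 * n ^ 2, a (v, t) = b (v, t))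
    (hs : Reaches n κ a A i k s) : Reaches n κ b A i k s :=
  ⟨fun p hp => ⟨(hs.1 p hp).1, (hs.1 p hp).2.1, (hs.1 p hp).2.2.congr h⟩,
    hs.2.congr fun p hp => h p.1 (hs.1 p hp).1 p.2 (hs.1 p hp).2.1⟩

/-- The trajectories of the walks as a field indexed by labels (walk, time). -/
def field {I : Finset (ℕ × ℕ)} (x : ℕ → Lattice d) (σ : I → Dir d) (p : ℕ × ℕ) : Lattice d :=
  walkPos x σ p.1 p.2

/-- A walk that starts in `B(n)` and hits is still within distance of order `n` at time `n ^ 2`. -/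
theorem hits_near {I : Finset (ℕ × ℕ)} {n : ℕ} {R : ℝ} {s : Finset (ℕ × ℕ)}
    {pt : ℕ × ℕ → Lattice d} {x : ℕ → Lattice d} {w : ℕ} {σ : I → Dir d}
    (hx : x w ∈ boxFinset d n) (h : Hits n R s pt (x w) w 0 σ) (k : Fin d) :
    |((walkPos x σ w (n ^ 2) k : ℤ) : ℝ)| ≤ (R + 1) * n := by
  have h1 := h.2 k
  rw [Nat.zero_add] at h1
  have b1 := abs_le.1 h1
  have b2 := abs_le.1 (abs_le_of_mem_boxFinset hx k)
  simp only [walkPos, Pi.add_apply]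
  push_cast
  rw [abs_le]; constructor <;> linarith

theorem hits_linked {I : Finset (ℕ × ℕ)} {n : ℕ} {R : ℝ} {s : Finset (ℕ × ℕ)}
    {pt : ℕ × ℕ → Lattice d} {x : ℕ → Lattice d} {w a : ℕ} {σ : I → Dir d} (ha : a ≤ n ^ 2)
    (hs : ∀ p ∈ s, p.2 ≤ 2 * n ^ 2 ∧ pt p = field x σ p)
    (h : Hits n R s pt (walkPos x σ w a) w a σ) :
    ∃ p ∈ s, Linked (n ^ 2) (field x σ) w p.1 := by
  obtain ⟨⟨u, hu, p, hp, e⟩, -⟩ := h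
  rw [Finset.mem_Icc] at hu
  refine ⟨p, hp, a + u, p.2, by omega, (hs p hp).1, ?_⟩
  rw [(hs p hp).2, ← walkPos_add x σ w (by omega)] at e
  exact e

/-- One generation: walks connected with `i` by `k` links of capacity `κ` are hit by fresh walks,
whose paths then have capacity `κ'`. There are `Q` independent groups of `m` fresh walks, and each
of them works with a probability bounded from below. -/
theorem exists_reaches_succ (hd : 3 ≤ d) :
    ∃ c : ℝ, 0 < c ∧ ∃ n₀ : ℕ, ∀ n ≥ n₀, ∀ (I : Finset (ℕ × ℕ)) (x : ℕ → Lattice d)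
      (A A' : Finset ℕ) (i k Q m : ℕ) (G : ℕ → Finset ℕ) (κ κ' : ℝ),
      (∀ r < Q, ∀ w ∈ G r, ∀ u < 2 * n ^ 2, (w, u) ∈ I) → (∀ r < Q, ∀ w ∈ G r, w ∉ A) →
      (∀ r < Q, ∀ r' < Q, r ≠ r' → Disjoint (G r) (G r')) → (∀ r < Q, m ≤ (G r).card) →
      (∀ r < Q, ∀ w ∈ G r, x w ∈ boxFinset d n) → A ⊆ A' → (∀ r < Q, G r ⊆ A') →
      0 ≤ κ → 0 ≤ κ' → 1 ≤ m * (c * κ * (n : ℝ) ^ 2 / (n : ℝ) ^ d) →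
      κ' ≤ c * n * (m * (c * κ * (n : ℝ) ^ 2 / (n : ℝ) ^ d)) →
      κ' ≤ c * ((n : ℝ) ^ d / (n : ℝ) ^ 2) →
      mean (fun σ : I → Dir d => ind ((∃ s, Reaches n κ (field x σ) A i k s) ∧
        ¬∃ s, Reaches n κ' (field x σ) A' i (k + 1) s)) ≤ Real.exp (-(c * Q)) := by
  have : NeZero d := ⟨by omega⟩
  obtain ⟨c₁, hc₁, n₁, hhit⟩ := exists_hits_ge hd (R₀ := 4) (by norm_num)
  obtain ⟨c₂, hc₂, n₂, hgen⟩ := exists_generation hd (R := 4 + 2 * d + 1) (by positivity)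
  refine ⟨min c₁ c₂, lt_min hc₁ hc₂, n₁ + n₂ + 1, ?_⟩
  set c := min c₁ c₂ with hc
  have hcc₁ : c ≤ c₁ := min_le_left _ _
  have hcc₂ : c ≤ c₂ := min_le_right _ _
  have hc0 : 0 < c := lt_min hc₁ hc₂
  intro n hn I x A A' i k Q m G κ κ' hI hGA hdis hcard hx hAA' hGA' hκ hκ' hone hκ1 hκ2
  have hn1 : 1 ≤ n := by omega
  have hn' : (1 : ℝ) ≤ n := by exact_mod_cast hn1
  set p := c * κ * (n : ℝ) ^ 2 / (n : ℝ) ^ d with hp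
  have hp0 : 0 ≤ p := by positivity
  let 𝓛 : Set (ℕ × ℕ) := {p | p.1 ∈ A ∧ p.2 ≤ 2 * n ^ 2}
  let S : Set (ℕ × ℕ) := {p | p.1 ∈ A}
  let Group : (ℕ × ℕ → Lattice d) → Finset (ℕ × ℕ) → ℕ → (I → Dir d) → Prop := fun pt s r τ =>
    ∃ s' : Finset (ℕ × ℕ), s'.Nonempty ∧
      (∀ q ∈ s', q.1 ∈ G r ∧ Hits n (4 + 2 * d) s pt (x q.1) q.1 0 τ ∧ q.2 ≤ 2 * n ^ 2 ∧
        walkPos x τ q.1 q.2 ∈ boxFinset d n) ∧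
      κ' * energy (n ^ 2) s' (fun q => walkPos x τ q.1 q.2) ≤ (s'.card : ℝ) ^ 2
  let Φ : (ℕ × ℕ → Lattice d) → (I → Dir d) → Prop := fun pt τ =>
    (∃ s, Reaches n κ pt A i k s) ∧
      ∀ s, Reaches n κ pt A i k s → ∀ r ∈ Finset.range Q, ¬Group pt s r τ
  have hrestr : ∀ (σ : I → Dir d), ∀ v ∈ A, ∀ t ≤ 2 * n ^ 2, field x σ (v, t) = restr 𝓛 x σ (v, t) :=
    fun σ v hv t ht => (restr_of_mem (𝓛 := 𝓛) x σ (p := (v, t)) ⟨hv, ht⟩).symm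
  have hevent : ∀ σ : I → Dir d, ((∃ s, Reaches n κ (field x σ) A i k s) ∧
        ¬∃ s, Reaches n κ' (field x σ) A' i (k + 1) s) → Φ (restr 𝓛 x σ) σ := by
    rintro σ ⟨⟨s, hs⟩, hno⟩
    refine ⟨⟨s, hs.congr (hrestr σ)⟩, ?_⟩
    rintro s hs r hr ⟨s', hne, hs', hen⟩
    rw [Finset.mem_range] at hr
    have hs2 := hs.congr (b := field x σ) fun v hv t ht => (hrestr σ v hv t ht).symm
    refine hno ⟨s', fun q hq => ⟨hGA' r hr (hs' q hq).1, (hs' q hq).2.2.1, ?_⟩, hne,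
      fun q hq l => ?_, hen⟩
    · have hl := hits_linked (x := x) (a := 0) (pt := restr 𝓛 x σ) (s := s) (R := 4 + 2 * d)
        (n := n) (σ := σ) (w := q.1) (Nat.zero_le _)
        (fun q hq => ⟨(hs.1 q hq).2.1, (hrestr σ q.1 (hs.1 q hq).1 q.2 (hs.1 q hq).2.1).symm⟩)
        (by have := (hs' q hq).2.1; simpa [walkPos, walkInc] using this)
      obtain ⟨q', hq', hl⟩ := hl
      exact (hs2.1 q' hq').2.2.succ hAA' (hGA' r hr (hs' q hq).1) hl
    · exact (abs_le_of_mem_boxFinset (hs' q hq).2.2.2 l).trans (by linarith)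
  have hGroupDep : ∀ pt s r, DepOn (Group pt s r) {p | p.1 ∈ G r} := by
    have key : ∀ pt s r (σ τ : I → Dir d), (∀ p : I, p.1.1 ∈ G r → σ p = τ p) →
        Group pt s r σ → Group pt s r τ := by
      rintro pt s r σ τ h ⟨s', hne, hs', hen⟩
      have hpos : ∀ q ∈ s', walkPos x σ q.1 q.2 = walkPos x τ q.1 q.2 := fun q hq =>
        depOn_walkPos x q.1 q.2 σ τ fun p hp => h p (by rw [hp.1]; exact (hs' q hq).1)
      refine ⟨s', hne, fun q hq => ⟨(hs' q hq).1, ?_, (hs' q hq).2.2.1, ?_⟩, ?_⟩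
      · have : Hits n (4 + 2 * d) s pt (x q.1) q.1 0 σ = Hits n (4 + 2 * d) s pt (x q.1) q.1 0 τ :=
          depOn_hits n (4 + 2 * d) s pt (x q.1) q.1 0 σ τ fun p hp => h p (by rw [hp.1]; exact (hs' q hq).1)
        rw [← this]; exact (hs' q hq).2.1
      · rw [← hpos q hq]; exact (hs' q hq).2.2.2
      · rw [← energy_congr hpos]; exact hen
    intro pt s r σ τ h
    exact propext ⟨key pt s r σ τ h, key pt s r τ σ fun p hp => (h p hp).symm⟩
  have hmean : ∀ pt : ℕ × ℕ → Lattice d, mean (fun τ : I → Dir d => ind (Φ pt τ)) ≤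
      Real.exp (-(c * Q)) := by
    intro pt
    by_cases h : ∃ s, Reaches n κ pt A i k s
    swap
    · calc _ ≤ mean (fun _ : I → Dir d => (0 : ℝ)) :=
            mean_mono fun τ => (ind_false fun hΦ : Φ pt τ => h hΦ.1).le
        _ ≤ _ := by rw [mean_const]; positivity
    obtain ⟨s, hs⟩ := h
    refine (mean_mono fun τ => ind_mono fun hΦ => hΦ.2 s hs).trans ?_
    have := mean_forall_not_le (Finset.range Q) (Group pt s) (fun r => {p | p.1 ∈ G r})
      (fun r _ => hGroupDep pt s r) (fun r hr r' hr' hne => ?_) (p := c) (fun r hr => ?_)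
    · rwa [Finset.card_range] at this
    · rw [Finset.mem_range] at hr hr'
      rw [Set.disjoint_left]
      exact fun q hq hq' => Finset.disjoint_left.1 (hdis r hr r' hr' hne) hq hq'
    · rw [Finset.mem_range] at hr
      have hsum : m * p ≤ ∑ w ∈ G r, mean (fun σ : I → Dir d =>
          ind (Hits n (4 + 2 * d) s pt (x w) w 0 σ)) := by
        calc m * p ≤ ((G r).card : ℝ) * p := by gcongr; exact_mod_cast hcard r hr
          _ = ∑ _w ∈ G r, p := by simp
          _ ≤ _ := by
            refine Finset.sum_le_sum fun w hw => ?_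
            refine le_trans ?_ (hhit n (by omega) I w 0 (fun u _ hu => hI r hr w hw u (by omega))
              (x w) (ℕ × ℕ) s pt hs.2.1 (fun q hq l => ?_) κ hs.2.2.2)
            · rw [hp]; gcongr
            · have b1 := abs_le.1 (abs_le_of_mem_boxFinset (hx r hr w hw) l)
              have b2 := abs_le.1 (hs.2.2.1 q hq l)
              push_cast
              rw [abs_le]; constructor <;> linarith
      refine hcc₂.trans (hgen n (by omega) I (G r) x
        (fun w τ => Hits n (4 + 2 * d) s pt (x w) w 0 τ) (hI r hr) (fun w _ => ?_)
        (fun w hw σ hσ => hits_near (hx r hr w hw) hσ) (hone.trans hsum) κ' hκ' ?_ ?_)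
      · have := depOn_hits (I := I) n (4 + 2 * d) s pt (x w) w 0
        rwa [Nat.zero_add] at this
      · refine hκ1.trans ?_
        have : 0 ≤ m * p := by positivity
        gcongr
      · exact hκ2.trans (by gcongr)
  have hfin := mean_decouple_le S (F := fun σ τ : I → Dir d => ind (Φ (restr 𝓛 x σ) τ))
    (f := fun _ => 1) (c := Real.exp (-(c * Q))) ?_ ?_ fun σ => by rw [one_mul]; exact hmean _
  · rw [mean_const, one_mul] at hfin
    exact (mean_mono fun σ => ind_mono (hevent σ)).trans hfin
  · intro τ
    refine (depOn_restr (𝓛 := 𝓛) x ?_).comp fun pt => ind (Φ pt τ)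
    rintro q ⟨hq, _⟩ q' ⟨hq', _⟩
    change q'.1 ∈ A
    rw [hq']; exact hq
  · intro σ τ τ' h
    have hh : ∀ s, ∀ r ∈ Finset.range Q,
        Group (restr 𝓛 x σ) s r τ = Group (restr 𝓛 x σ) s r τ' := by
      intro s r hr
      rw [Finset.mem_range] at hr
      exact hGroupDep _ s r τ τ' fun q hq => h q fun hq' => hGA r hr _ hq hq'
    have : Φ (restr 𝓛 x σ) τ = Φ (restr 𝓛 x σ) τ' := by
      refine congrArg (And _) (forall_congr fun s => forall_congr fun _ => forall_congr fun r =>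
        forall_congr fun hr => ?_)
      rw [hh s r hr]
    simp only [this]

/-- The last two links: a fresh walk hits the paths that are connected with `i` and then the path
of `j`. -/
theorem exists_chain_end (hd : 3 ≤ d) :
    ∃ c : ℝ, 0 < c ∧ ∃ n₀ : ℕ, ∀ n ≥ n₀, ∀ (I : Finset (ℕ × ℕ)) (x : ℕ → Lattice d)
      (A A' V : Finset ℕ) (i j k : ℕ) (κ κ₀ : ℝ),
      (∀ w ∈ V, ∀ u < 2 * n ^ 2, (w, u) ∈ I) → (∀ w ∈ V, w ∉ A) → j ∉ V →
      (∀ w ∈ V, x w ∈ boxFinset d n) → A ⊆ A' → V ⊆ A' → j ∈ A' → 0 ≤ κ → 0 ≤ κ₀ →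
      mean (fun σ : I → Dir d => ind ((∃ s, Reaches n κ (field x σ) A i k s) ∧
        (∃ s : Finset (ℕ × ℕ), (∀ p ∈ s, p.1 = j ∧ p.2 ≤ 2 * n ^ 2) ∧ Spread n κ₀ s (field x σ)) ∧
        ¬Chain (n ^ 2) (field x σ) A' i (k + 2) j)) ≤
        Real.exp (-(c * κ * (n : ℝ) ^ 2 / (n : ℝ) ^ d * (c * κ₀ * (n : ℝ) ^ 2 / (n : ℝ) ^ d) *
          V.card)) := by
  have : NeZero d := ⟨by omega⟩
  obtain ⟨c₁, hc₁, n₁, hhit₁⟩ := exists_hits_ge hd (R₀ := 4) (by norm_num)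
  obtain ⟨c₂, hc₂, n₂, hhit₂⟩ := exists_hits_ge hd (R₀ := 8 + 2 * d) (by positivity)
  refine ⟨min c₁ c₂, lt_min hc₁ hc₂, n₁ + n₂ + 1, ?_⟩
  set c := min c₁ c₂ with hc
  have hcc₁ : c ≤ c₁ := min_le_left _ _
  have hcc₂ : c ≤ c₂ := min_le_right _ _
  have hc0 : 0 < c := lt_min hc₁ hc₂
  intro n hn I x A A' V i j k κ κ₀ hI hVA hjV hx hAA' hVA' hjA' hκ hκ₀
  have hn1 : 1 ≤ n := by omega
  have hn' : (1 : ℝ) ≤ n := by exact_mod_cast hn1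
  set p := c * κ * (n : ℝ) ^ 2 / (n : ℝ) ^ d with hp
  set p₀ := c * κ₀ * (n : ℝ) ^ 2 / (n : ℝ) ^ d with hp₀
  have hp₀0 : 0 ≤ p₀ := by positivity
  let 𝓛 : Set (ℕ × ℕ) := {p | (p.1 ∈ A ∨ p.1 = j) ∧ p.2 ≤ 2 * n ^ 2}
  let S : Set (ℕ × ℕ) := {p | p.1 ∈ A ∨ p.1 = j}
  let End : (ℕ × ℕ → Lattice d) → Finset (ℕ × ℕ) → Prop := fun pt s =>
    (∀ p ∈ s, p.1 = j ∧ p.2 ≤ 2 * n ^ 2) ∧ Spread n κ₀ s pt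
  let W : (ℕ × ℕ → Lattice d) → Finset (ℕ × ℕ) → Finset (ℕ × ℕ) → ℕ → (I → Dir d) → Prop :=
    fun pt s s₁ w τ => Hits n (4 + 2 * d) s pt (x w) w 0 τ ∧
      Hits n (8 + 2 * d + 2 * d) s₁ pt (walkPos x τ w (n ^ 2)) w (n ^ 2) τ
  let Φ : (ℕ × ℕ → Lattice d) → (I → Dir d) → Prop := fun pt τ =>
    (∃ s s₁, Reaches n κ pt A i k s ∧ End pt s₁) ∧
      ∀ s s₁, Reaches n κ pt A i k s ∧ End pt s₁ → ∀ w ∈ V, ¬W pt s s₁ w τ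
  have hrestr : ∀ (σ : I → Dir d) (v : ℕ), v ∈ A ∨ v = j → ∀ t ≤ 2 * n ^ 2,
      field x σ (v, t) = restr 𝓛 x σ (v, t) :=
    fun σ v hv t ht => (restr_of_mem (𝓛 := 𝓛) x σ (p := (v, t)) ⟨hv, ht⟩).symm
  have hevent : ∀ σ : I → Dir d, ((∃ s, Reaches n κ (field x σ) A i k s) ∧
        (∃ s : Finset (ℕ × ℕ), (∀ p ∈ s, p.1 = j ∧ p.2 ≤ 2 * n ^ 2) ∧ Spread n κ₀ s (field x σ)) ∧
        ¬Chain (n ^ 2) (field x σ) A' i (k + 2) j) → Φ (restr 𝓛 x σ) σ := by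
    rintro σ ⟨⟨s, hs⟩, ⟨s₁, hs₁, hsp⟩, hno⟩
    refine ⟨⟨s, s₁, hs.congr fun v hv t ht => hrestr σ v (Or.inl hv) t ht, hs₁,
      hsp.congr fun p hp => hrestr σ p.1 (Or.inr (hs₁ p hp).1) p.2 (hs₁ p hp).2⟩, ?_⟩
    rintro s s₁ ⟨hs, hs₁, -⟩ w hw ⟨hW1, hW2⟩
    have hs2 := hs.congr (b := field x σ) fun v hv t ht => (hrestr σ v (Or.inl hv) t ht).symm
    have hl1 := hits_linked (x := x) (a := 0) (pt := restr 𝓛 x σ) (s := s) (R := 4 + 2 * d)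
      (n := n) (σ := σ) (w := w) (Nat.zero_le _)
      (fun q hq => ⟨(hs.1 q hq).2.1,
        (hrestr σ q.1 (Or.inl (hs.1 q hq).1) q.2 (hs.1 q hq).2.1).symm⟩)
      (by simpa [walkPos, walkInc] using hW1)
    have hl2 := hits_linked (x := x) le_rfl
      (fun q hq => ⟨(hs₁ q hq).2, (hrestr σ q.1 (Or.inr (hs₁ q hq).1) q.2 (hs₁ q hq).2).symm⟩) hW2
    obtain ⟨q, hq, hl1⟩ := hl1
    obtain ⟨q', hq', t, t', ht, ht', e⟩ := hl2
    rw [(hs₁ q' hq').1] at e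
    exact hno (((hs2.1 q hq).2.2.succ hAA' (hVA' hw) hl1).succ subset_rfl hjA'
      ⟨t', t, ht', ht, e.symm⟩)
  have hWdep : ∀ pt s s₁ w, DepOn (W pt s s₁ w) (slots w 0 (n ^ 2 + n ^ 2)) := by
    intro pt s s₁ w σ τ h
    have h1 := depOn_hits n (4 + 2 * d) s pt (x w) w 0 σ τ
      fun p hp => h p (slots_mono w le_rfl (by omega) hp)
    have h2 : walkPos x σ w (n ^ 2) = walkPos x τ w (n ^ 2) := depOn_walkPos x w (n ^ 2) σ τ
      fun p hp => h p (slots_mono w le_rfl (by omega) hp)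
    have h3 := depOn_hits n (8 + 2 * d + 2 * d) s₁ pt (walkPos x τ w (n ^ 2)) w (n ^ 2) σ τ
      fun p hp => h p (slots_mono w (by omega) le_rfl hp)
    simp only [W]
    rw [h2]
    exact congrArg₂ And h1 h3
  have hWmean : ∀ pt s s₁, Reaches n κ pt A i k s → End pt s₁ → ∀ w ∈ V,
      p * p₀ ≤ mean fun τ : I → Dir d => ind (W pt s s₁ w τ) := by
    intro pt s s₁ hs hs₁ w hw
    have hxw := hx w hw
    have h1 : p ≤ mean fun τ : I → Dir d => ind (Hits n (4 + 2 * d) s pt (x w) w 0 τ) := by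
      refine le_trans ?_ (hhit₁ n (by omega) I w 0 (fun u _ hu => hI w hw u (by omega))
        (x w) (ℕ × ℕ) s pt hs.2.1 (fun q hq l => ?_) κ hs.2.2.2)
      · rw [hp]; gcongr
      · have b1 := abs_le.1 (abs_le_of_mem_boxFinset hxw l)
        have b2 := abs_le.1 (hs.2.2.1 q hq l)
        push_cast
        rw [abs_le]; constructor <;> linarith
    refine (mul_le_mul_of_nonneg_right h1 hp₀0).trans ?_
    simp only [W, ind_and]
    refine mean_decouple_ge (slots w 0 (n ^ 2)) (F := fun σ τ : I → Dir d =>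
      ind (Hits n (4 + 2 * d) s pt (x w) w 0 σ) *
      ind (Hits n (8 + 2 * d + 2 * d) s₁ pt (walkPos x σ w (n ^ 2)) w (n ^ 2) τ)) ?_ ?_ ?_
    · intro τ
      have := depOn_hits (I := I) n (4 + 2 * d) s pt (x w) w 0
      rw [Nat.zero_add] at this
      exact this.comp₂ (depOn_walkPos x w (n ^ 2)) fun q y =>
        ind q * ind (Hits n (8 + 2 * d + 2 * d) s₁ pt y w (n ^ 2) τ)
    · intro σ
      exact ((depOn_hits (I := I) n (8 + 2 * d + 2 * d) s₁ pt (walkPos x σ w (n ^ 2)) w (n ^ 2)).mono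
        (slots_subset_compl_of_le w w le_rfl)).comp fun q => _ * ind q
    · intro σ
      by_cases hσ : Hits n (4 + 2 * d) s pt (x w) w 0 σ
      · simp only [lin_mul]
        refine mul_le_mul_of_nonneg_left ?_ (ind_nonneg _)
        refine le_trans ?_ (hhit₂ n (by omega) I w (n ^ 2) (fun u _ hu => hI w hw u (by omega))
          (walkPos x σ w (n ^ 2)) (ℕ × ℕ) s₁ pt hs₁.2.1 (fun q hq l => ?_) κ₀ hs₁.2.2.2)
        · rw [hp₀]; gcongr
        · have b1 := abs_le.1 (hits_near hxw hσ l)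
          have b2 := abs_le.1 (hs₁.2.2.1 q hq l)
          push_cast
          rw [abs_le]; constructor <;> nlinarith
      · simp only [ind_false hσ, zero_mul, mean_const, le_refl]
  have hmean : ∀ pt : ℕ × ℕ → Lattice d, mean (fun τ : I → Dir d => ind (Φ pt τ)) ≤
      Real.exp (-(p * p₀ * V.card)) := by
    intro pt
    by_cases h : ∃ s s₁, Reaches n κ pt A i k s ∧ End pt s₁
    swap
    · calc _ ≤ mean (fun _ : I → Dir d => (0 : ℝ)) :=
            mean_mono fun τ => (ind_false fun hΦ : Φ pt τ => h hΦ.1).le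
        _ ≤ _ := by rw [mean_const]; positivity
    obtain ⟨s, s₁, hs⟩ := h
    refine (mean_mono fun τ => ind_mono fun hΦ => hΦ.2 s s₁ hs).trans ?_
    refine mean_forall_not_le V (W pt s s₁) (fun w => slots w 0 (n ^ 2 + n ^ 2))
      (fun w _ => hWdep pt s s₁ w) (fun w _ w' _ hne => ?_) (hWmean pt s s₁ hs.1 hs.2)
    rw [Set.disjoint_left]
    rintro q ⟨rfl, _⟩ ⟨h2, _⟩
    exact hne h2
  have hfin := mean_decouple_le S (F := fun σ τ : I → Dir d => ind (Φ (restr 𝓛 x σ) τ))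
    (f := fun _ => 1) (c := Real.exp (-(p * p₀ * V.card))) ?_ ?_
      fun σ => by rw [one_mul]; exact hmean _
  · rw [mean_const, one_mul] at hfin
    exact (mean_mono fun σ => ind_mono (hevent σ)).trans hfin
  · intro τ
    refine (depOn_restr (𝓛 := 𝓛) x ?_).comp fun pt => ind (Φ pt τ)
    rintro q ⟨hq, _⟩ q' ⟨hq', _⟩
    change q'.1 ∈ A ∨ q'.1 = j
    rw [hq']; exact hq
  · intro σ τ τ' h
    have hh : ∀ s s₁, ∀ w ∈ V, W (restr 𝓛 x σ) s s₁ w τ = W (restr 𝓛 x σ) s s₁ w τ' := by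
      intro s s₁ w hw
      refine hWdep _ s s₁ w τ τ' fun q hq => h q ?_
      rintro (hq' | hq')
      · exact hVA w hw (hq.1 ▸ hq')
      · exact hjV (hq' ▸ hq.1 ▸ hw)
    have : Φ (restr 𝓛 x σ) τ = Φ (restr 𝓛 x σ) τ' := by
      refine congrArg (And _) (forall_congr fun s => forall_congr fun s₁ => forall_congr fun _ =>
        forall_congr fun w => forall_congr fun hw => ?_)
      rw [hh s s₁ w hw]
    simp only [this]

/-! ### Chains of bounded length -/

/-- The walks number `q * (m + 2), …, (q + 1) * (m + 2) - 1` without `i` and `j`. -/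
def block (m i j q : ℕ) : Finset ℕ := (Finset.Ico (q * (m + 2)) ((q + 1) * (m + 2))) \ {i, j}

theorem mem_block {m i j q w : ℕ} : w ∈ block m i j q ↔
    (q * (m + 2) ≤ w ∧ w < (q + 1) * (m + 2)) ∧ w ≠ i ∧ w ≠ j := by
  simp [block]

theorem le_card_block (m i j q : ℕ) : m ≤ (block m i j q).card := by
  have h1 := Finset.le_card_sdiff {i, j} (Finset.Ico (q * (m + 2)) ((q + 1) * (m + 2)))
  have h2 : ({i, j} : Finset ℕ).card ≤ 2 := Finset.card_le_two
  rw [Nat.card_Ico] at h1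
  have h3 : (q + 1) * (m + 2) - q * (m + 2) = m + 2 := by
    rw [add_mul, one_mul, Nat.add_sub_cancel_left]
  unfold block
  omega

theorem disjoint_block {m i j q q' : ℕ} (h : q < q') : Disjoint (block m i j q) (block m i j q') := by
  rw [Finset.disjoint_left]
  intro w hw hw'
  have h1 := (mem_block.1 hw).1.2
  have h2 := (mem_block.1 hw').1.1
  have h3 : (q + 1) * (m + 2) ≤ q' * (m + 2) := Nat.mul_le_mul_right _ h
  omega

/-- Walk `i` and the walks of the first `q` blocks. -/
def blocksBelow (m i j q : ℕ) : Finset ℕ := insert i (Finset.range (q * (m + 2)) \ {i, j})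

theorem mem_blocksBelow {m i j q w : ℕ} : w ∈ blocksBelow m i j q ↔
    w = i ∨ (w < q * (m + 2) ∧ w ≠ i ∧ w ≠ j) := by
  simp [blocksBelow]

theorem blocksBelow_mono {m i j q q' : ℕ} (h : q ≤ q') :
    blocksBelow m i j q ⊆ blocksBelow m i j q' := by
  intro w hw
  rw [mem_blocksBelow] at hw ⊢
  have : q * (m + 2) ≤ q' * (m + 2) := Nat.mul_le_mul_right _ h
  rcases hw with h | h
  · exact Or.inl h
  · exact Or.inr ⟨by omega, h.2⟩

theorem block_subset {m i j q q' : ℕ} (h : q < q') : block m i j q ⊆ blocksBelow m i j q' := by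
  intro w hw
  rw [mem_block] at hw
  rw [mem_blocksBelow]
  have : (q + 1) * (m + 2) ≤ q' * (m + 2) := Nat.mul_le_mul_right _ h
  exact Or.inr ⟨by omega, hw.2⟩

theorem notMem_blocksBelow {m i j q q' w : ℕ} (h : q ≤ q') (hw : w ∈ block m i j q') :
    w ∉ blocksBelow m i j q := by
  rw [mem_block] at hw
  rw [mem_blocksBelow]
  have : q * (m + 2) ≤ q' * (m + 2) := Nat.mul_le_mul_right _ h
  rintro (h | h)
  · exact hw.2.1 h
  · omega

/-- The beginning of the path of one walk has capacity at least `κ`, up to a small probability. -/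
theorem exists_spread_start (hd : 3 ≤ d) :
    ∃ C : ℝ, 0 < C ∧ ∀ n : ℕ, 1 ≤ n → ∀ (I : Finset (ℕ × ℕ)) (i l Q : ℕ) (x : ℕ → Lattice d)
      (L κ : ℝ), 1 ≤ l → 0 < L → (∀ m < Q * l, (i, m) ∈ I) → ((Q * l : ℕ) : ℝ) ≤ L →
      Q * l ≤ 2 * n ^ 2 → x i ∈ boxFinset d n → κ ≤ (l : ℝ) ^ (3 / 4 : ℝ) / (C * √n) →
      mean (fun σ : I → Dir d => ind (¬∃ s : Finset (ℕ × ℕ), (∀ p ∈ s, p.1 = i ∧ p.2 ≤ 2 * n ^ 2) ∧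
        Spread n κ s (field x σ))) ≤
        2 * d * (L + 1) * Real.exp (-((n : ℝ) ^ 2 / (2 * L))) + Real.exp (-(1 / 2 * Q)) := by
  obtain ⟨C, hC, hseed⟩ := exists_seed hd
  refine ⟨C, hC, fun n hn I i l Q x L κ hl hL hI hQ hQn hx hκ => ?_⟩
  obtain ⟨D, -, hD, hgood⟩ := hseed n hn I i 0 l Q x L hl hL (by simpa using hI) hQ
  refine (mean_mono fun σ => ind_mono fun h => ?_).trans hD
  by_contra hDσ
  obtain ⟨hdisp, s, hne, hs, hen⟩ := hgood σ hDσ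
  refine h ⟨s, fun p hp => ⟨(hs p hp).1, by have := hs p hp; omega⟩, hne, fun p hp k => ?_, ?_⟩
  · have b1 := abs_le.1 (hdisp p.2 (Nat.zero_le _) (hs p hp).2.2 k)
    have b2 := abs_le.1 (abs_le_of_mem_boxFinset hx k)
    simp only [field, (hs p hp).1, walkPos, Pi.add_apply]
    push_cast
    have : (0 : ℝ) ≤ n := Nat.cast_nonneg _
    rw [abs_le]; constructor <;> linarith
  · exact (mul_le_mul_of_nonneg_right hκ (energy_nonneg _ _ _)).trans hen

/-- Two walks are connected by a chain of `K + 2` links, up to a small probability: `K` generations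
of growing capacity `κ 0, …, κ K` start at walk `i`, and the last two links lead to walk `j`. -/
theorem exists_chain (hd : 3 ≤ d) :
    ∃ C : ℝ, 0 < C ∧ ∃ c : ℝ, 0 < c ∧ ∃ n₀ : ℕ, ∀ n ≥ n₀, ∀ (I : Finset (ℕ × ℕ)) (x : ℕ → Lattice d)
      (N i j K l Q m : ℕ) (L : ℝ) (κ : ℕ → ℝ),
      i ≠ j → (K * Q + 1) * (m + 2) ≤ N →
      (∀ w, w < N ∨ w = i ∨ w = j → x w ∈ boxFinset d n ∧ ∀ u < 2 * n ^ 2, (w, u) ∈ I) →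
      1 ≤ l → 0 < L → ((Q * l : ℕ) : ℝ) ≤ L → Q * l ≤ 2 * n ^ 2 → (∀ g, 0 ≤ κ g) →
      κ 0 ≤ (l : ℝ) ^ (3 / 4 : ℝ) / (C * √n) →
      (∀ g < K, 1 ≤ m * (c * κ g * (n : ℝ) ^ 2 / (n : ℝ) ^ d)) →
      (∀ g < K, κ (g + 1) ≤ c * n * (m * (c * κ g * (n : ℝ) ^ 2 / (n : ℝ) ^ d))) →
      (∀ g < K, κ (g + 1) ≤ c * ((n : ℝ) ^ d / (n : ℝ) ^ 2)) →
      mean (fun σ : I → Dir d =>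
        ind (¬Chain (n ^ 2) (field x σ) (insert i (insert j (Finset.range N))) i (K + 2) j)) ≤
      2 * (2 * d * (L + 1) * Real.exp (-((n : ℝ) ^ 2 / (2 * L))) + Real.exp (-(1 / 2 * Q))) +
        K * Real.exp (-(c * Q)) +
        Real.exp (-(c * κ K * (n : ℝ) ^ 2 / (n : ℝ) ^ d * (c * κ 0 * (n : ℝ) ^ 2 / (n : ℝ) ^ d) * m)) := by
  have : NeZero d := ⟨by omega⟩
  obtain ⟨C, hC, hstart⟩ := exists_spread_start hd
  obtain ⟨c₁, hc₁, n₁, hsucc⟩ := exists_reaches_succ hd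
  obtain ⟨c₂, hc₂, n₂, hend⟩ := exists_chain_end hd
  refine ⟨C, hC, min c₁ c₂, lt_min hc₁ hc₂, n₁ + n₂ + 1, ?_⟩
  set c := min c₁ c₂ with hc
  have hcc₁ : c ≤ c₁ := min_le_left _ _
  have hcc₂ : c ≤ c₂ := min_le_right _ _
  have hc0 : 0 < c := lt_min hc₁ hc₂
  intro n hn I x N i j K l Q m L κ hij hN hxI hl hL hQL hQn hκ hκ0 hone hκ1 hκ2
  have hn1 : 1 ≤ n := by omega
  set e₁ := 2 * d * (L + 1) * Real.exp (-((n : ℝ) ^ 2 / (2 * L))) + Real.exp (-(1 / 2 * Q)) with he₁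
  have hQK : ∀ g < K, ∀ r < Q, g * Q + r < K * Q := by
    intro g hg r hr
    calc g * Q + r < g * Q + Q := by omega
      _ = (g + 1) * Q := by ring
      _ ≤ K * Q := Nat.mul_le_mul_right _ hg
  have hblockN : ∀ q ≤ K * Q, ∀ w ∈ block m i j q, w < N := by
    intro q hq w hw
    have h1 := (mem_block.1 hw).1.2
    have h2 : (q + 1) * (m + 2) ≤ (K * Q + 1) * (m + 2) := Nat.mul_le_mul_right _ (by omega)
    omega
  let E : ℕ → (I → Dir d) → Prop := fun g σ =>
    ∃ s, Reaches n (κ g) (field x σ) (blocksBelow m i j (g * Q)) i g s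
  let J : (I → Dir d) → Prop := fun σ =>
    ∃ s : Finset (ℕ × ℕ), (∀ p ∈ s, p.1 = j ∧ p.2 ≤ 2 * n ^ 2) ∧ Spread n (κ 0) s (field x σ)
  have hgen : ∀ g ≤ K, mean (fun σ : I → Dir d => ind (¬E g σ)) ≤ e₁ + g * Real.exp (-(c * Q)) := by
    intro g
    induction g with
    | zero =>
      intro _
      have h0 := hstart n hn1 I i l Q x L (κ 0) hl hL
        (fun u hu => (hxI i (Or.inr (Or.inl rfl))).2 u (by omega)) hQL hQn
        (hxI i (Or.inr (Or.inl rfl))).1 hκ0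
      rw [Nat.cast_zero, zero_mul, add_zero]
      refine (mean_mono fun σ => ind_mono fun hno => ?_).trans h0
      rintro ⟨s, hs, hsp⟩
      refine hno ⟨s, fun p hp => ⟨?_, (hs p hp).2, fun _ => i, rfl, (hs p hp).1.symm, ?_, ?_⟩, hsp⟩
      · exact mem_blocksBelow.2 (Or.inl (hs p hp).1)
      · exact fun t _ => mem_blocksBelow.2 (Or.inl rfl)
      · exact fun t ht => absurd ht (Nat.not_lt_zero _)
    | succ g ih =>
      intro hg
      have h1 := ih (by omega)
      have hle : g * Q ≤ (g + 1) * Q := Nat.mul_le_mul_right _ (by omega)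
      have hfac : c * κ g * (n : ℝ) ^ 2 / (n : ℝ) ^ d ≤ c₁ * κ g * (n : ℝ) ^ 2 / (n : ℝ) ^ d := by
        have := hκ g
        gcongr
      have h2 := hsucc n (by omega) I x (blocksBelow m i j (g * Q)) (blocksBelow m i j ((g + 1) * Q))
        i g Q m (fun r => block m i j (g * Q + r)) (κ g) (κ (g + 1))
        (fun r hr w hw => (hxI w (Or.inl (hblockN _ (hQK g hg r hr).le w hw))).2)
        (fun r hr w hw => notMem_blocksBelow (by omega) hw)
        (fun r hr r' hr' hne => by
          rcases Nat.lt_or_ge r r' with h | h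
          · exact disjoint_block (by omega)
          · exact (disjoint_block (by omega)).symm)
        (fun r hr => le_card_block _ _ _ _)
        (fun r hr w hw => (hxI w (Or.inl (hblockN _ (hQK g hg r hr).le w hw))).1)
        (blocksBelow_mono hle) (fun r hr => block_subset (by rw [add_mul, one_mul]; omega))
        (hκ g) (hκ (g + 1))
        ((hone g hg).trans (by gcongr))
        ((hκ1 g hg).trans (by have := hκ g; gcongr))
        ((hκ2 g hg).trans (by gcongr))
      calc mean (fun σ : I → Dir d => ind (¬E (g + 1) σ))
          ≤ mean (fun σ : I → Dir d => ind (¬E g σ) + ind (E g σ ∧ ¬E (g + 1) σ)) := by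
            refine mean_mono fun σ => (ind_mono fun hno => ?_).trans (ind_or_le _ _)
            by_cases hE : E g σ
            · exact Or.inr ⟨hE, hno⟩
            · exact Or.inl hE
        _ = mean (fun σ : I → Dir d => ind (¬E g σ)) +
            mean (fun σ : I → Dir d => ind (E g σ ∧ ¬E (g + 1) σ)) := lin_add _ _ _
        _ ≤ (e₁ + g * Real.exp (-(c * Q))) + Real.exp (-(c * Q)) := by
            refine add_le_add h1 (h2.trans ?_)
            rw [Real.exp_le_exp]
            have : c * Q ≤ c₁ * Q := by gcongr
            linarith
        _ = _ := by push_cast; ring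
  have hj := hstart n hn1 I j l Q x L (κ 0) hl hL
    (fun u hu => (hxI j (Or.inr (Or.inr rfl))).2 u (by omega)) hQL hQn
    (hxI j (Or.inr (Or.inr rfl))).1 hκ0
  have hlast := hend n (by omega) I x (blocksBelow m i j (K * Q))
    (insert i (insert j (Finset.range N))) (block m i j (K * Q)) i j K (κ K) (κ 0)
    (fun w hw => (hxI w (Or.inl (hblockN _ le_rfl w hw))).2)
    (fun w hw => notMem_blocksBelow le_rfl hw) (fun hjb => (mem_block.1 hjb).2.2 rfl)
    (fun w hw => (hxI w (Or.inl (hblockN _ le_rfl w hw))).1)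
    (fun w hw => by
      rw [mem_blocksBelow] at hw
      have : K * Q * (m + 2) ≤ (K * Q + 1) * (m + 2) := Nat.mul_le_mul_right _ (by omega)
      simp only [Finset.mem_insert, Finset.mem_range]
      rcases hw with h | h
      · exact Or.inl h
      · exact Or.inr (Or.inr (by omega)))
    (fun w hw => by
      simp only [Finset.mem_insert, Finset.mem_range]
      exact Or.inr (Or.inr (hblockN _ le_rfl w hw)))
    (by simp) (hκ K) (hκ 0)
  have hsplit : mean (fun σ : I → Dir d =>
        ind (¬Chain (n ^ 2) (field x σ) (insert i (insert j (Finset.range N))) i (K + 2) j)) ≤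
      mean (fun σ : I → Dir d => ind (¬E K σ)) + mean (fun σ : I → Dir d => ind (¬J σ)) +
      mean (fun σ : I → Dir d => ind (E K σ ∧ J σ ∧
        ¬Chain (n ^ 2) (field x σ) (insert i (insert j (Finset.range N))) i (K + 2) j)) := by
    rw [← lin_add, ← lin_add]
    refine mean_mono fun σ => ?_
    refine le_trans (ind_mono fun hno => ?_)
      ((ind_or_le (¬E K σ ∨ ¬J σ) _).trans (add_le_add_left (ind_or_le _ _) _))
    by_cases hE : E K σ
    · by_cases hJ : J σ
      · exact Or.inr ⟨hE, hJ, hno⟩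
      · exact Or.inl (Or.inr hJ)
    · exact Or.inl (Or.inl hE)
  have hlast' : Real.exp (-(c₂ * κ K * (n : ℝ) ^ 2 / (n : ℝ) ^ d *
      (c₂ * κ 0 * (n : ℝ) ^ 2 / (n : ℝ) ^ d) * (block m i j (K * Q)).card)) ≤
      Real.exp (-(c * κ K * (n : ℝ) ^ 2 / (n : ℝ) ^ d *
        (c * κ 0 * (n : ℝ) ^ 2 / (n : ℝ) ^ d) * m)) := by
    rw [Real.exp_le_exp, neg_le_neg_iff]
    have h1 := hκ K
    have h2 := hκ 0
    have h3 : (m : ℝ) ≤ (block m i j (K * Q)).card := by exact_mod_cast le_card_block m i j (K * Q)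
    gcongr
  have := hgen K le_rfl
  have h4 : mean (fun σ : I → Dir d => ind (E K σ ∧ J σ ∧
      ¬Chain (n ^ 2) (field x σ) (insert i (insert j (Finset.range N))) i (K + 2) j)) ≤ _ :=
    hlast.trans hlast'
  have h5 : mean (fun σ : I → Dir d => ind (¬J σ)) ≤ e₁ := hj
  linarith

/-! ### From the finite model to the random walks -/

theorem dirVec_injective : Function.Injective (dirVec : Dir d → Lattice d) := by
  rintro ⟨i, b⟩ ⟨j, b'⟩ h
  have hne : ∀ b, signStep b ≠ 0 := by intro b; cases b <;> simp [signStep]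
  have hij : i = j := by
    by_contra hij
    have := congrFun h i
    simp only [dirVec, Pi.single_eq_same, Pi.single_eq_of_ne hij] at this
    exact hne b this
  subst hij
  have := congrFun h i
  simp only [dirVec, Pi.single_eq_same] at this
  cases b <;> cases b' <;> simp_all [signStep]

theorem sum_abs_dirVec (q : Dir d) : ∑ i, |dirVec q i| = 1 := by
  rw [Finset.sum_eq_single q.1]
  · cases hb : q.2 <;> simp [dirVec, signStep, hb]
  · intro j _ hj
    simp [dirVec, Pi.single_eq_of_ne hj]
  · simp

/-- The step of walk `p.1` after time `p.2`. -/
def stepOf {Ω : Type*} (X : ℕ → ℕ → Ω → Lattice d) (p : ℕ × ℕ) (ω : Ω) : Lattice d :=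
  X p.1 (p.2 + 1) ω - X p.1 p.2 ω

section bridge
variable {Ω : Type*} [MeasurableSpace Ω] {μ : Measure Ω}
  {X : ℕ → ℕ → Ω → Lattice d}

theorem measurable_stepOf (hX : IndepSimpleRandomWalks μ X) (p : ℕ × ℕ) :
    Measurable (stepOf X p) := (hX.measurable _ _).sub (hX.measurable _ _)

theorem measureReal_stepOf_eq (hX : IndepSimpleRandomWalks μ X) (p : ℕ × ℕ) (q : Dir d) :
    μ.real {ω | stepOf X p ω = dirVec q} = (Fintype.card (Dir d) : ℝ)⁻¹ := by
  have := hX.step_law p.1 p.2 (dirVec q) (sum_abs_dirVec q)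
  simp only [stepOf, this, Dir, Fintype.card_prod, Fintype.card_fin, Fintype.card_bool]
  push_cast
  rw [one_div, mul_comm]

/-- Almost surely all steps are unit vectors. -/
theorem ae_stepOf [NeZero d] [IsProbabilityMeasure μ] (hX : IndepSimpleRandomWalks μ X) :
    ∀ᵐ ω ∂μ, ∀ p, ∃ q : Dir d, stepOf X p ω = dirVec q := by
  rw [ae_all_iff]
  intro p
  have hmeas : ∀ q : Dir d, MeasurableSet {ω | stepOf X p ω = dirVec q} := fun q =>
    measurable_stepOf hX p (measurableSet_singleton _)
  have hU : {ω | ∃ q : Dir d, stepOf X p ω = dirVec q} =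
      ⋃ q ∈ (Finset.univ : Finset (Dir d)), {ω | stepOf X p ω = dirVec q} := by
    ext ω; simp
  have h1 : μ.real {ω | ∃ q : Dir d, stepOf X p ω = dirVec q} = 1 := by
    rw [hU, measureReal_biUnion_finset]
    · simp only [measureReal_stepOf_eq hX]
      rw [Finset.sum_const, Finset.card_univ, nsmul_eq_mul]
      refine mul_inv_cancel₀ ?_
      exact_mod_cast Fintype.card_ne_zero
    · intro q _ q' _ hne
      rw [Function.onFun, Set.disjoint_left]
      intro ω h h'
      exact hne (dirVec_injective (h.symm.trans h'))
    · exact fun q _ => hmeas q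
  have h2 : MeasurableSet {ω | ∃ q : Dir d, stepOf X p ω = dirVec q} := by
    rw [hU]; exact Finset.measurableSet_biUnion _ fun q _ => hmeas q
  rw [measureReal_def, ENNReal.toReal_eq_one_iff] at h1
  exact (prob_compl_eq_zero_iff h2).2 h1

/-- Finitely many steps of the walks are uniformly distributed, as in the finite model. -/
theorem measureReal_steps_eq (hX : IndepSimpleRandomWalks μ X) {I : Finset (ℕ × ℕ)}
    (σ : I → Dir d) :
    μ.real {ω | ∀ p : I, stepOf X p ω = dirVec (σ p)} = (Fintype.card (I → Dir d) : ℝ)⁻¹ := by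
  have h := hX.steps_indep.precomp (g := fun p : I => p.1) Subtype.val_injective
  have h1 := h.measure_inter_preimage_eq_mul Finset.univ (sets := fun p => {dirVec (σ p)})
    fun p _ => measurableSet_singleton _
  have h2 : {ω | ∀ p : I, stepOf X p ω = dirVec (σ p)} =
      ⋂ p ∈ (Finset.univ : Finset I), (fun ω => X p.1.1 (p.1.2 + 1) ω - X p.1.1 p.1.2 ω) ⁻¹'
        {dirVec (σ p)} := by
    ext ω; simp [stepOf]
  rw [h2, measureReal_def, h1, ENNReal.toReal_prod]
  have h3 : ∀ p : I, (μ ((fun ω => X p.1.1 (p.1.2 + 1) ω - X p.1.1 p.1.2 ω) ⁻¹'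
      {dirVec (σ p)})).toReal = (Fintype.card (Dir d) : ℝ)⁻¹ := fun p =>
    measureReal_stepOf_eq hX p.1 (σ p)
  rw [Finset.prod_congr rfl fun p _ => h3 p, Finset.prod_const, Finset.card_univ,
    Fintype.card_fun, inv_pow]
  push_cast
  rfl

/-- The starting points of the first `N` walks; the others are put to the origin. -/
def startsBelow (N : ℕ) (y : ℕ → Lattice d) (k : ℕ) : Lattice d := if k < N then y k else 0

/-- The starting points below `N` range over a countable set, so every event is measurable. -/
theorem measurableSet_startsBelow (N : ℕ) (P : (ℕ → Lattice d) → Prop) :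
    MeasurableSet {y | P (startsBelow N y)} := by
  let r : (ℕ → Lattice d) → (Fin N → Lattice d) := fun y k => y k
  let e : (Fin N → Lattice d) → (ℕ → Lattice d) := fun z k => if h : k < N then z ⟨k, h⟩ else 0
  have hr : Measurable r := measurable_pi_lambda _ fun k => measurable_pi_apply _
  have he : ∀ y, e (r y) = startsBelow N y := by
    intro y; ext k
    by_cases h : k < N <;> simp [e, r, startsBelow, h]
  have : {y | P (startsBelow N y)} = r ⁻¹' {z | P (e z)} := by
    ext y; simp [he]
  rw [this]
  exact hr (Set.to_countable _).measurableSet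

/-- An event that is determined by finitely many steps and starting points has probability at most
`ε` if this holds in the finite model for all deterministic starting points. -/
theorem measureReal_le_of_mean_le [NeZero d] [IsProbabilityMeasure μ] (hX : IndepSimpleRandomWalks μ X) (I : Finset (ℕ × ℕ))
    (N : ℕ) (Ψ : (ℕ → Lattice d) → (I → Dir d) → Prop) (ε : ℝ)
    (hΨ : ∀ x, mean (fun σ => ind (Ψ x σ)) ≤ ε) (F : Set Ω)
    (hF : ∀ ω ∈ F, ∀ σ : I → Dir d, (∀ p : I, stepOf X p ω = dirVec (σ p)) →
      Ψ (startsBelow N fun k => X k 0 ω) σ) : μ.real F ≤ ε := by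
  let st : Ω → ℕ → Lattice d := fun ω k => X k 0 ω
  have hst : Measurable st := measurable_pi_lambda _ fun k => hX.measurable k 0
  let A : (I → Dir d) → Set (ℕ → Lattice d) := fun σ => {y | Ψ (startsBelow N y) σ}
  have hA : ∀ σ, MeasurableSet (A σ) := fun σ => measurableSet_startsBelow N fun x => Ψ x σ
  let B : (I → Dir d) → Set ((ℕ × ℕ) → Lattice d) := fun σ => {s | ∀ p : I, s p = dirVec (σ p)}
  have hB : ∀ σ, MeasurableSet (B σ) := by
    intro σ
    have : B σ = ⋂ p : I, (fun s : (ℕ × ℕ) → Lattice d => s p) ⁻¹' {dirVec (σ p)} := by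
      ext s; simp [B]
    rw [this]
    exact MeasurableSet.iInter fun p => measurable_pi_apply _ (measurableSet_singleton _)
  let T : Ω → (ℕ × ℕ) → Lattice d := fun ω p => stepOf X p ω
  have hind : ∀ σ, μ.real (st ⁻¹' A σ ∩ T ⁻¹' B σ) =
      μ.real (st ⁻¹' A σ) * (Fintype.card (I → Dir d) : ℝ)⁻¹ := by
    intro σ
    have := hX.starts_indep_steps.measure_inter_preimage_eq_mul (A σ) (B σ) (hA σ) (hB σ)
    rw [← measureReal_steps_eq hX σ, measureReal_def, measureReal_def, measureReal_def,
      ← ENNReal.toReal_mul]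
    exact congrArg ENNReal.toReal this
  have hcov : μ.real F ≤ μ.real (⋃ σ ∈ (Finset.univ : Finset (I → Dir d)),
      (st ⁻¹' A σ ∩ T ⁻¹' B σ)) := by
    rw [measureReal_def, measureReal_def]
    refine ENNReal.toReal_mono (measure_ne_top _ _) (measure_mono_ae ?_)
    filter_upwards [ae_stepOf hX] with ω hω hωF
    choose q hq using hω
    refine Set.mem_biUnion (Finset.mem_coe.2 (Finset.mem_univ fun p : I => q p))
      ⟨hF ω hωF _ fun p => hq p, fun p => hq p⟩
  calc μ.real F ≤ _ := hcov
    _ ≤ ∑ σ : I → Dir d, μ.real (st ⁻¹' A σ ∩ T ⁻¹' B σ) := measureReal_biUnion_finset_le _ _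
    _ = ∑ σ : I → Dir d, (Fintype.card (I → Dir d) : ℝ)⁻¹ *
        ∫ ω, (st ⁻¹' A σ).indicator 1 ω ∂μ := by
      refine Finset.sum_congr rfl fun σ _ => ?_
      rw [hind, integral_indicator_one (hst (hA σ)), mul_comm]
    _ = ∫ ω, mean (fun σ => ind (Ψ (startsBelow N (st ω)) σ)) ∂μ := by
      simp only [mean_apply]
      rw [integral_const_mul, ← Finset.mul_sum, integral_finsetSum]
      · refine congrArg _ (Finset.sum_congr rfl fun σ _ => integral_congr_ae (ae_of_all _ fun ω => ?_))
        by_cases h : Ψ (startsBelow N (st ω)) σ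
        · simp [A, h]
        · simp [A, h]
      · intro σ _
        have : (fun ω => ind (Ψ (startsBelow N (st ω)) σ)) = (st ⁻¹' A σ).indicator 1 := by
          ext ω
          by_cases h : Ψ (startsBelow N (st ω)) σ
          · simp [A, h]
          · simp [A, h]
        rw [this]
        exact (integrable_const (1 : ℝ)).indicator (hst (hA σ))
    _ ≤ ∫ _ω, ε ∂μ := by
      refine integral_mono_of_nonneg (ae_of_all _ fun ω => mean_nonneg fun σ => ind_nonneg _)
        (integrable_const _) (ae_of_all _ fun ω => hΨ _)
    _ = ε := by simp

end bridge

/-- If the directions of the steps with labels in `I` are given by `σ`, then the walks of the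
finite model are the random walks as far as `I` reaches. -/
theorem walkPos_eq {Ω : Type*} {X : ℕ → ℕ → Ω → Lattice d} {I : Finset (ℕ × ℕ)}
    {σ : I → Dir d} {ω : Ω} {N w t : ℕ} (hw : w < N)
    (hσ : ∀ p : I, stepOf X p ω = dirVec (σ p)) (hI : ∀ m < t, (w, m) ∈ I) :
    walkPos (startsBelow N fun k => X k 0 ω) σ w t = X w t ω := by
  induction t with
  | zero => simp [walkPos, walkInc, startsBelow, hw]
  | succ t ih =>
    have h1 : walkInc σ w t (t + 1) = stepOf X (w, t) ω := by
      rw [walkInc, Nat.Ico_succ_singleton, Finset.sum_singleton, stepAt,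
        dif_pos (hI t (Nat.lt_succ_self t))]
      exact (hσ ⟨(w, t), _⟩).symm
    rw [walkPos_add _ σ w (Nat.le_succ t), ih fun m hm => hI m (by omega), h1, stepOf]
    abel

/-! ### Stretched-exponential smallness -/

theorem SESmall.add {f g : ℕ → ℝ} (hf : SESmall f) (hg : SESmall g) :
    SESmall fun n => f n + g n := by
  obtain ⟨a₁, a₂, a₃, ha₁, ha₂, ha₃, ha⟩ := hf
  obtain ⟨b₁, b₂, b₃, hb₁, hb₂, hb₃, hb⟩ := hg
  refine ⟨a₁ + b₁, min a₂ b₂, min a₃ b₃, by positivity, lt_min ha₂ hb₂, lt_min ha₃ hb₃,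
    fun n hn => ⟨add_nonneg (ha n hn).1 (hb n hn).1, ?_⟩⟩
  have hn' : (1 : ℝ) ≤ n := by exact_mod_cast hn
  have key : ∀ u v : ℝ, 0 < u → min a₂ b₂ ≤ u → min a₃ b₃ ≤ v →
      Real.exp (-u * (n : ℝ) ^ v) ≤ Real.exp (-min a₂ b₂ * (n : ℝ) ^ min a₃ b₃) := by
    intro u v hu h1 h2
    rw [Real.exp_le_exp, neg_mul, neg_mul, neg_le_neg_iff]
    exact mul_le_mul h1 (Real.rpow_le_rpow_of_exponent_le hn' h2) (by positivity) hu.le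
  have h1 := mul_le_mul_of_nonneg_left (key a₂ a₃ ha₂ (min_le_left _ _) (min_le_left _ _)) ha₁.le
  have h2 := mul_le_mul_of_nonneg_left (key b₂ b₃ hb₂ (min_le_right _ _) (min_le_right _ _)) hb₁.le
  linarith [(ha n hn).2, (hb n hn).2]

theorem SESmall.ite {f : ℕ → ℝ} (hf : SESmall f) (n₀ : ℕ) :
    SESmall fun n => if n < n₀ then 1 else f n := by
  obtain ⟨a₁, a₂, a₃, ha₁, ha₂, ha₃, ha⟩ := hf
  refine ⟨a₁ + Real.exp (a₂ * (n₀ : ℝ) ^ a₃), a₂, a₃, by positivity, ha₂, ha₃, fun n hn => ?_⟩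
  dsimp only
  split_ifs with h
  · refine ⟨zero_le_one, ?_⟩
    have h1 : (n : ℝ) ^ a₃ ≤ (n₀ : ℝ) ^ a₃ :=
      Real.rpow_le_rpow (Nat.cast_nonneg _) (by exact_mod_cast h.le) ha₃.le
    calc (1 : ℝ) ≤ Real.exp (a₂ * (n₀ : ℝ) ^ a₃ + -a₂ * (n : ℝ) ^ a₃) := by
          rw [Real.one_le_exp_iff]; nlinarith
      _ = Real.exp (a₂ * (n₀ : ℝ) ^ a₃) * Real.exp (-a₂ * (n : ℝ) ^ a₃) := Real.exp_add _ _
      _ ≤ _ := by gcongr; linarith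
  · refine ⟨(ha n hn).1, (ha n hn).2.trans ?_⟩
    gcongr
    linarith [Real.exp_pos (a₂ * (n₀ : ℝ) ^ a₃)]

theorem sesmall_exp {b δ : ℝ} (hb : 0 < b) (hδ : 0 < δ) :
    SESmall fun n => Real.exp (-(b * (n : ℝ) ^ δ)) :=
  ⟨1, b, δ, one_pos, hb, hδ, fun n _ => ⟨(Real.exp_pos _).le, by rw [one_mul, neg_mul]⟩⟩

theorem eventually_le_rpow (A : ℝ) {δ : ℝ} (hδ : 0 < δ) :
    ∀ᶠ n : ℕ in Filter.atTop, A ≤ (n : ℝ) ^ δ :=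
  ((tendsto_rpow_atTop hδ).comp tendsto_natCast_atTop_atTop).eventually_ge_atTop A

theorem eventually_rpow_mul_exp_le (A B : ℝ) {b δ : ℝ} (hb : 0 < b) (hδ : 0 < δ) :
    ∀ᶠ n : ℕ in Filter.atTop, A * (n : ℝ) ^ B * Real.exp (-(b * (n : ℝ) ^ δ)) ≤
      Real.exp (-(b / 2 * (n : ℝ) ^ δ)) := by
  have h1 := (tendsto_rpow_mul_exp_neg_mul_atTop_nhds_zero (B / δ) (b / 2) (half_pos hb)).const_mul A
  rw [mul_zero] at h1
  have h2 := h1.comp ((tendsto_rpow_atTop hδ).comp tendsto_natCast_atTop_atTop)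
  filter_upwards [h2.eventually (ge_mem_nhds zero_lt_one)] with n hn
  simp only [Function.comp] at hn
  rw [← Real.rpow_mul (Nat.cast_nonneg n), mul_div_cancel₀ _ hδ.ne'] at hn
  calc A * (n : ℝ) ^ B * Real.exp (-(b * (n : ℝ) ^ δ))
      = A * ((n : ℝ) ^ B * Real.exp (-(b / 2) * (n : ℝ) ^ δ)) *
          Real.exp (-(b / 2 * (n : ℝ) ^ δ)) := by
        rw [mul_assoc, mul_assoc, mul_assoc, ← Real.exp_add]; congr 3; ring_nf
    _ ≤ 1 * Real.exp (-(b / 2 * (n : ℝ) ^ δ)) :=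
        mul_le_mul_of_nonneg_right hn (Real.exp_pos _).le
    _ = _ := one_mul _

/-! ### The exponents -/

/-- The number of generations in the definition of `β` suffices: every link of a chain gains a
factor `n ^ (1 - h)` of capacity, and the capacity has to grow from `n ^ 0` to `n ^ (d - 3)`. -/
theorem lt_two_mul_of_betaCondition (hd : 3 ≤ d) {h : ℝ} (hh : h < 2 / (d : ℝ)) {k : ℕ}
    (hk : BetaCondition d h k) : (d : ℝ) - 3 < 2 * k * (1 - h) := by
  obtain ⟨hk1, hk2⟩ := hk
  have hd' : (3 : ℝ) ≤ d := by exact_mod_cast hd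
  have hk' : (1 : ℝ) ≤ k := by exact_mod_cast hk1
  have hhd : h * d < 2 := by rwa [lt_div_iff₀ (by linarith)] at hh
  have hh1 : h < 2 / 3 := hh.trans_le (by
    rw [div_le_div_iff₀ (by linarith) (by norm_num)]; linarith)
  by_contra hcon
  rw [not_lt] at hcon
  have hd4 : (4 : ℝ) ≤ d := by
    rcases Nat.lt_or_ge d 4 with h4 | h4
    · have : (d : ℝ) = 3 := by exact_mod_cast (show d = 3 by omega)
      rw [this] at hcon
      nlinarith
    · exact_mod_cast h4
  set A := (d : ℝ) - 3 + h - d * h / 2 with hA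
  have hA0 : 0 ≤ A := by nlinarith
  have hinv : 2 / (d : ℝ) ≤ 2 := by rw [div_le_iff₀ (by linarith)]; linarith
  have hB := one_add_mul_le_pow (a := -(2 / (d : ℝ))) (by linarith) (k - 1)
  rw [Nat.cast_sub hk1, Nat.cast_one] at hB
  have h1 : A * (1 + ((k : ℝ) - 1) * -(2 / (d : ℝ))) ≤ A * (1 - 2 / (d : ℝ)) ^ (k - 1) := by
    refine mul_le_mul_of_nonneg_left ?_ hA0
    rw [sub_eq_add_neg]; exact hB
  have h2 : A * (2 / (d : ℝ)) ≤ 2 - 2 * h := by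
    rw [mul_div_assoc', div_le_iff₀ (by linarith)]
    nlinarith
  have h3 : (k - 1) * (A * (2 / (d : ℝ))) ≤ (k - 1) * (2 - 2 * h) :=
    mul_le_mul_of_nonneg_left h2 (by linarith)
  nlinarith

/-- The exponent of the capacity of generation `g`. -/
noncomputable def capExp (d : ℕ) (h δ : ℝ) (g : ℕ) : ℝ :=
  min (1 - 2 * δ + g * (1 - h - 3 * δ)) ((d : ℝ) - 2 - δ)

/-- The choice of the lengths, the sizes and the capacities that the chains use, with the
estimates that they have to satisfy. -/
structure Parameters (d n : ℕ) (C c b δ : ℝ) (K N l Q m : ℕ) (L : ℝ) (κ : ℕ → ℝ) : Prop where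
  one_le_l : 1 ≤ l
  L_pos : 0 < L
  L_le : L ≤ (n : ℝ) ^ 2
  Ql_le_L : ((Q * l : ℕ) : ℝ) ≤ L
  Ql_le : Q * l ≤ n ^ 2
  card_le : (K * Q + 1) * (m + 2) ≤ N
  κ_nonneg : ∀ g, 0 ≤ κ g
  κ_zero_le : κ 0 ≤ (l : ℝ) ^ (3 / 4 : ℝ) / (C * √n)
  one_le : ∀ g, 1 ≤ m * (c * κ g * (n : ℝ) ^ 2 / (n : ℝ) ^ d)
  κ_succ_le : ∀ g, κ (g + 1) ≤ c * n * (m * (c * κ g * (n : ℝ) ^ 2 / (n : ℝ) ^ d))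
  κ_succ_le' : ∀ g, κ (g + 1) ≤ c * ((n : ℝ) ^ d / (n : ℝ) ^ 2)
  le_sq_div : b * (n : ℝ) ^ δ ≤ (n : ℝ) ^ 2 / (2 * L)
  le_half_Q : b * (n : ℝ) ^ δ ≤ 1 / 2 * Q
  le_mul_Q : b * (n : ℝ) ^ δ ≤ c * Q
  le_start : b * (n : ℝ) ^ δ ≤ κ 0 * (n : ℝ) ^ 2 / (n : ℝ) ^ d * m
  le_last : b * (n : ℝ) ^ δ ≤
    c * κ K * (n : ℝ) ^ 2 / (n : ℝ) ^ d * (c * κ 0 * (n : ℝ) ^ 2 / (n : ℝ) ^ d) * m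

theorem half_le_floor {y : ℝ} (hy : 1 ≤ y) : y / 2 ≤ (⌊y⌋₊ : ℝ) := by
  have h1 := Nat.lt_floor_add_one y
  have h2 : (1 : ℝ) ≤ ⌊y⌋₊ := by exact_mod_cast Nat.le_floor (by exact_mod_cast hy)
  linarith

theorem mul_rpow_mul_sq_div {x : ℝ} (hx : 0 < x) (f : ℝ) :
    x ^ f * x ^ 2 / x ^ d = x ^ (f + 2 - d) := by
  rw [Real.rpow_sub hx, Real.rpow_add hx, Real.rpow_natCast, Real.rpow_ofNat]

/-- Up to rounding, the capacity of generation `g` is `n ^ capExp g`, the pieces of a path have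
`n ^ (2 - 2δ)` steps, and there are `n ^ δ` pieces and groups, with `n ^ (d - 2 - h - 2δ)` walks in
each group. -/
theorem eventually_parameters (hd : 3 ≤ d) {h δ C₅ C c : ℝ} {K : ℕ} (hδ : 0 < δ)
    (hδ4 : δ ≤ 1 / 4) (hδh : 6 * δ ≤ 1 - h)
    (hK : (d : ℝ) - 3 + h + 5 * δ ≤ 1 - 2 * δ + K * (1 - h - 3 * δ)) (hC₅ : 0 < C₅) (hC : 0 < C)
    (hc : 0 < c) :
    ∃ b : ℝ, 0 < b ∧ ∀ᶠ n : ℕ in Filter.atTop, ∃ (l Q m : ℕ) (L : ℝ) (κ : ℕ → ℝ),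
      Parameters d n C c b δ K ⌈C₅ * (n : ℝ) ^ ((d : ℝ) - 2 - h)⌉₊ l Q m L κ := by
  have hd' : (3 : ℝ) ≤ d := by exact_mod_cast hd
  have hf0 : capExp d h δ 0 = 1 - 2 * δ := by
    rw [capExp, Nat.cast_zero, zero_mul, add_zero, min_eq_left]; linarith
  have hfle : ∀ g, h + 3 * δ ≤ capExp d h δ g := by
    intro g
    have : 0 ≤ (g : ℝ) * (1 - h - 3 * δ) := mul_nonneg (Nat.cast_nonneg _) (by linarith)
    exact le_min (by linarith) (by linarith)
  have hfsucc : ∀ g, capExp d h δ (g + 1) ≤ capExp d h δ g + (1 - h - 3 * δ) := by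
    intro g
    unfold capExp
    rw [← min_add_add_right]
    refine min_le_min ?_ (by linarith)
    push_cast; linarith
  have hfd : ∀ g, capExp d h δ g ≤ (d : ℝ) - 2 - δ := fun g => min_le_right _ _
  have hfK : (d : ℝ) - 3 + h + 5 * δ ≤ capExp d h δ K := le_min hK (by linarith)
  refine ⟨min (1 / 4) (min (c / 2) (c ^ 2 / 2)), by positivity, ?_⟩
  set b := min (1 / 4) (min (c / 2) (c ^ 2 / 2)) with hb
  have hb1 : b ≤ 1 / 4 := min_le_left _ _
  have hb2 : b ≤ c / 2 := (min_le_right _ _).trans (min_le_left _ _)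
  have hb3 : b ≤ c ^ 2 / 2 := (min_le_right _ _).trans (min_le_right _ _)
  filter_upwards [eventually_le_rpow (2 / c) hδ, eventually_le_rpow (2 / c ^ 2) hδ,
    eventually_le_rpow (3 * (K + 1) / C₅) hδ, eventually_le_rpow (2 * C) (half_pos hδ),
    Filter.eventually_ge_atTop 1] with n e1 e2 e3 e4 hn
  have hx : (1 : ℝ) ≤ n := by exact_mod_cast hn
  set x : ℝ := (n : ℝ) with hxdef
  have hx0 : 0 < x := by linarith
  rw [div_le_iff₀ hc] at e1
  rw [div_le_iff₀ (by positivity)] at e2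
  rw [div_le_iff₀ hC₅] at e3
  have hy1 : ∀ a : ℝ, 0 ≤ a → 1 ≤ x ^ a := fun a ha => Real.one_le_rpow hx ha
  have hmono : ∀ a a' : ℝ, a ≤ a' → x ^ a ≤ x ^ a' := fun a a' h =>
    Real.rpow_le_rpow_of_exponent_le hx h
  have hl1 := hy1 (2 - 2 * δ) (by linarith)
  have hQ1 := hy1 δ hδ.le
  have hm1 := hy1 ((d : ℝ) - 2 - h - 2 * δ) (by linarith)
  have hl2 := half_le_floor hl1
  have hQ2 := half_le_floor hQ1
  have hm2 := half_le_floor hm1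
  have hl3 := Nat.floor_le (zero_le_one.trans hl1)
  have hQ3 := Nat.floor_le (zero_le_one.trans hQ1)
  have hm3 := Nat.floor_le (zero_le_one.trans hm1)
  have hQl : ((⌊x ^ δ⌋₊ * ⌊x ^ (2 - 2 * δ)⌋₊ : ℕ) : ℝ) ≤ x ^ (2 - δ) := by
    push_cast
    calc _ ≤ x ^ δ * x ^ (2 - 2 * δ) := by gcongr
      _ = x ^ (2 - δ) := by rw [← Real.rpow_add hx0]; congr 1; ring
  have hL : x ^ (2 - δ) ≤ x ^ 2 := by
    rw [← Real.rpow_ofNat]; exact hmono _ _ (by norm_num; linarith)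
  -- `m κ n ^ (2 - d)`, the expected number of hits of a group, is of order `n ^ (f - h - 2δ)` for
  -- `κ = n ^ f`.
  have hmκ : ∀ f : ℝ, x ^ (f - h - 2 * δ) / 2 ≤
      ⌊x ^ ((d : ℝ) - 2 - h - 2 * δ)⌋₊ * (x ^ f * x ^ 2 / x ^ d) := by
    intro f
    rw [mul_rpow_mul_sq_div hx0]
    calc x ^ (f - h - 2 * δ) / 2 = x ^ ((d : ℝ) - 2 - h - 2 * δ) / 2 * x ^ (f + 2 - d) := by
          rw [div_mul_eq_mul_div, ← Real.rpow_add hx0]; congr 2; ring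
      _ ≤ _ := by gcongr
  refine ⟨⌊x ^ (2 - 2 * δ)⌋₊, ⌊x ^ δ⌋₊, ⌊x ^ ((d : ℝ) - 2 - h - 2 * δ)⌋₊, x ^ (2 - δ),
    fun g => x ^ capExp d h δ g, ?_⟩
  constructor
  · exact Nat.le_floor (by exact_mod_cast hl1)
  · positivity
  · exact hL
  · exact hQl
  · have := hQl.trans hL
    rw [hxdef] at this
    exact_mod_cast this
  · have h1 : (((K * ⌊x ^ δ⌋₊ + 1) * (⌊x ^ ((d : ℝ) - 2 - h - 2 * δ)⌋₊ + 2) : ℕ) : ℝ) ≤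
        C₅ * x ^ ((d : ℝ) - 2 - h) := by
      push_cast
      calc (K * (⌊x ^ δ⌋₊ : ℝ) + 1) * (⌊x ^ ((d : ℝ) - 2 - h - 2 * δ)⌋₊ + 2)
          ≤ (K * x ^ δ + x ^ δ) * (x ^ ((d : ℝ) - 2 - h - 2 * δ) +
              2 * x ^ ((d : ℝ) - 2 - h - 2 * δ)) := by gcongr; linarith
        _ = (3 * (K + 1)) * (x ^ δ * x ^ ((d : ℝ) - 2 - h - 2 * δ)) := by ring
        _ ≤ (x ^ δ * C₅) * (x ^ δ * x ^ ((d : ℝ) - 2 - h - 2 * δ)) := by gcongr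
        _ = C₅ * (x ^ δ * (x ^ δ * x ^ ((d : ℝ) - 2 - h - 2 * δ))) := by ring
        _ = C₅ * x ^ ((d : ℝ) - 2 - h) := by
          rw [← Real.rpow_add hx0, ← Real.rpow_add hx0]; congr 2; ring
    exact_mod_cast h1.trans (Nat.le_ceil _)
  · exact fun g => by positivity
  · rw [hf0, le_div_iff₀ (by positivity)]
    have h1 : (x ^ (2 - 2 * δ) / 2) ^ (3 / 4 : ℝ) ≤ (⌊x ^ (2 - 2 * δ)⌋₊ : ℝ) ^ (3 / 4 : ℝ) := by
      gcongr
    refine le_trans ?_ h1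
    rw [Real.div_rpow (by positivity) (by norm_num), ← Real.rpow_mul hx0.le]
    have h2 : (2 : ℝ) ^ (3 / 4 : ℝ) ≤ 2 := by
      calc (2 : ℝ) ^ (3 / 4 : ℝ) ≤ 2 ^ (1 : ℝ) := by gcongr <;> norm_num
        _ = 2 := Real.rpow_one 2
    calc x ^ (1 - 2 * δ) * (C * √x) = (2 * C) * (x ^ (1 - 2 * δ) * x ^ (1 / 2 : ℝ)) / 2 := by
          rw [Real.sqrt_eq_rpow]; ring
      _ ≤ x ^ (δ / 2) * (x ^ (1 - 2 * δ) * x ^ (1 / 2 : ℝ)) / 2 := by gcongr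
      _ = x ^ ((2 - 2 * δ) * (3 / 4)) / 2 := by
          rw [← Real.rpow_add hx0, ← Real.rpow_add hx0]; congr 2; ring
      _ ≤ _ := by gcongr
  · intro g
    have h1 := hmκ (capExp d h δ g)
    have h2 := hmono δ (capExp d h δ g - h - 2 * δ) (by linarith [hfle g])
    calc (1 : ℝ) ≤ c * (x ^ δ / 2) := by linarith
      _ ≤ c * (x ^ (capExp d h δ g - h - 2 * δ) / 2) := by gcongr
      _ ≤ c * (⌊x ^ ((d : ℝ) - 2 - h - 2 * δ)⌋₊ * (x ^ capExp d h δ g * x ^ 2 / x ^ d)) := by gcongr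
      _ = _ := by ring
  · intro g
    have h1 := hmκ (capExp d h δ g)
    calc x ^ capExp d h δ (g + 1) ≤ x ^ (1 + (capExp d h δ g - h - 3 * δ)) :=
          hmono _ _ (by linarith [hfsucc g])
      _ = x * x ^ (capExp d h δ g - h - 3 * δ) := by rw [Real.rpow_add hx0, Real.rpow_one]
      _ ≤ x * ((x ^ δ * c ^ 2) / 2 * x ^ (capExp d h δ g - h - 3 * δ)) := by
          have : 1 ≤ x ^ δ * c ^ 2 / 2 := by linarith
          gcongr
          exact le_mul_of_one_le_left (by positivity) this
      _ = c ^ 2 * x * (x ^ δ * x ^ (capExp d h δ g - h - 3 * δ) / 2) := by ring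
      _ = c ^ 2 * x * (x ^ (capExp d h δ g - h - 2 * δ) / 2) := by
          rw [← Real.rpow_add hx0]; congr 3; ring
      _ ≤ c ^ 2 * x * (⌊x ^ ((d : ℝ) - 2 - h - 2 * δ)⌋₊ * (x ^ capExp d h δ g * x ^ 2 / x ^ d)) := by
          gcongr
      _ = _ := by ring
  · intro g
    have h1 : x ^ d / x ^ 2 = x ^ ((d : ℝ) - 2) := by
      rw [Real.rpow_sub hx0, Real.rpow_natCast, Real.rpow_ofNat]
    rw [h1]
    calc x ^ capExp d h δ (g + 1) ≤ x ^ ((d : ℝ) - 2 - δ) := hmono _ _ (hfd _)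
      _ ≤ (x ^ δ * c) * x ^ ((d : ℝ) - 2 - δ) :=
          le_mul_of_one_le_left (by positivity) (by linarith)
      _ = c * (x ^ δ * x ^ ((d : ℝ) - 2 - δ)) := by ring
      _ = _ := by rw [← Real.rpow_add hx0]; congr 2; ring
  · have h1 : x ^ 2 / (2 * x ^ (2 - δ)) = x ^ δ / 2 := by
      rw [Real.rpow_sub hx0, Real.rpow_ofNat]
      field_simp
    rw [h1]
    have : b * x ^ δ ≤ 1 / 4 * x ^ δ := by gcongr
    linarith
  · have : b * x ^ δ ≤ 1 / 4 * x ^ δ := by gcongr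
    linarith
  · calc b * x ^ δ ≤ c / 2 * x ^ δ := by gcongr
      _ = c * (x ^ δ / 2) := by ring
      _ ≤ _ := by gcongr
  · have h1 := hmκ (capExp d h δ 0)
    have h2 := hmono δ (capExp d h δ 0 - h - 2 * δ) (by linarith [hf0])
    calc b * x ^ δ ≤ 1 / 4 * x ^ δ := by gcongr
      _ ≤ x ^ (capExp d h δ 0 - h - 2 * δ) / 2 := by linarith
      _ ≤ _ := h1
      _ = _ := by ring
  · have h1 := hmκ (capExp d h δ 0)
    have h3 := mul_rpow_mul_sq_div (d := d) hx0 (capExp d h δ K)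
    calc b * x ^ δ ≤ c ^ 2 / 2 * x ^ δ := by gcongr
      _ ≤ c ^ 2 / 2 * x ^ ((capExp d h δ K + 2 - d) + (capExp d h δ 0 - h - 2 * δ)) := by
          gcongr
          linarith
      _ = c ^ 2 * x ^ (capExp d h δ K + 2 - d) * (x ^ (capExp d h δ 0 - h - 2 * δ) / 2) := by
          rw [Real.rpow_add hx0]; ring
      _ ≤ c ^ 2 * x ^ (capExp d h δ K + 2 - d) *
          (⌊x ^ ((d : ℝ) - 2 - h - 2 * δ)⌋₊ * (x ^ capExp d h δ 0 * x ^ 2 / x ^ d)) := by gcongr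
      _ = _ := by rw [← h3]; ring

/-! ### The estimates for the random walks -/

theorem mem_box_iff {n : ℕ} {z : Lattice d} : z ∈ box d n ↔ z ∈ boxFinset d n := by
  rw [box, Metric.mem_closedBall, dist_pi_le_iff (Nat.cast_nonneg n), mem_boxFinset]
  refine forall_congr' fun i => ?_
  rw [Int.dist_eq, Pi.zero_apply, Int.cast_zero, sub_zero, ← Int.cast_abs]
  exact_mod_cast Iff.rfl

theorem measureReal_biUnion_range_le {Ω : Type*} [MeasurableSpace Ω] {μ : Measure Ω}
    {N : ℕ} {F : ℕ → Set Ω} {e : ℝ}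
    (h : ∀ i < N, μ.real (F i) ≤ e) : μ.real (⋃ i ∈ Finset.range N, F i) ≤ N * e := by
  refine (measureReal_biUnion_finset_le _ _).trans ?_
  refine (Finset.sum_le_card_nsmul _ _ e fun i hi => h i (Finset.mem_range.1 hi)).trans ?_
  rw [Finset.card_range, nsmul_eq_mul]

section probability
variable {Ω : Type*} [MeasurableSpace Ω] {μ : Measure Ω} [IsProbabilityMeasure μ]

theorem one_sub_le_measureReal {S₁ S₂ G F : Set Ω} {e₁ e₂ e₃ : ℝ} (hS₁ : MeasurableSet S₁)
    (hS₂ : MeasurableSet S₂) (h₁ : 1 - e₁ ≤ μ.real S₁) (h₂ : 1 - e₂ ≤ μ.real S₂)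
    (h₃ : μ.real F ≤ e₃) (hF : ∀ ω ∈ S₁, ω ∈ S₂ → ω ∉ G → ω ∈ F) :
    1 - (e₁ + e₂ + e₃) ≤ μ.real G := by
  have hU : (Set.univ : Set Ω) ⊆ ((G ∪ S₁ᶜ) ∪ S₂ᶜ) ∪ F := by
    intro ω _
    by_cases h1 : ω ∈ S₁
    · by_cases h2 : ω ∈ S₂
      · by_cases hG : ω ∈ G
        · exact Or.inl (Or.inl (Or.inl hG))
        · exact Or.inr (hF ω h1 h2 hG)
      · exact Or.inl (Or.inr h2)
    · exact Or.inl (Or.inl (Or.inr h1))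
  have h4 : μ.real Set.univ ≤ μ.real G + μ.real S₁ᶜ + μ.real S₂ᶜ + μ.real F :=
    (measureReal_mono hU).trans ((measureReal_union_le _ _).trans (add_le_add_left
      ((measureReal_union_le _ _).trans (add_le_add_left (measureReal_union_le _ _) _)) _))
  rw [probReal_univ, probReal_compl_eq_one_sub hS₁, probReal_compl_eq_one_sub hS₂] at h4
  linarith

theorem measureReal_iUnion_le_tsum {F : ℕ → Set Ω} {g : ℕ → ℝ} (hg : ∀ t, 0 ≤ g t)
    (hs : Summable g) (h : ∀ t, μ.real (F t) ≤ g t) : μ.real (⋃ t, F t) ≤ ∑' t, g t := by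
  rw [measureReal_def]
  refine ENNReal.toReal_le_of_le_ofReal (tsum_nonneg hg) ((measure_iUnion_le F).trans ?_)
  rw [ENNReal.ofReal_tsum_of_nonneg hg hs]
  refine ENNReal.tsum_le_tsum fun t => ?_
  rw [← ofReal_measureReal]
  exact ENNReal.ofReal_le_ofReal (h t)

variable {X : ℕ → ℕ → Ω → Lattice d} {η₁ η₂ : Ω → ℕ}

/-- The estimate of the finite model for chains, for the random walks. -/
theorem measureReal_not_chainConnected_le [NeZero d] (hX : IndepSimpleRandomWalks μ X)
    {n N K i j : ℕ} (hη : ∀ ω, η₁ ω ≤ η₂ ω) (hbox : ∀ ω, ∀ k < η₂ ω, X k 0 ω ∈ box d n) {ε : ℝ}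
    (hε : 0 ≤ ε) {I : Finset (ℕ × ℕ)}
    (hI : ∀ w, w < N ∨ w = i ∨ w = j → ∀ u < 2 * n ^ 2, (w, u) ∈ I)
    (hmean : ∀ x : ℕ → Lattice d, (∀ w, w < N ∨ w = i ∨ w = j → x w ∈ boxFinset d n) →
      mean (fun σ : I → Dir d =>
        ind (¬Chain (n ^ 2) (field x σ) (insert i (insert j (Finset.range N))) i K j)) ≤ ε) :
    μ.real {ω | N ≤ η₁ ω ∧ i < η₁ ω ∧ j < η₁ ω ∧
      ¬ChainConnected (fun k m => X k m ω) (η₁ ω) K (2 * n ^ 2) i j} ≤ ε := by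
  refine measureReal_le_of_mean_le hX I (N + i + j + 1)
    (fun x σ => (∀ w, w < N ∨ w = i ∨ w = j → x w ∈ boxFinset d n) ∧
      ¬Chain (n ^ 2) (field x σ) (insert i (insert j (Finset.range N))) i K j) ε (fun x => ?_) _ ?_
  · by_cases hx : ∀ w, w < N ∨ w = i ∨ w = j → x w ∈ boxFinset d n
    · exact (mean_mono fun σ => ind_mono fun h => h.2).trans (hmean x hx)
    · refine (mean_mono (g := fun _ => (0 : ℝ)) fun σ => ?_).trans (by rwa [mean_const])
      exact (ind_false fun h => hx h.1).le
  · rintro ω ⟨hN, hi, hj, hno⟩ σ hσ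
    have hlt : ∀ w, w < N ∨ w = i ∨ w = j → w < η₁ ω ∧ w < N + i + j + 1 := by
      rintro w (h | rfl | rfl) <;> omega
    refine ⟨fun w hw => ?_, ?_⟩
    · rw [startsBelow, if_pos (hlt w hw).2]
      exact mem_box_iff.1 (hbox ω w ((hlt w hw).1.trans_le (hη ω)))
    · rintro ⟨f, h0, hK, hA, hl⟩
      have hA' : ∀ t ≤ K, f t < N ∨ f t = i ∨ f t = j := by
        intro t ht
        have := hA t ht
        simp only [Finset.mem_insert, Finset.mem_range] at this
        tauto
      have hpos : ∀ t ≤ K, ∀ u ≤ 2 * n ^ 2,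
          field (startsBelow (N + i + j + 1) fun k => X k 0 ω) σ (f t, u) = X (f t) u ω :=
        fun t ht u hu => walkPos_eq (hlt _ (hA' t ht)).2 hσ
          fun m hm => hI _ (hA' t ht) m (by omega)
      refine hno ⟨f, h0, hK, fun t ht => (hlt _ (hA' t ht)).1, fun t ht => ?_⟩
      obtain ⟨u, u', hu, hu', e⟩ := hl t ht
      rw [hpos (t + 1) ht u hu, hpos t ht.le u' hu'] at e
      exact ⟨_, ⟨u, hu, rfl⟩, ⟨u', hu', e.symm⟩⟩

/-- The estimate of the finite model for walks that meet no other walk, for the random walks. -/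
theorem measureReal_no_meet_le [NeZero d] (hX : IndepSimpleRandomWalks μ X)
    {n N i a b t : ℕ} (hη : ∀ ω, η₁ ω ≤ η₂ ω) (hbox : ∀ ω, ∀ k < η₂ ω, X k 0 ω ∈ box d n) {ε : ℝ}
    (hε : 0 ≤ ε) (htb : t ≤ b) {I : Finset (ℕ × ℕ)} (hIi : ∀ u < b, (i, u) ∈ I)
    (hI : ∀ w < N, ∀ u < n ^ 2, (w, u) ∈ I)
    (hmean : ∀ x : ℕ → Lattice d, (∀ w ∈ (Finset.range N).erase i, x w ∈ boxFinset d n) →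
      mean (fun σ : I → Dir d => ind (walkPos x σ i t ∈ boxFinset d n ∧
        ∀ j ∈ (Finset.range N).erase i, ¬∃ u u', a ≤ u ∧ u ≤ b ∧ u' ≤ n ^ 2 ∧
          walkPos x σ i u = walkPos x σ j u')) ≤ ε) :
    μ.real {ω | N ≤ η₁ ω ∧ X i t ω ∈ box d n ∧ ∀ j < η₁ ω,
      ¬∃ u u', a ≤ u ∧ u ≤ b ∧ u' ≤ n ^ 2 ∧ X i u ω = X j u' ω} ≤ ε := by
  refine measureReal_le_of_mean_le hX I (N + i + 1)
    (fun x σ => (∀ w ∈ (Finset.range N).erase i, x w ∈ boxFinset d n) ∧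
      (walkPos x σ i t ∈ boxFinset d n ∧
        ∀ j ∈ (Finset.range N).erase i, ¬∃ u u', a ≤ u ∧ u ≤ b ∧ u' ≤ n ^ 2 ∧
          walkPos x σ i u = walkPos x σ j u')) ε (fun x => ?_) _ ?_
  · by_cases hx : ∀ w ∈ (Finset.range N).erase i, x w ∈ boxFinset d n
    · exact (mean_mono fun σ => ind_mono fun h => h.2).trans (hmean x hx)
    · refine (mean_mono (g := fun _ => (0 : ℝ)) fun σ => ?_).trans (by rwa [mean_const])
      exact (ind_false fun h => hx h.1).le
  · rintro ω ⟨hN, ht, hno⟩ σ hσ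
    have hiu : ∀ u ≤ b, walkPos (startsBelow (N + i + 1) fun k => X k 0 ω) σ i u = X i u ω :=
      fun u hu => walkPos_eq (by omega) hσ fun m hm => hIi m (by omega)
    refine ⟨fun w hw => ?_, ?_, fun j hj => ?_⟩
    · have hw' := Finset.mem_range.1 (Finset.mem_of_mem_erase hw)
      rw [startsBelow, if_pos (by omega)]
      exact mem_box_iff.1 (hbox ω w ((hw'.trans_le hN).trans_le (hη ω)))
    · rw [hiu t htb]; exact mem_box_iff.1 ht
    · have hj' := Finset.mem_range.1 (Finset.mem_of_mem_erase hj)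
      rintro ⟨u, u', h1, h2, h3, e⟩
      rw [hiu u h2, walkPos_eq (w := j) (by omega) hσ fun m hm => hI j hj' m (by omega)] at e
      exact hno j (hj'.trans_le hN) ⟨u, u', h1, h2, h3, e⟩
end probability

theorem decay_sq_le {a t : ℕ} (h : t ≤ 2 * a + 1) :
    decay a ^ 2 ≤ 4 * ((t + 1 : ℕ) : ℝ) ^ (-(3 / 2) : ℝ) := by
  rw [decay_sq]
  have h1 : ((t + 1 : ℕ) : ℝ) / 2 ≤ (a : ℝ) + 1 := by
    have : (t : ℝ) ≤ 2 * a + 1 := by exact_mod_cast h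
    push_cast; linarith
  have h2 : (2 : ℝ) ^ (3 / 2 : ℝ) ≤ 4 := by
    calc (2 : ℝ) ^ (3 / 2 : ℝ) ≤ 2 ^ (2 : ℝ) := by gcongr <;> norm_num
      _ = 4 := by norm_num
  calc ((a : ℝ) + 1) ^ (-(3 / 2) : ℝ) ≤ (((t + 1 : ℕ) : ℝ) / 2) ^ (-(3 / 2) : ℝ) :=
        Real.rpow_le_rpow_of_nonpos (by positivity) h1 (by norm_num)
    _ = 2 ^ (3 / 2 : ℝ) * ((t + 1 : ℕ) : ℝ) ^ (-(3 / 2) : ℝ) := by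
        rw [Real.div_rpow (by positivity) (by norm_num), Real.rpow_neg (by norm_num : (0 : ℝ) ≤ 2),
          div_inv_eq_mul, mul_comm]
    _ ≤ _ := by gcongr

theorem summable_decay_sq : Summable fun t : ℕ => ((t + 1 : ℕ) : ℝ) ^ (-(3 / 2) : ℝ) :=
  (summable_nat_add_iff 1).2 (Real.summable_nat_rpow.2 (by norm_num))

/-- The two estimates in the finite model with all parameters chosen: the probability that walks
`i` and `j` are not connected by a chain, and the probability that walk `i` is in the box at the
time `t` and meets none of the other walks in the window `[a, a + q]` around this time. -/
theorem exists_model_bounds (hd : 3 ≤ d) {h C₅ : ℝ} (hh : h < 2 / (d : ℝ)) (hC₅ : 0 < C₅) :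
    ∃ b δ A : ℝ, 0 < b ∧ 0 < δ ∧ 0 < A ∧ ∀ᶠ n : ℕ in Filter.atTop, ∃ q : ℕ, q ≤ n ^ 2 ∧
      (∀ (I : Finset (ℕ × ℕ)) (x : ℕ → Lattice d) (i j : ℕ), i ≠ j →
        (∀ w, w < ⌈C₅ * (n : ℝ) ^ ((d : ℝ) - 2 - h)⌉₊ ∨ w = i ∨ w = j →
          x w ∈ boxFinset d n ∧ ∀ u < 2 * n ^ 2, (w, u) ∈ I) →
        mean (fun σ : I → Dir d => ind (¬Chain (n ^ 2) (field x σ)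
          (insert i (insert j (Finset.range ⌈C₅ * (n : ℝ) ^ ((d : ℝ) - 2 - h)⌉₊)))
          i (2 * beta d h + 1) j)) ≤ A * (n : ℝ) ^ 2 * Real.exp (-(b * (n : ℝ) ^ δ))) ∧
      ∀ (I : Finset (ℕ × ℕ)) (x : ℕ → Lattice d) (i a t : ℕ),
        (∀ u < a + q, (i, u) ∈ I) →
        (∀ w < ⌈C₅ * (n : ℝ) ^ ((d : ℝ) - 2 - h)⌉₊, ∀ u < n ^ 2, (w, u) ∈ I) →
        (∀ w ∈ (Finset.range ⌈C₅ * (n : ℝ) ^ ((d : ℝ) - 2 - h)⌉₊).erase i, x w ∈ boxFinset d n) →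
        a ≤ t → t ≤ a + q →
        mean (fun σ : I → Dir d => ind (walkPos x σ i t ∈ boxFinset d n ∧
          ∀ j ∈ (Finset.range ⌈C₅ * (n : ℝ) ^ ((d : ℝ) - 2 - h)⌉₊).erase i,
            ¬∃ u u', a ≤ u ∧ u ≤ a + q ∧ u' ≤ n ^ 2 ∧ walkPos x σ i u = walkPos x σ j u')) ≤
          decay a ^ 2 * (A * (n : ℝ) ^ (d + 2) * Real.exp (-(b * (n : ℝ) ^ δ))) := by
  obtain ⟨C₁, hC₁, c₁, hc₁, n₁, hchain⟩ := exists_chain hd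
  obtain ⟨C₂, hC₂, c₂, hc₂, n₂, hmeet⟩ := exists_meet hd
  have hd' : (3 : ℝ) ≤ d := by exact_mod_cast hd
  have hh1 : h < 1 := hh.trans_le (by rw [div_le_one (by linarith)]; linarith)
  have hβ := beta_spec hd hh
  have hgap := lt_two_mul_of_betaCondition hd hh hβ
  have hβ1 : 1 ≤ beta d h := hβ.1
  have hβ1' : (1 : ℝ) ≤ beta d h := by exact_mod_cast hβ1
  -- The exponent of generation `2β - 1` exceeds the needed one because the inequality
  -- `d - 3 < 2β (1 - h)` is strict.
  obtain ⟨δ, hδ, hδ4, hδ6, hδK⟩ : ∃ δ : ℝ, 0 < δ ∧ δ ≤ 1 / 4 ∧ 6 * δ ≤ 1 - h ∧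
      (d : ℝ) - 3 + h + 5 * δ ≤
        1 - 2 * δ + ((2 * beta d h - 1 : ℕ) : ℝ) * (1 - h - 3 * δ) := by
    set s := 2 * (beta d h : ℝ) * (1 - h) - ((d : ℝ) - 3) with hs
    have hs0 : 0 < s := by linarith
    refine ⟨min (1 / 4) (min ((1 - h) / 6) (s / (4 + 6 * beta d h))), ?_, min_le_left _ _, ?_, ?_⟩
    · have : 0 < (1 - h) / 6 := by linarith
      positivity
    · have : min (1 / 4) (min ((1 - h) / 6) (s / (4 + 6 * beta d h))) ≤ (1 - h) / 6 :=
        (min_le_right _ _).trans (min_le_left _ _)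
      linarith
    · have h1 : min (1 / 4) (min ((1 - h) / 6) (s / (4 + 6 * beta d h))) ≤ s / (4 + 6 * beta d h) :=
        (min_le_right _ _).trans (min_le_right _ _)
      rw [le_div_iff₀ (by positivity)] at h1
      rw [Nat.cast_sub (by omega)]
      push_cast
      linarith
  obtain ⟨b, hb, hpar⟩ := eventually_parameters (K := 2 * beta d h - 1) hd hδ hδ4 hδ6 hδK hC₅
    (add_pos hC₁ hC₂) hc₁
  have hKs : 2 * beta d h - 1 + 2 = 2 * beta d h + 1 := by omega
  set b' := min b (c₂ * b) with hb'
  have hb'1 : b' ≤ b := min_le_left _ _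
  have hb'2 : b' ≤ c₂ * b := min_le_right _ _
  set A := 2 * (4 * d + 1) + 2 * beta d h + 1 + 3 ^ d * C₂ * (4 * d + 2) with hA
  refine ⟨b', δ, A, by positivity, hδ, by positivity, ?_⟩
  filter_upwards [hpar, Filter.eventually_ge_atTop (n₁ + n₂ + 1)] with n ⟨l, Q, m, L, κ, hp⟩ hn
  set N := ⌈C₅ * (n : ℝ) ^ ((d : ℝ) - 2 - h)⌉₊ with hN
  have hn1 : (1 : ℝ) ≤ n := by exact_mod_cast (by omega : 1 ≤ n)
  have hn2 : (1 : ℝ) ≤ (n : ℝ) ^ 2 := one_le_pow₀ hn1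
  have hx0 : 0 ≤ (n : ℝ) ^ δ := by positivity
  set E := Real.exp (-(b' * (n : ℝ) ^ δ)) with hE
  have hE0 : 0 < E := Real.exp_pos _
  have hexp : ∀ y, b * (n : ℝ) ^ δ ≤ y → Real.exp (-y) ≤ E := by
    intro y hy
    rw [hE, Real.exp_le_exp, neg_le_neg_iff]
    exact (mul_le_mul_of_nonneg_right hb'1 hx0).trans hy
  have hseed : 2 * d * (L + 1) * Real.exp (-((n : ℝ) ^ 2 / (2 * L))) + Real.exp (-(1 / 2 * Q)) ≤
      (4 * d + 1) * (n : ℝ) ^ 2 * E := by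
    have h1 : 2 * d * (L + 1) * Real.exp (-((n : ℝ) ^ 2 / (2 * L))) ≤
        2 * d * ((n : ℝ) ^ 2 + (n : ℝ) ^ 2) * E := by
      have := hexp _ hp.le_sq_div
      have := hp.L_pos
      have := hp.L_le
      gcongr
    have h2 : Real.exp (-(1 / 2 * Q)) ≤ (n : ℝ) ^ 2 * E :=
      (hexp _ hp.le_half_Q).trans (le_mul_of_one_le_left hE0.le hn2)
    linarith
  have hκ0 : ∀ C, 0 < C → C ≤ C₁ + C₂ → κ 0 ≤ (l : ℝ) ^ (3 / 4 : ℝ) / (C * √n) := by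
    intro C hC hC'
    refine hp.κ_zero_le.trans ?_
    gcongr
  have hE2 : E ≤ (n : ℝ) ^ 2 * E := le_mul_of_one_le_left hE0.le hn2
  refine ⟨Q * l, hp.Ql_le, ?_, ?_⟩
  · intro I x i j hij hxI
    have := hchain n (by omega) I x N i j (2 * beta d h - 1) l Q m L κ hij hp.card_le hxI hp.one_le_l
      hp.L_pos hp.Ql_le_L (hp.Ql_le.trans (by omega)) hp.κ_nonneg (hκ0 C₁ hC₁ (by linarith))
      (fun g _ => hp.one_le g) (fun g _ => hp.κ_succ_le g) (fun g _ => hp.κ_succ_le' g)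
    rw [hKs] at this
    refine this.trans ?_
    have h1 := hexp _ hp.le_mul_Q
    have h2 := hexp _ hp.le_last
    have h3 : ((2 * beta d h - 1 : ℕ) : ℝ) ≤ 2 * beta d h := by
      exact_mod_cast Nat.sub_le _ _
    have h4 : ((2 * beta d h - 1 : ℕ) : ℝ) * Real.exp (-(c₁ * Q)) ≤
        2 * beta d h * ((n : ℝ) ^ 2 * E) := by
      have := h1.trans hE2
      gcongr
    have h5 : 0 ≤ 3 ^ d * C₂ * (4 * d + 2) * ((n : ℝ) ^ 2 * E) := by positivity
    rw [hA]
    linarith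
  · intro I x i a t hIi hI hx hat hta
    have := hmeet n (by omega) I i ((Finset.range N).erase i) a t l Q x L (κ 0) hp.one_le_l hp.L_pos
      hIi (fun j hj => hI j (Finset.mem_range.1 (Finset.mem_of_mem_erase hj)))
      (Finset.notMem_erase _ _) hx hat hta hp.Ql_le_L (hκ0 C₂ hC₂ (by linarith))
    refine this.trans ?_
    have hcard : (m : ℝ) ≤ ((Finset.range N).erase i).card := by
      have h1 := Finset.pred_card_le_card_erase (s := Finset.range N) (a := i)
      rw [Finset.card_range] at h1
      have h2 : m + 2 ≤ N := (Nat.le_mul_of_pos_left _ (Nat.succ_pos _)).trans hp.card_le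
      exact_mod_cast (by omega : m ≤ ((Finset.range N).erase i).card)
    have h1 : Real.exp (-(c₂ * κ 0 * (n : ℝ) ^ 2 / (n : ℝ) ^ d * ((Finset.range N).erase i).card)) ≤
        E := by
      rw [hE, Real.exp_le_exp, neg_le_neg_iff]
      have hκ := hp.κ_nonneg 0
      calc b' * (n : ℝ) ^ δ ≤ c₂ * b * (n : ℝ) ^ δ := by gcongr
        _ = c₂ * (b * (n : ℝ) ^ δ) := by ring
        _ ≤ c₂ * (κ 0 * (n : ℝ) ^ 2 / (n : ℝ) ^ d * m) :=
          mul_le_mul_of_nonneg_left hp.le_start hc₂.le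
        _ = c₂ * κ 0 * (n : ℝ) ^ 2 / (n : ℝ) ^ d * m := by ring
        _ ≤ _ := by gcongr
    have h2 : (2 * (n : ℝ) + 1) ^ d ≤ 3 ^ d * (n : ℝ) ^ d := by
      rw [← mul_pow]; gcongr; linarith
    have hdec : 0 ≤ decay a ^ 2 := sq_nonneg _
    calc _ ≤ 3 ^ d * (n : ℝ) ^ d * (C₂ * decay a ^ 2) *
          ((4 * d + 1) * (n : ℝ) ^ 2 * E + (n : ℝ) ^ 2 * E) := by
          have h6 := h1.trans hE2
          have hL := hp.L_pos
          gcongr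
      _ = decay a ^ 2 * ((3 ^ d * C₂ * (4 * d + 2)) * (n : ℝ) ^ (d + 2) * E) := by ring
      _ ≤ _ := by
          gcongr
          rw [hA]
          have : (0 : ℝ) ≤ 2 * (4 * d + 1) + 2 * beta d h + 1 := by positivity
          linarith

/-! ### The three union bounds -/

section probability
variable {Ω : Type*} [MeasurableSpace Ω] {μ : Measure Ω} [IsProbabilityMeasure μ]
  {X : ℕ → ℕ → Ω → Lattice d} {η₁ η₂ : Ω → ℕ} {y₁ y₂ e₁ e₂ e : ℝ} {n : ℕ}

theorem measurableSet_le_natCast (hη₁ : Measurable η₁) (y : ℝ) :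
    MeasurableSet {ω | y ≤ (η₁ ω : ℝ)} :=
  hη₁ (MeasurableSet.of_discrete (s := {k : ℕ | y ≤ (k : ℝ)}))

theorem measurableSet_natCast_le (hη₂ : Measurable η₂) (y : ℝ) :
    MeasurableSet {ω | (η₂ ω : ℝ) ≤ y} :=
  hη₂ (MeasurableSet.of_discrete (s := {k : ℕ | (k : ℝ) ≤ y}))

/-- The union bound over all pairs of walks. -/
theorem le_measureReal_chainConnected {K T : ℕ} (hη₁ : Measurable η₁) (hη₂ : Measurable η₂)
    (hη : ∀ ω, η₁ ω ≤ η₂ ω) (h₁ : 1 - e₁ ≤ μ.real {ω | y₁ ≤ (η₁ ω : ℝ)})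
    (h₂ : 1 - e₂ ≤ μ.real {ω | (η₂ ω : ℝ) ≤ y₂}) (hy₂ : 0 ≤ y₂) (he : 0 ≤ e)
    (hpair : ∀ i j, i ≠ j → μ.real {ω | ⌈y₁⌉₊ ≤ η₁ ω ∧ i < η₁ ω ∧ j < η₁ ω ∧
      ¬ChainConnected (fun k m => X k m ω) (η₁ ω) K T i j} ≤ e) :
    1 - (e₁ + e₂ + y₂ * (y₂ * e)) ≤ μ.real {ω | ∀ i < η₁ ω, ∀ j < η₁ ω,
      ChainConnected (fun k m => X k m ω) (η₁ ω) K T i j} := by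
  have hpair' : ∀ i j, μ.real {ω | ⌈y₁⌉₊ ≤ η₁ ω ∧ i < η₁ ω ∧ j < η₁ ω ∧
      ¬ChainConnected (fun k m => X k m ω) (η₁ ω) K T i j} ≤ e := by
    intro i j
    by_cases hij : i = j
    · have : {ω | ⌈y₁⌉₊ ≤ η₁ ω ∧ i < η₁ ω ∧ j < η₁ ω ∧
          ¬ChainConnected (fun k m => X k m ω) (η₁ ω) K T i j} = ∅ := by
        refine Set.eq_empty_of_forall_notMem ?_
        rintro ω ⟨-, hi, -, hno⟩
        exact hno ⟨fun _ => i, rfl, hij, fun _ _ => hi, fun _ _ =>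
          ⟨X i 0 ω, ⟨0, Nat.zero_le _, rfl⟩, ⟨0, Nat.zero_le _, rfl⟩⟩⟩
      rwa [this, measureReal_empty]
    · exact hpair i j hij
  refine one_sub_le_measureReal (F := ⋃ i ∈ Finset.range ⌊y₂⌋₊, ⋃ j ∈ Finset.range ⌊y₂⌋₊,
    {ω | ⌈y₁⌉₊ ≤ η₁ ω ∧ i < η₁ ω ∧ j < η₁ ω ∧
      ¬ChainConnected (fun k m => X k m ω) (η₁ ω) K T i j})
    (measurableSet_le_natCast hη₁ y₁) (measurableSet_natCast_le hη₂ y₂) h₁ h₂ ?_ ?_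
  · refine (measureReal_biUnion_range_le fun i _ =>
      measureReal_biUnion_range_le fun j _ => hpair' i j).trans ?_
    have := Nat.floor_le hy₂
    gcongr
  · intro ω hω₁ hω₂ hω
    have hex : ∃ i < η₁ ω, ∃ j < η₁ ω, ¬ChainConnected (fun k m => X k m ω) (η₁ ω) K T i j := by
      by_contra! hcon
      exact hω hcon
    obtain ⟨i, hi, j, hj, hno⟩ := hex
    have hlt : η₂ ω ≤ ⌊y₂⌋₊ := Nat.le_floor hω₂
    have := hη ω
    exact Set.mem_biUnion (Finset.mem_coe.2 (Finset.mem_range.2 (by omega)))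
      (Set.mem_biUnion (Finset.mem_coe.2 (Finset.mem_range.2 (by omega)))
        ⟨Nat.ceil_le.2 hω₁, hi, hj, hno⟩)

/-- The union bound over all walks, for the paths that begin in the box. -/
theorem le_measureReal_visited {q : ℕ} (hη₁ : Measurable η₁) (hη₂ : Measurable η₂)
    (h₁ : 1 - e₁ ≤ μ.real {ω | y₁ ≤ (η₁ ω : ℝ)})
    (h₂ : 1 - e₂ ≤ μ.real {ω | (η₂ ω : ℝ) ≤ y₂}) (hy₂ : 0 ≤ y₂) (he : 0 ≤ e) (hq : q ≤ n ^ 2)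
    (hbox : ∀ ω, ∀ k < η₂ ω, X k 0 ω ∈ box d n)
    (hmeet : ∀ i a t, a ≤ t → t ≤ a + q → μ.real {ω | ⌈y₁⌉₊ ≤ η₁ ω ∧ X i t ω ∈ box d n ∧
      ∀ j < η₁ ω, ¬∃ u u', a ≤ u ∧ u ≤ a + q ∧ u' ≤ n ^ 2 ∧ X i u ω = X j u' ω} ≤
      decay a ^ 2 * e) :
    1 - (e₁ + e₂ + y₂ * e) ≤ μ.real {ω | ∀ i < η₂ ω, ∃ j < η₁ ω,
      (visited (fun m => X i m ω) (n ^ 2) ∩ visited (fun m => X j m ω) (2 * n ^ 2)).Nonempty} := by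
  refine one_sub_le_measureReal (F := ⋃ i ∈ Finset.range ⌊y₂⌋₊,
    {ω | ⌈y₁⌉₊ ≤ η₁ ω ∧ X i 0 ω ∈ box d n ∧ ∀ j < η₁ ω,
      ¬∃ u u', 0 ≤ u ∧ u ≤ 0 + q ∧ u' ≤ n ^ 2 ∧ X i u ω = X j u' ω})
    (measurableSet_le_natCast hη₁ y₁) (measurableSet_natCast_le hη₂ y₂) h₁ h₂ ?_ ?_
  · refine (measureReal_biUnion_range_le fun i _ => (hmeet i 0 0 le_rfl (Nat.zero_le _)).trans
      (mul_le_of_le_one_left he (pow_le_one₀ (decay_pos 0).le (decay_le_one 0)))).trans ?_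
    have := Nat.floor_le hy₂
    gcongr
  · intro ω hω₁ hω₂ hω
    have hex : ∃ i < η₂ ω, ∀ j < η₁ ω, ¬(visited (fun m => X i m ω) (n ^ 2) ∩
        visited (fun m => X j m ω) (2 * n ^ 2)).Nonempty := by
      by_contra! hcon
      exact hω hcon
    obtain ⟨i, hi, hno⟩ := hex
    have hlt : η₂ ω ≤ ⌊y₂⌋₊ := Nat.le_floor hω₂
    refine Set.mem_biUnion (Finset.mem_coe.2 (Finset.mem_range.2 (by omega)))
      ⟨Nat.ceil_le.2 hω₁, hbox ω i hi, ?_⟩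
    rintro j hj ⟨u, u', -, hu, hu', h⟩
    exact hno j hj ⟨X i u ω, ⟨u, by omega, rfl⟩, ⟨u', by omega, h.symm⟩⟩

/-- The start of a window of length `q` around the time `t` inside the piece that contains `t`. -/
def windowStart (n q t : ℕ) : ℕ := min t (3 * n ^ 2 * (t / (3 * n ^ 2)) + 3 * n ^ 2 - 1 - q)

theorem windowStart_spec {n q : ℕ} (hn : 1 ≤ n) (hq : q ≤ n ^ 2) (t : ℕ) :
    windowStart n q t ≤ t ∧ t ≤ windowStart n q t + q ∧ t ≤ windowStart n q t + n ^ 2 ∧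
      3 * n ^ 2 * (t / (3 * n ^ 2)) ≤ windowStart n q t ∧
      windowStart n q t + q < 3 * n ^ 2 * (t / (3 * n ^ 2)) + 3 * n ^ 2 := by
  have hn2 : 1 ≤ n ^ 2 := Nat.one_le_pow _ _ hn
  have h1 : 3 * n ^ 2 * (t / (3 * n ^ 2)) ≤ t := Nat.mul_div_le _ _
  have h2 : t < 3 * n ^ 2 * (t / (3 * n ^ 2)) + 3 * n ^ 2 := Nat.lt_mul_div_succ t (by omega)
  unfold windowStart
  generalize 3 * n ^ 2 * (t / (3 * n ^ 2)) = s at h1 h2 ⊢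
  generalize n ^ 2 = r at hq hn2 h2 ⊢
  omega

/-- The union bound over all walks and all times at which a walk is in the box. -/
theorem le_measureReal_piece {q : ℕ} (hη₁ : Measurable η₁) (hη₂ : Measurable η₂)
    (h₁ : 1 - e₁ ≤ μ.real {ω | y₁ ≤ (η₁ ω : ℝ)})
    (h₂ : 1 - e₂ ≤ μ.real {ω | (η₂ ω : ℝ) ≤ y₂}) (hy₂ : 0 ≤ y₂) (he : 0 ≤ e) (hn : 1 ≤ n)
    (hq : q ≤ n ^ 2)
    (hmeet : ∀ i a t, a ≤ t → t ≤ a + q → μ.real {ω | ⌈y₁⌉₊ ≤ η₁ ω ∧ X i t ω ∈ box d n ∧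
      ∀ j < η₁ ω, ¬∃ u u', a ≤ u ∧ u ≤ a + q ∧ u' ≤ n ^ 2 ∧ X i u ω = X j u' ω} ≤
      decay a ^ 2 * e) :
    1 - (e₁ + e₂ + y₂ * ((∑' t : ℕ, 4 * ((t + 1 : ℕ) : ℝ) ^ (-(3 / 2) : ℝ)) * e)) ≤
      μ.real {ω | ∀ i < η₂ ω, ∀ m ∈ returnPieces (fun t => X i t ω) n, ∃ j < η₁ ω,
        (piece (fun t => X i t ω) n m ∩ visited (fun t => X j t ω) (2 * n ^ 2)).Nonempty} := by
  have hS0 : 0 ≤ ∑' t : ℕ, 4 * ((t + 1 : ℕ) : ℝ) ^ (-(3 / 2) : ℝ) :=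
    tsum_nonneg fun t => by positivity
  have hsum : Summable fun t : ℕ => 4 * ((t + 1 : ℕ) : ℝ) ^ (-(3 / 2) : ℝ) :=
    summable_decay_sq.mul_left 4
  refine one_sub_le_measureReal (F := ⋃ i ∈ Finset.range ⌊y₂⌋₊, ⋃ t : ℕ,
    {ω | 3 * n ^ 2 ≤ t ∧ ⌈y₁⌉₊ ≤ η₁ ω ∧ X i t ω ∈ box d n ∧ ∀ j < η₁ ω,
      ¬∃ u u', windowStart n q t ≤ u ∧ u ≤ windowStart n q t + q ∧ u' ≤ n ^ 2 ∧
        X i u ω = X j u' ω})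
    (measurableSet_le_natCast hη₁ y₁) (measurableSet_natCast_le hη₂ y₂) h₁ h₂ ?_ ?_
  · refine (measureReal_biUnion_range_le (e :=
      (∑' t : ℕ, 4 * ((t + 1 : ℕ) : ℝ) ^ (-(3 / 2) : ℝ)) * e) fun i _ => ?_).trans
      (mul_le_mul_of_nonneg_right (Nat.floor_le hy₂) (mul_nonneg hS0 he))
    rw [← tsum_mul_right]
    refine measureReal_iUnion_le_tsum (fun t => by positivity) (hsum.mul_right _) fun t => ?_
    obtain ⟨hw1, hw2, hw3, -⟩ := windowStart_spec hn hq t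
    by_cases ht : 3 * n ^ 2 ≤ t
    · refine (measureReal_mono fun ω hω => hω.2).trans
        ((hmeet i (windowStart n q t) t hw1 hw2).trans ?_)
      exact mul_le_mul_of_nonneg_right (decay_sq_le (by omega)) he
    · simp only [ht, false_and, Set.ofPred_false, measureReal_empty]
      positivity
  · intro ω hω₁ hω₂ hω
    have hex : ∃ i < η₂ ω, ∃ m ∈ returnPieces (fun t => X i t ω) n, ∀ j < η₁ ω,
        ¬(piece (fun t => X i t ω) n m ∩ visited (fun t => X j t ω) (2 * n ^ 2)).Nonempty := by
      by_contra! hcon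
      exact hω hcon
    obtain ⟨i, hi, m, ⟨hm, _, ⟨t, ht1, ht2, rfl⟩, htbox⟩, hno⟩ := hex
    have hlt : η₂ ω ≤ ⌊y₂⌋₊ := Nat.le_floor hω₂
    have h3 : 3 * m * n ^ 2 = 3 * n ^ 2 * m := by ring
    have h4 : 3 * (m + 1) * n ^ 2 = 3 * n ^ 2 * m + 3 * n ^ 2 := by ring
    have hdiv : t / (3 * n ^ 2) = m := by
      refine Nat.div_eq_of_lt_le ?_ ?_
      · rw [mul_comm m]; omega
      · rw [mul_comm, Nat.mul_succ]; omega
    obtain ⟨-, -, -, hw4, hw5⟩ := windowStart_spec hn hq t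
    rw [hdiv] at hw4 hw5
    have h5 : 3 * n ^ 2 ≤ 3 * n ^ 2 * m := Nat.le_mul_of_pos_right _ hm
    refine Set.mem_biUnion (Finset.mem_coe.2 (Finset.mem_range.2 (by omega)))
      (Set.mem_iUnion.2 ⟨t, by omega, Nat.ceil_le.2 hω₁, htbox, ?_⟩)
    rintro j hj ⟨u, u', hu1, hu2, hu', h⟩
    exact hno j hj ⟨X i u ω, ⟨u, by omega, by omega, rfl⟩, ⟨u', by omega, h.symm⟩⟩
end probability

theorem rpow_mul_mul_exp_eq {x : ℝ} (hx : 0 < x) (C M S A E : ℝ) :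
    C * x ^ M * (S * (A * x ^ (d + 2) * E)) = C * S * A * x ^ (M + (d + 2)) * E := by
  have h1 : x ^ (M + ((d : ℝ) + 2)) = x ^ M * x ^ (d + 2) := by
    rw [Real.rpow_add hx, ← Real.rpow_natCast _ (d + 2)]; push_cast; rfl
  rw [h1]
  ring

end WalkIntersections

theorem proposition4p2 (d : ℕ) (hd : 3 ≤ d) (h : ℝ) (hh : h < 2 / (d : ℝ))
    (M C₅ C₆ : ℝ) (hM : 0 < M) (hC₅ : 0 < C₅) (hC₆ : 0 < C₆)
    (ε₁ ε₂ : ℕ → ℝ) (hε₁ : WalkIntersections.SESmall ε₁) (hε₂ : WalkIntersections.SESmall ε₂) :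
    ∃ ε : ℕ → ℝ, WalkIntersections.SESmall ε ∧
      ∀ (Ω : Type*) [MeasurableSpace Ω] (μ : Measure Ω) [IsProbabilityMeasure μ]
        (n : ℕ) (η₁ η₂ : Ω → ℕ) (X : ℕ → ℕ → Ω → WalkIntersections.Lattice d),
        1 ≤ n →
        Measurable η₁ → Measurable η₂ → (∀ ω, η₁ ω ≤ η₂ ω) →
        1 - ε₁ n ≤ μ.real {ω | C₅ * (n : ℝ) ^ ((d : ℝ) - 2 - h) ≤ (η₁ ω : ℝ)} →
        1 - ε₂ n ≤ μ.real {ω | (η₂ ω : ℝ) ≤ C₆ * (n : ℝ) ^ M} →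
        WalkIntersections.IndepSimpleRandomWalks μ X →
        (∀ ω, ∀ k < η₂ ω, X k 0 ω ∈ WalkIntersections.box d n) →
          1 - ε n ≤ μ.real {ω | ∀ i < η₁ ω, ∀ j < η₁ ω,
              WalkIntersections.ChainConnected (fun k m => X k m ω) (η₁ ω)
                (2 * WalkIntersections.beta d h + 1) (2 * n ^ 2) i j} ∧
          1 - ε n ≤ μ.real {ω | ∀ i < η₂ ω, ∃ j < η₁ ω,
              (WalkIntersections.visited (fun m => X i m ω) (n ^ 2) ∩
                WalkIntersections.visited (fun m => X j m ω) (2 * n ^ 2)).Nonempty} ∧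
          1 - ε n ≤ μ.real {ω | ∀ i < η₂ ω,
              ∀ m ∈ WalkIntersections.returnPieces (fun t => X i t ω) n, ∃ j < η₁ ω,
                (WalkIntersections.piece (fun t => X i t ω) n m ∩
                  WalkIntersections.visited (fun t => X j t ω) (2 * n ^ 2)).Nonempty} := by
  open WalkIntersections in
  have : NeZero d := ⟨by omega⟩
  obtain ⟨b, δ, A, hb, hδ, hA, hev⟩ := exists_model_bounds hd hh hC₅
  obtain ⟨n₀, hn₀⟩ := Filter.eventually_atTop.1 (((hev.and
    (eventually_rpow_mul_exp_le (C₆ ^ 2 * A) (2 * M + 2) hb hδ)).and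
    (eventually_rpow_mul_exp_le (C₆ * 1 * A) (M + (d + 2)) hb hδ)).and
    (eventually_rpow_mul_exp_le (C₆ * (∑' t : ℕ, 4 * ((t + 1 : ℕ) : ℝ) ^ (-(3 / 2) : ℝ)) * A)
      (M + (d + 2)) hb hδ))
  refine ⟨fun n => if n < n₀ then 1 else ε₁ n + ε₂ n + Real.exp (-(b / 2 * (n : ℝ) ^ δ)),
    ((hε₁.add hε₂).add (sesmall_exp (half_pos hb) hδ)).ite n₀, ?_⟩
  intro Ω _ μ _ n η₁ η₂ X hn hη₁ hη₂ hη h₁ h₂ hX hbox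
  by_cases hnn : n < n₀
  · simp only [hnn, if_true, sub_self]
    exact ⟨measureReal_nonneg, measureReal_nonneg, measureReal_nonneg⟩
  simp only [hnn, if_false]
  obtain ⟨⟨⟨⟨q, hq, hchain, hmeet⟩, e₁⟩, e₂⟩, e₃⟩ := hn₀ n (not_lt.1 hnn)
  have hn0 : (0 : ℝ) < n := by exact_mod_cast hn
  have meet : ∀ i a t, a ≤ t → t ≤ a + q →
      μ.real {ω | ⌈C₅ * (n : ℝ) ^ ((d : ℝ) - 2 - h)⌉₊ ≤ η₁ ω ∧ X i t ω ∈ box d n ∧ ∀ j < η₁ ω,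
        ¬∃ u u', a ≤ u ∧ u ≤ a + q ∧ u' ≤ n ^ 2 ∧ X i u ω = X j u' ω} ≤
      decay a ^ 2 * (A * (n : ℝ) ^ (d + 2) * Real.exp (-(b * (n : ℝ) ^ δ))) := by
    intro i a t hat hta
    generalize ⌈C₅ * (n : ℝ) ^ ((d : ℝ) - 2 - h)⌉₊ = N at hmeet
    have hIi : ∀ u < a + q, (i, u) ∈ insert i (Finset.range N) ×ˢ Finset.range (a + q + n ^ 2) :=
      fun u hu => Finset.mk_mem_product (Finset.mem_insert_self _ _)
        (Finset.mem_range.2 (by omega))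
    have hI : ∀ w < N, ∀ u < n ^ 2,
        (w, u) ∈ insert i (Finset.range N) ×ˢ Finset.range (a + q + n ^ 2) :=
      fun w hw u hu => Finset.mk_mem_product
        (Finset.mem_insert_of_mem (Finset.mem_range.2 hw)) (Finset.mem_range.2 (by omega))
    exact measureReal_no_meet_le hX hη hbox (by positivity) hta hIi hI
      fun x hx => hmeet _ x i a t hIi hI hx hat hta
  refine ⟨le_trans ?_ (le_measureReal_chainConnected (e := A * (n : ℝ) ^ 2 *
      Real.exp (-(b * (n : ℝ) ^ δ))) hη₁ hη₂ hη h₁ h₂ (by positivity) (by positivity) ?_),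
    le_trans ?_ (le_measureReal_visited hη₁ hη₂ h₁ h₂ (by positivity) (by positivity) hq hbox meet),
    le_trans ?_ (le_measureReal_piece hη₁ hη₂ h₁ h₂ (by positivity) (by positivity) hn hq meet)⟩
  · have : C₆ * (n : ℝ) ^ M * (C₆ * (n : ℝ) ^ M * (A * (n : ℝ) ^ 2 *
        Real.exp (-(b * (n : ℝ) ^ δ)))) =
        C₆ ^ 2 * A * (n : ℝ) ^ (2 * M + 2) * Real.exp (-(b * (n : ℝ) ^ δ)) := by
      rw [Real.rpow_add hn0, two_mul, Real.rpow_add hn0, Real.rpow_ofNat]; ring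
    rw [this]
    linarith
  · intro i j hij
    generalize ⌈C₅ * (n : ℝ) ^ ((d : ℝ) - 2 - h)⌉₊ = N at hchain
    have hI : ∀ w, w < N ∨ w = i ∨ w = j → ∀ u < 2 * n ^ 2,
        (w, u) ∈ insert i (insert j (Finset.range N)) ×ˢ Finset.range (2 * n ^ 2) := by
      intro w hw u hu
      refine Finset.mk_mem_product ?_ (Finset.mem_range.2 hu)
      simp only [Finset.mem_insert, Finset.mem_range]
      tauto
    exact measureReal_not_chainConnected_le hX hη hbox (by positivity) hI
      fun x hx => hchain _ x i j hij fun w hw => ⟨hx w hw, hI w hw⟩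
  · have := rpow_mul_mul_exp_eq (d := d) hn0 C₆ M 1 A (Real.exp (-(b * (n : ℝ) ^ δ)))
    rw [one_mul] at this
    rw [this]
    linarith
  · rw [rpow_mul_mul_exp_eq hn0]
    linarith
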